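/- Let $\beta\in(0,1)$ and $p\in(0,2/(1+\beta))$. For $\epsilon\in(0,1)$ put \[ \bar h_\epsilon(\xi):=\int_0^\xi\frac{\beta}{\epsilon^{(1-\beta)/2}+|\eta|^{1-\beta}}\,d\eta,\qquad \xi\in\mathbb{R}. \] (1) Let $\mu_1\ge 0$ (transport term absent if $\mu_1=0$, of the wrong sign if $\mu_1>0$). Then for every $\epsilon\in(0,1)$ there exist a non-negative smooth function $g_\epsilon$ with $\|g_\epsilon\|_{L^p(0,T)}\le 1$ for every $T>0$, and a classical solution $\mathcal V_\epsilon$ on $[0,\infty)\times\mathbb{R}$, even in $\xi$ and bounded on $[0,T]\times\mathbb{R}$ for every $T>0$, of \[ \partial_t\mathcal V_\epsilon-4\,\partial_\xi^2\mathcal V_\epsilon+\mu_1 g_\epsilon(t)\bar h_\epsilon(\xi)\,\partial_\xi\mathcal V_\epsilon=g_\epsilon(t)\bar h_\epsilon'(\xi)\,\mathcal V_\epsilon\quad (t>0,\ \xi\in\mathbb{R}),\qquad \mathcal V_\epsilon(0,\xi)=e^{-\xi^2/\epsilon}, \] and there is a constant $C>0$, independent of $\epsilon$ and $T$, such that for all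 $\epsilon\in(0,1)$ and all $T\ge\epsilon$ \[ \int_0^T\|\mathcal V_\epsilon(t,\cdot)\|_{L^\infty(\mathbb{R})}\,dt\ \ge\ C\,\epsilon^{-1}. \] In particular, for every $q\in[1,\infty]$ and every $T>0$, the norms $\|\mathcal V_\epsilon\|_{L^q(0,T;L^\infty(\mathbb{R}))}$ are not bounded uniformly in $\epsilon\in(0,1)$. (2) The associated non-local problem has no minimum principle: for all $k_1\ge 0$ and $k_2>0$ there exist $\epsilon\in(0,1)$, a non-negative smooth function $g$ with $\|g\|_{L^p(0,T)}\le1$ for every $T>0$, and a classical solution $\Omega$, continuous on $[0,\infty)\times[0,\infty)$ and bounded on $[0,T]\times[0,\infty)$ for every $T>0$, of \[ \partial_t\Omega-4\,\partial_\xi^2\Omega=g(t)\int_0^\xi\bar h_\epsilon'(\eta)\,\partial_\eta\Omega(t,\eta)\,d\eta+k_1\quad (t,\xi>0), \] with $\Omega(0,\xi)\ge0$ for all $\xi\ge0$ and $\Omega(t,0)=tk_1+k_2$ for all $t\ge0$, such that $\Omega(t,\xi)<0$ for some $t>0$ and $\xi>0$. Here a classical solution is a function that is continuous up to $t=0$,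 whose derivatives $\partial_t$, $\partial_\xi$, $\partial_\xi^2$ exist and are continuous for $t>0$ (and $\xi\in\mathbb{R}$, respectively $\xi>0$), and that satisfies the equation pointwise there. -/

import Mathlib

open MeasureTheory Set
open scoped ContDiff ENNReal

namespace DriftExample

/-- The regularised power `ξ ↦ ∫₀^ξ β / (ε^((1-β)/2) + |η|^(1-β)) dη`. -/
noncomputable def hBar (β ε ξ : ℝ) : ℝ :=
  ∫ η in (0 : ℝ)..ξ, β / (ε ^ ((1 - β) / 2) + |η| ^ (1 - β))

/-- Smooth non-negative `g` whose `L^p(0,T)` norm is at most `1` for every `T > 0`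
(for `p < 1` this is the usual quasi-norm `(∫₀ᵀ |g|^p)^(1/p)`). -/
structure IsAdmissibleCoeff (p : ℝ) (g : ℝ → ℝ) : Prop where
  smooth : ContDiff ℝ ∞ g
  nonneg : ∀ t, 0 ≤ g t
  norm_le : ∀ T : ℝ, 0 < T →
    eLpNorm g (ENNReal.ofReal p) (volume.restrict (Ioo 0 T)) ≤ 1

/-- `u` has continuous derivatives `∂ₜu`, `∂_ξ u`, `∂²_ξ u` on `(0,∞) × I`, with `I` open. -/
structure IsC12 (I : Set ℝ) (u : ℝ → ℝ → ℝ) : Prop where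
  diff_time : ∀ t > 0, ∀ ξ ∈ I, DifferentiableAt ℝ (fun s => u s ξ) t
  diff_space : ∀ t > 0, ∀ ξ ∈ I, DifferentiableAt ℝ (u t) ξ
  diff_space_two : ∀ t > 0, ∀ ξ ∈ I, DifferentiableAt ℝ (deriv (u t)) ξ
  cont_time : ContinuousOn (fun z : ℝ × ℝ => deriv (fun s => u s z.2) z.1) (Ioi 0 ×ˢ I)
  cont_space : ContinuousOn (fun z : ℝ × ℝ => deriv (u z.1) z.2) (Ioi 0 ×ˢ I)
  cont_space_two : ContinuousOn (fun z : ℝ × ℝ => deriv (deriv (u z.1)) z.2) (Ioi 0 ×ˢ I)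

/-- `u` is bounded on `[0,T] × J` for every finite `T`. -/
def IsLocBounded (J : Set ℝ) (u : ℝ → ℝ → ℝ) : Prop :=
  ∀ T : ℝ, ∃ M : ℝ, ∀ t ∈ Icc 0 T, ∀ ξ ∈ J, |u t ξ| ≤ M

/-- Classical solution on `[0,∞) × ℝ`, bounded on bounded time intervals, of
`∂ₜV - 4 ∂²_ξ V + μ₁ g(t) h(ξ) ∂_ξ V = g(t) h'(ξ) V`, `V(0,ξ) = exp(-ξ²/ε)`, `h = hBar β ε`. -/
structure IsSolution (β ε μ₁ : ℝ) (g : ℝ → ℝ) (V : ℝ → ℝ → ℝ) : Prop where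
  cont : ContinuousOn (fun z : ℝ × ℝ => V z.1 z.2) (Ici 0 ×ˢ univ)
  bounded : IsLocBounded univ V
  regular : IsC12 univ V
  eqn : ∀ t > 0, ∀ ξ : ℝ,
    deriv (fun s => V s ξ) t - 4 * deriv (deriv (V t)) ξ
        + μ₁ * g t * hBar β ε ξ * deriv (V t) ξ
      = g t * deriv (hBar β ε) ξ * V t ξ
  init : ∀ ξ : ℝ, V 0 ξ = Real.exp (-ξ ^ 2 / ε)

/-- Classical solution on `[0,∞) × [0,∞)`, bounded on bounded time intervals, of the non-local
equation `∂ₜΩ - 4 ∂²_ξ Ω = g(t) ∫₀^ξ h'(η) ∂_ηΩ(t,η) dη + k`, with `h = hBar β ε`. -/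
structure IsNonlocalSolution (β ε k : ℝ) (g : ℝ → ℝ) (Ω : ℝ → ℝ → ℝ) : Prop where
  cont : ContinuousOn (fun z : ℝ × ℝ => Ω z.1 z.2) (Ici 0 ×ˢ Ici 0)
  bounded : IsLocBounded (Ici 0) Ω
  regular : IsC12 (Ioi 0) Ω
  integrable : ∀ t > 0, ∀ ξ > 0,
    IntervalIntegrable (fun η => deriv (hBar β ε) η * deriv (Ω t) η) volume 0 ξ
  eqn : ∀ t > 0, ∀ ξ > 0,
    deriv (fun s => Ω s ξ) t - 4 * deriv (deriv (Ω t)) ξ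
      = g t * (∫ η in (0 : ℝ)..ξ, deriv (hBar β ε) η * deriv (Ω t) η) + k

end DriftExample

open Filter Topology ProbabilityTheory
open scoped NNReal

namespace DriftExample

/-! ### The heat semigroup of `4 ∂²` and Duhamel integrals -/

/-- The heat semigroup generated by `4 ∂²`, written with a fixed Gaussian measure. -/
noncomputable def heat (τ : ℝ) (f : ℝ → ℝ) (ξ : ℝ) : ℝ :=
  ∫ z, f (ξ + √τ * z) ∂gaussianReal 0 8

/-- The Duhamel integral of a source vanishing at non-positive times. -/
noncomputable def duhamel (F : ℝ → ℝ → ℝ) (t ξ : ℝ) : ℝ :=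
  ∫ q : ℝ × ℝ, F (t - q.1) (ξ + √q.1 * q.2)
    ∂((volume.restrict (Ioi (0 : ℝ))).prod (gaussianReal 0 8))

/-- Continuous sources of quadratic growth vanishing at non-positive times. -/
structure IsSource (F : ℝ → ℝ → ℝ) : Prop where
  cont : Continuous fun z : ℝ × ℝ => F z.1 z.2
  zero : ∀ s ≤ 0, ∀ ξ, F s ξ = 0
  growth : ∃ C, ∀ s ξ, |F s ξ| ≤ C * (1 + ξ ^ 2)

lemma integrable_affine_abs_pow (a b : ℝ) (n : ℕ) :
    Integrable (fun z : ℝ => (a + b * |z|) ^ n) (gaussianReal 0 8) := by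
  have h1 : MemLp (fun z : ℝ => a + b * |z|) (n : ℝ≥0∞) (gaussianReal 0 8) := by
    have h2 : MemLp (fun z : ℝ => z) (n : ℝ≥0∞) (gaussianReal 0 8) :=
      memLp_id_gaussianReal' _ (by simp)
    exact (memLp_const a).add (h2.norm.const_mul b)
  rcases Nat.eq_zero_or_pos n with rfl | hn
  · simp
  · have := h1.integrable_norm_pow hn.ne'
    refine this.mono' (by fun_prop) (Eventually.of_forall fun z => ?_)
    simp

lemma sq_add_sqrt_mul_le {X M ξ τ z : ℝ} (hτ0 : 0 ≤ τ) (hτ : τ ≤ M) (hξ : |ξ| ≤ X) :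
    (ξ + √τ * z) ^ 2 ≤ 2 * X ^ 2 + 2 * M * z ^ 2 := by
  have h1 : ξ ^ 2 ≤ X ^ 2 := sq_le_sq' (by linarith [neg_abs_le ξ]) ((le_abs_self ξ).trans hξ)
  have h2 : (√τ * z) ^ 2 ≤ M * z ^ 2 := by
    rw [mul_pow, Real.sq_sqrt hτ0]; gcongr
  nlinarith [sq_nonneg (ξ - √τ * z)]

/-- The dominating function used for Duhamel integrals. -/
noncomputable def duhamelBound (C X M : ℝ) (q : ℝ × ℝ) : ℝ :=
  (Iic M).indicator (fun _ => (1 : ℝ)) q.1 * (C * (1 + (2 * X ^ 2 + 2 * M * q.2 ^ 2)))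

lemma integrable_duhamelBound (C X M : ℝ) :
    Integrable (duhamelBound C X M)
      ((volume.restrict (Ioi (0 : ℝ))).prod (gaussianReal 0 8)) := by
  refine Integrable.mul_prod (f := (Iic M).indicator (fun _ => (1 : ℝ)))
    (g := fun z => C * (1 + (2 * X ^ 2 + 2 * M * z ^ 2))) ?_ ?_
  · rw [integrable_indicator_iff measurableSet_Iic]
    refine integrableOn_const ?_
    rw [Measure.restrict_apply measurableSet_Iic, Iic_inter_Ioi]
    simp
  · have := integrable_affine_abs_pow 0 1 2
    simp only [zero_add, one_mul, sq_abs] at this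
    exact ((integrable_const _).add ((integrable_const _).add (this.const_mul _))).const_mul _

/-- Delays `q.1 > M ≥ t` sample the source at negative times, where it vanishes; the remaining
delays are bounded, so quadratic growth is integrable against the Gaussian. -/
lemma norm_duhamel_integrand_le {F : ℝ → ℝ → ℝ} {C : ℝ} (hF0 : ∀ s ≤ 0, ∀ ξ, F s ξ = 0)
    (hC : ∀ s ξ, |F s ξ| ≤ C * (1 + ξ ^ 2)) {t ξ X M : ℝ} (ht : t ≤ M) (hξ : |ξ| ≤ X) :
    ∀ᵐ q : ℝ × ℝ ∂((volume.restrict (Ioi (0 : ℝ))).prod (gaussianReal 0 8)),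
      ‖F (t - q.1) (ξ + √q.1 * q.2)‖ ≤ duhamelBound C X M q := by
  have hC0 : 0 ≤ C := by simpa using (abs_nonneg _).trans (hC 0 0)
  have h : ∀ᵐ q : ℝ × ℝ ∂((volume.restrict (Ioi (0 : ℝ))).prod (gaussianReal 0 8)), 0 < q.1 :=
    Measure.quasiMeasurePreserving_fst.ae (ae_restrict_mem measurableSet_Ioi)
  filter_upwards [h] with q hq
  unfold duhamelBound
  by_cases hM : q.1 ≤ M
  · rw [indicator_of_mem (by exact hM), one_mul, Real.norm_eq_abs]
    refine (hC _ _).trans ?_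
    gcongr
    exact sq_add_sqrt_mul_le hq.le hM hξ
  · rw [indicator_of_notMem (by exact hM), zero_mul, hF0 _ (by linarith)]
    simp

lemma IsSource.integrable {F : ℝ → ℝ → ℝ} (hF : IsSource F) (t ξ : ℝ) :
    Integrable (fun q : ℝ × ℝ => F (t - q.1) (ξ + √q.1 * q.2))
      ((volume.restrict (Ioi (0 : ℝ))).prod (gaussianReal 0 8)) := by
  obtain ⟨C, hC⟩ := hF.growth
  have hc := hF.cont
  exact (integrable_duhamelBound C |ξ| t).mono' (by fun_prop)
    (norm_duhamel_integrand_le hF.zero hC le_rfl le_rfl)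

lemma IsSource.continuous_duhamel {F : ℝ → ℝ → ℝ} (hF : IsSource F) :
    Continuous fun z : ℝ × ℝ => duhamel F z.1 z.2 := by
  obtain ⟨C, hC⟩ := hF.growth
  have hc := hF.cont
  rw [continuous_iff_continuousAt]
  intro z₀
  have hev : ∀ᶠ z : ℝ × ℝ in 𝓝 z₀, z.1 < z₀.1 + 1 ∧ |z.2| < |z₀.2| + 1 := by
    have h1 : ContinuousAt (fun z : ℝ × ℝ => z.1) z₀ := by fun_prop
    have h2 : ContinuousAt (fun z : ℝ × ℝ => |z.2|) z₀ := by fun_prop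
    exact (h1.eventually_lt continuousAt_const (by simp)).and
      (h2.eventually_lt continuousAt_const (by simp))
  unfold duhamel
  refine continuousAt_of_dominated (bound := duhamelBound C (|z₀.2| + 1) (z₀.1 + 1))
    (Eventually.of_forall fun z => by fun_prop) ?_ (integrable_duhamelBound _ _ _)
    (Eventually.of_forall fun q => by fun_prop)
  filter_upwards [hev] with z hz
  exact norm_duhamel_integrand_le hF.zero hC hz.1.le hz.2.le

/-- The source vanishes at non-positive times, so the delay integral has no moving endpoint and the
time derivative falls on the source alone. -/
lemma IsSource.hasDerivAt_duhamel_time {F Ft : ℝ → ℝ → ℝ} (hF : IsSource F) (hFt : IsSource Ft)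
    (hd : ∀ s ξ, HasDerivAt (fun r => F r ξ) (Ft s ξ) s) (t ξ : ℝ) :
    HasDerivAt (fun s => duhamel F s ξ) (duhamel Ft t ξ) t := by
  obtain ⟨C, hC⟩ := hFt.growth
  have hc := hF.cont
  have hct := hFt.cont
  unfold duhamel
  refine (hasDerivAt_integral_of_dominated_loc_of_deriv_le (s := Iio (t + 1))
    (bound := duhamelBound C |ξ| (t + 1))
    (F' := fun s (q : ℝ × ℝ) => Ft (s - q.1) (ξ + √q.1 * q.2)) (Iio_mem_nhds (by linarith))
    (Eventually.of_forall fun s => by fun_prop) (hF.integrable t ξ) (by fun_prop) ?_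
    (integrable_duhamelBound _ _ _) ?_).2
  · have h : ∀ᵐ q : ℝ × ℝ ∂((volume.restrict (Ioi (0 : ℝ))).prod (gaussianReal 0 8)), 0 < q.1 :=
      Measure.quasiMeasurePreserving_fst.ae (ae_restrict_mem measurableSet_Ioi)
    have hC0 : 0 ≤ C := by simpa using (abs_nonneg _).trans (hC 0 0)
    filter_upwards [h] with q hq s hs
    have hs' : s < t + 1 := hs
    unfold duhamelBound
    by_cases hM : q.1 ≤ t + 1
    · rw [indicator_of_mem (by exact hM), one_mul, Real.norm_eq_abs]
      refine (hC _ _).trans ?_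
      gcongr
      exact sq_add_sqrt_mul_le hq.le hM le_rfl
    · rw [indicator_of_notMem (by exact hM), zero_mul, hFt.zero _ (by linarith)]
      simp
  · refine Eventually.of_forall fun q s _ => ?_
    exact (hd (s - q.1) (ξ + √q.1 * q.2)).comp_sub_const s q.1

lemma IsSource.hasDerivAt_duhamel_space {F F1 : ℝ → ℝ → ℝ} (hF : IsSource F) (hF1 : IsSource F1)
    (hd : ∀ s ξ, HasDerivAt (F s) (F1 s ξ) ξ) (t ξ : ℝ) :
    HasDerivAt (duhamel F t) (duhamel F1 t ξ) ξ := by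
  obtain ⟨C, hC⟩ := hF1.growth
  have hc := hF.cont
  have hc1 := hF1.cont
  have hC0 : 0 ≤ C := by simpa using (abs_nonneg _).trans (hC 0 0)
  have h : ∀ᵐ q : ℝ × ℝ ∂((volume.restrict (Ioi (0 : ℝ))).prod (gaussianReal 0 8)), 0 < q.1 :=
    Measure.quasiMeasurePreserving_fst.ae (ae_restrict_mem measurableSet_Ioi)
  have := (hasDerivAt_integral_of_dominated_loc_of_deriv_le (x₀ := ξ)
    (s := {y : ℝ | |y| < |ξ| + 1})
    (μ := (volume.restrict (Ioi (0 : ℝ))).prod (gaussianReal 0 8))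
    (bound := duhamelBound C (|ξ| + 1) t)
    (F := fun y (q : ℝ × ℝ) => F (t - q.1) (y + √q.1 * q.2))
    (F' := fun y (q : ℝ × ℝ) => F1 (t - q.1) (y + √q.1 * q.2))
    ((isOpen_lt (by fun_prop) (by fun_prop)).mem_nhds (by simp))
    (Eventually.of_forall fun s => by fun_prop) (hF.integrable t ξ) (by fun_prop) ?_
    (integrable_duhamelBound _ _ _) ?_).2
  · exact this
  · filter_upwards [h] with q hq y hy
    have hy' : |y| < |ξ| + 1 := hy
    unfold duhamelBound
    by_cases hM : q.1 ≤ t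
    · rw [indicator_of_mem (by exact hM), one_mul, Real.norm_eq_abs]
      refine (hC _ _).trans ?_
      gcongr
      exact sq_add_sqrt_mul_le hq.le hM hy'.le
    · rw [indicator_of_notMem (by exact hM), zero_mul, hF1.zero _ (by linarith)]
      simp
  · refine Eventually.of_forall fun q y _ => ?_
    exact (hd (t - q.1) (y + √q.1 * q.2)).comp_add_const y _

lemma duhamel_of_nonpos {F : ℝ → ℝ → ℝ} (hF : IsSource F) {t : ℝ} (ht : t ≤ 0) (ξ : ℝ) :
    duhamel F t ξ = 0 := by
  have h : ∀ᵐ q : ℝ × ℝ ∂((volume.restrict (Ioi (0 : ℝ))).prod (gaussianReal 0 8)), 0 < q.1 :=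
    Measure.quasiMeasurePreserving_fst.ae (ae_restrict_mem measurableSet_Ioi)
  unfold duhamel
  refine integral_eq_zero_of_ae ?_
  filter_upwards [h] with q hq
  exact hF.zero _ (by linarith) _

lemma duhamel_eq_intervalIntegral {F : ℝ → ℝ → ℝ} (hF : IsSource F) {t : ℝ} (ht : 0 ≤ t) (ξ : ℝ) :
    duhamel F t ξ = ∫ τ in (0 : ℝ)..t, heat τ (F (t - τ)) ξ := by
  unfold duhamel
  rw [integral_prod _ (hF.integrable t ξ), intervalIntegral.integral_of_le ht]
  refine setIntegral_eq_of_subset_of_forall_sdiff_eq_zero measurableSet_Ioi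
    (fun x hx => hx.1) fun x hx => ?_
  have : t < x := by
    by_contra hcon
    exact hx.2 ⟨hx.1, not_lt.1 hcon⟩
  simp [hF.zero (t - x) (by linarith)]

/-! ### Gaussian integration by parts and Duhamel's formula -/

lemma hasDerivAt_gaussianPDFReal (x : ℝ) :
    HasDerivAt (gaussianPDFReal 0 8) (-(x / 8) * gaussianPDFReal 0 8 x) x := by
  have h : HasDerivAt (fun x : ℝ => (√(2 * Real.pi * (8 : ℝ≥0)))⁻¹ *
      Real.exp (-(x - 0) ^ 2 / (2 * (8 : ℝ≥0)))) _ x :=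
    (((((hasDerivAt_id x).sub_const 0).pow 2).neg.div_const (2 * ((8 : ℝ≥0) : ℝ))).exp).const_mul _
  rw [gaussianPDFReal_def]
  refine h.congr_deriv ?_
  simp
  ring

/-- Gaussian integration by parts. -/
lemma integral_mul_id_gaussianReal {f f' : ℝ → ℝ} (hf : ∀ x, HasDerivAt f (f' x) x)
    (hint : Integrable (fun x => f x * x) (gaussianReal 0 8))
    (hint' : Integrable f' (gaussianReal 0 8)) (hint₀ : Integrable f (gaussianReal 0 8)) :
    ∫ z, f z * z ∂gaussianReal 0 8 = 8 * ∫ z, f' z ∂gaussianReal 0 8 := by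
  have h8 : (8 : ℝ≥0) ≠ 0 := by norm_num
  have key : ∀ k : ℝ → ℝ, Integrable k (gaussianReal 0 8) →
      Integrable (fun x => k x * gaussianPDFReal 0 8 x) := by
    intro k hk
    rw [gaussianReal_of_var_ne_zero _ h8, integrable_withDensity_iff_integrable_smul'
      (measurable_gaussianPDF 0 8) (Eventually.of_forall fun x => gaussianPDF_lt_top)] at hk
    simpa [toReal_gaussianPDF, mul_comm] using hk
  rw [integral_gaussianReal_eq_integral_smul h8, integral_gaussianReal_eq_integral_smul h8]
  have := integral_mul_deriv_eq_deriv_mul_of_integrable (u := f) (v := gaussianPDFReal 0 8)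
    (u' := f') (v' := fun x => -(x / 8) * gaussianPDFReal 0 8 x) (fun x _ => hf x)
    (fun x _ => hasDerivAt_gaussianPDFReal x) ?_ (key _ hint') (key _ hint₀)
  · simp only [smul_eq_mul]
    have e1 : ∫ x, gaussianPDFReal 0 8 x * (f x * x)
        = (-8) * ∫ x, f x * (-(x / 8) * gaussianPDFReal 0 8 x) := by
      rw [← integral_const_mul]; congr 1; ext x; ring
    rw [e1, this, neg_mul_neg]
    congr 2; ext x; ring
  · refine ((key _ hint).const_mul (-1 / 8)).congr (Eventually.of_forall fun x => ?_)
    simp only [Pi.mul_apply]; ring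

lemma heat_zero (f : ℝ → ℝ) (ξ : ℝ) : heat 0 f ξ = f ξ := by simp [heat]

lemma heat_zero_fun (τ ξ : ℝ) : heat τ (fun _ => 0) ξ = 0 := by simp [heat]

/-- A majorant uniform in `τ ≤ T` whose shape is covered by `integrable_affine_abs_pow`. -/
lemma sq_growth_le_pow_three {ξ T τ z C x : ℝ} (hτ : τ ≤ T) (hC : 0 ≤ C)
    (h : x ≤ C * (1 + (ξ + √τ * z) ^ 2)) :
    x ≤ C * (1 + |ξ| + √T * |z|) ^ 3 := by
  refine h.trans ?_
  gcongr
  have h1 : |ξ + √τ * z| ≤ |ξ| + √T * |z| := by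
    refine (abs_add_le _ _).trans ?_
    rw [abs_mul, abs_of_nonneg (Real.sqrt_nonneg τ)]
    gcongr
  have h0 : 0 ≤ |ξ| + √T * |z| := by positivity
  rw [← sq_abs, add_assoc]
  set a := |ξ| + √T * |z|
  have : |ξ + √τ * z| ^ 2 ≤ a ^ 2 := by gcongr
  nlinarith [pow_nonneg h0 3, pow_nonneg h0 2]

/-- The function `τ ↦ P_τ F(t - τ)` is continuous. -/
lemma continuousOn_heat {F : ℝ → ℝ → ℝ} (hF : Continuous fun z : ℝ × ℝ => F z.1 z.2) {t C : ℝ}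
    (hC : ∀ s ∈ Icc 0 t, ∀ ξ, |F s ξ| ≤ C * (1 + ξ ^ 2)) (ξ : ℝ) :
    ContinuousOn (fun τ => heat τ (F (t - τ)) ξ) (Icc 0 t) := by
  unfold heat
  refine continuousOn_of_dominated (bound := fun z => C * (1 + |ξ| + √t * |z|) ^ 3)
    (fun τ _ => by fun_prop) (fun τ hτ => Eventually.of_forall fun z => ?_)
    ((integrable_affine_abs_pow _ _ _).const_mul _) (Eventually.of_forall fun z => ?_)
  · have hs : t - τ ∈ Icc 0 t := ⟨by linarith [hτ.2], by linarith [hτ.1]⟩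
    have hC0 : 0 ≤ C := by simpa using (abs_nonneg _).trans (hC _ hs 0)
    exact sq_growth_le_pow_three hτ.2 hC0 (hC _ hs _)
  · fun_prop

lemma integrable_heat {f : ℝ → ℝ} (hf : Continuous f) {C : ℝ}
    (hC : ∀ ξ, |f ξ| ≤ C * (1 + ξ ^ 2)) (τ ξ : ℝ) :
    Integrable (fun z => f (ξ + √τ * z)) (gaussianReal 0 8) := by
  have hC0 : 0 ≤ C := by simpa using (abs_nonneg _).trans (hC 0)
  refine ((integrable_affine_abs_pow (1 + |ξ|) (√τ) 3).const_mul C).mono' (by fun_prop)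
    (Eventually.of_forall fun z => ?_)
  exact sq_growth_le_pow_three le_rfl hC0 (hC _)

/-- Functions that are `C¹` in time and `C²` in space, with the given derivatives. -/
structure IsRegular (K Kt K1 K2 : ℝ → ℝ → ℝ) : Prop where
  cont : Continuous fun z : ℝ × ℝ => K z.1 z.2
  cont_t : Continuous fun z : ℝ × ℝ => Kt z.1 z.2
  cont_1 : Continuous fun z : ℝ × ℝ => K1 z.1 z.2
  cont_2 : Continuous fun z : ℝ × ℝ => K2 z.1 z.2
  deriv_t : ∀ s ξ, HasDerivAt (fun r => K r ξ) (Kt s ξ) s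
  deriv_1 : ∀ s ξ, HasDerivAt (K s) (K1 s ξ) ξ
  deriv_2 : ∀ s ξ, HasDerivAt (K1 s) (K2 s ξ) ξ

/-- Continuous partial derivatives give joint strict differentiability, hence the chain rule along a
curve moving in time and space together. -/
lemma IsRegular.hasDerivAt_comp {K Kt K1 K2 : ℝ → ℝ → ℝ} (h : IsRegular K Kt K1 K2)
    {a b : ℝ → ℝ} {a' b' x : ℝ} (ha : HasDerivAt a a' x) (hb : HasDerivAt b b' x) :
    HasDerivAt (fun x => K (a x) (b x)) (Kt (a x) (b x) * a' + K1 (a x) (b x) * b') x := by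
  have hs := hasStrictFDerivAt_uncurry_coprod (𝕜 := ℝ) (u := (a x, b x)) (f := K)
    (f₁ := fun s ξ => ContinuousLinearMap.toSpanSingleton ℝ (Kt s ξ))
    (f₂ := fun s ξ => ContinuousLinearMap.toSpanSingleton ℝ (K1 s ξ))
    (Eventually.of_forall fun v => (h.deriv_t v.1 v.2).hasFDerivAt)
    (Eventually.of_forall fun v => (h.deriv_1 v.1 v.2).hasFDerivAt)
    (by
      have := h.cont_t
      exact ((ContinuousLinearMap.toSpanSingletonCLE (𝕜 := ℝ) (E := ℝ)).continuous.comp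
        this).continuousAt)
    (by
      have := h.cont_1
      exact ((ContinuousLinearMap.toSpanSingletonCLE (𝕜 := ℝ) (E := ℝ)).continuous.comp
        this).continuousAt)
  have := hs.hasFDerivAt.comp_hasDerivAt x (ha.prodMk hb)
  refine this.congr_deriv ?_
  simp [Function.HasUncurry.uncurry, mul_comm]

/-- Differentiating `√τ` produces `K1 * z / (2√τ)`. Integration by parts against the Gaussian of
variance 8 turns the mean of `K1 * z` into `8√τ` times the mean of `K2`, so the total is `4 * K2`.
-/
lemma IsRegular.hasDerivAt_heat {K Kt K1 K2 : ℝ → ℝ → ℝ} (h : IsRegular K Kt K1 K2) {t C : ℝ}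
    (hC : ∀ s ∈ Icc 0 t, ∀ ξ, |K s ξ| ≤ C * (1 + ξ ^ 2) ∧ |Kt s ξ| ≤ C * (1 + ξ ^ 2) ∧
      |K1 s ξ| ≤ C * (1 + ξ ^ 2) ∧ |K2 s ξ| ≤ C * (1 + ξ ^ 2))
    {τ : ℝ} (hτ : τ ∈ Ioo 0 t) (ξ : ℝ) :
    HasDerivAt (fun τ => heat τ (K (t - τ)) ξ)
      (heat τ (fun y => 4 * K2 (t - τ) y - Kt (t - τ) y) ξ) τ := by
  have hc := h.cont
  have hct := h.cont_t
  have hc1 := h.cont_1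
  have hc2 := h.cont_2
  have hmem : ∀ {r}, r ∈ Ioo 0 t → t - r ∈ Icc 0 t := fun hr =>
    ⟨by linarith [hr.2], by linarith [hr.1]⟩
  have hC0 : 0 ≤ C := by simpa using (abs_nonneg _).trans (hC _ (hmem hτ) 0).1
  have hτ0 : 0 < √τ := Real.sqrt_pos.2 hτ.1
  -- Restricting to `r > τ/2` keeps `1/√r` bounded; the extra factor `z` raises the cubic majorant
  -- to a fourth power.
  have hd := hasDerivAt_integral_of_dominated_loc_of_deriv_le (x₀ := τ) (μ := gaussianReal 0 8)
    (s := Ioo (τ / 2) t) (F := fun r z => K (t - r) (ξ + √r * z))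
    (F' := fun r z => Kt (t - r) (ξ + √r * z) * (-1)
      + K1 (t - r) (ξ + √r * z) * (1 / (2 * √r) * z))
    (bound := fun z => C * (1 + |ξ| + (√t + 1 / √(τ / 2)) * |z|) ^ 4)
    (Ioo_mem_nhds (by linarith [hτ.1]) hτ.2) (Eventually.of_forall fun r => by fun_prop)
    (integrable_heat (by fun_prop) (fun y => (hC _ (hmem hτ) y).1) τ ξ) (by fun_prop)
    (Eventually.of_forall fun z r hr => ?_)
    ((integrable_affine_abs_pow _ _ _).const_mul _)
    (Eventually.of_forall fun z r hr => ?_)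
  · unfold heat
    refine hd.2.congr_deriv ?_
    have i1 := integrable_heat (f := Kt (t - τ)) (by fun_prop)
      (fun y => (hC _ (hmem hτ) y).2.1) τ ξ
    have i2 := integrable_heat (f := K2 (t - τ)) (by fun_prop)
      (fun y => (hC _ (hmem hτ) y).2.2.2) τ ξ
    have i3 := integrable_heat (f := K1 (t - τ)) (by fun_prop)
      (fun y => (hC _ (hmem hτ) y).2.2.1) τ ξ
    -- Removing the `Kt` part from the already integrable derivative avoids a separate moment bound.
    have i4 : Integrable (fun z => K1 (t - τ) (ξ + √τ * z) * z) (gaussianReal 0 8) := by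
      have := (hd.1.add i1).const_mul (2 * √τ)
      refine this.congr (Eventually.of_forall fun z => ?_)
      simp only [Pi.add_apply]
      field_simp
      ring
    have ibp := integral_mul_id_gaussianReal (f := fun z => K1 (t - τ) (ξ + √τ * z))
      (f' := fun z => K2 (t - τ) (ξ + √τ * z) * √τ)
      (fun z => ((h.deriv_2 (t - τ) (ξ + √τ * z)).comp z
        (((hasDerivAt_id z).const_mul (√τ)).const_add ξ)).congr_deriv (by ring))
      i4 (i2.mul_const _) i3
    have e1 : ∫ z, (Kt (t - τ) (ξ + √τ * z) * (-1)
        + K1 (t - τ) (ξ + √τ * z) * (1 / (2 * √τ) * z)) ∂gaussianReal 0 8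
        = ∫ z, ((-1) * Kt (t - τ) (ξ + √τ * z)
          + 1 / (2 * √τ) * (K1 (t - τ) (ξ + √τ * z) * z)) ∂gaussianReal 0 8 := by
      congr 1; ext z; ring
    rw [e1, integral_add (i1.const_mul _) (i4.const_mul _), integral_const_mul,
      integral_const_mul, ibp, integral_mul_const, integral_sub (i2.const_mul _) i1,
      integral_const_mul]
    field_simp
    ring
  · have hr' : r ∈ Ioo 0 t := ⟨by linarith [hτ.1, hr.1], hr.2⟩
    obtain ⟨-, b1, b2, -⟩ := hC _ (hmem hr') (ξ + √r * z)
    have b1' := sq_growth_le_pow_three hr'.2.le hC0 b1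
    have b2' := sq_growth_le_pow_three hr'.2.le hC0 b2
    have hsr : 1 / (2 * √r) ≤ 1 / √(τ / 2) := by
      have h2 : 0 < √(τ / 2) := Real.sqrt_pos.2 (by linarith [hτ.1])
      have h3 : √(τ / 2) ≤ √r := Real.sqrt_le_sqrt hr.1.le
      gcongr
      linarith
    have hA : 0 ≤ 1 + |ξ| + √t * |z| := by positivity
    have hB : |1 / (2 * √r) * z| ≤ 1 / √(τ / 2) * |z| := by
      rw [abs_mul, abs_of_nonneg (by positivity)]
      gcongr
    calc ‖Kt (t - r) (ξ + √r * z) * (-1) + K1 (t - r) (ξ + √r * z) * (1 / (2 * √r) * z)‖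
        ≤ C * (1 + |ξ| + √t * |z|) ^ 3
          + C * (1 + |ξ| + √t * |z|) ^ 3 * (1 / √(τ / 2) * |z|) := by
          refine (norm_add_le _ _).trans ?_
          simp only [Real.norm_eq_abs, abs_mul (Kt _ _), abs_mul (K1 _ _)]
          rw [abs_neg, abs_one, mul_one]
          gcongr
      _ = C * ((1 + |ξ| + √t * |z|) ^ 3 * (1 + 1 / √(τ / 2) * |z|)) := by ring
      _ ≤ C * ((1 + |ξ| + (√t + 1 / √(τ / 2)) * |z|) ^ 3
          * (1 + |ξ| + (√t + 1 / √(τ / 2)) * |z|)) := by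
          have h4 : 0 ≤ 1 / √(τ / 2) * |z| := by positivity
          have h5 : 0 ≤ |ξ| + √t * |z| := by positivity
          have h6 : 0 ≤ √t * |z| := by positivity
          have h7 : 0 ≤ |ξ| := abs_nonneg ξ
          rw [add_mul (√t)]
          refine mul_le_mul_of_nonneg_left (mul_le_mul (pow_le_pow_left₀ hA ?_ 3) ?_ ?_ ?_) hC0
          · linarith
          · linarith
          · linarith
          · positivity
      _ = _ := by ring
  · have hr' : 0 < r := by linarith [hτ.1, hr.1]
    have hsq : HasDerivAt (fun r => ξ + √r * z) (1 / (2 * √r) * z) r :=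
      ((Real.hasDerivAt_sqrt hr'.ne').mul_const z).const_add ξ
    exact h.hasDerivAt_comp ((hasDerivAt_id r).const_sub t) hsq

/-- Duhamel's formula for smooth functions. -/
lemma IsRegular.intervalIntegral_heat {K Kt K1 K2 : ℝ → ℝ → ℝ} (h : IsRegular K Kt K1 K2)
    {t C : ℝ} (ht : 0 ≤ t)
    (hC : ∀ s ∈ Icc 0 t, ∀ ξ, |K s ξ| ≤ C * (1 + ξ ^ 2) ∧ |Kt s ξ| ≤ C * (1 + ξ ^ 2) ∧
      |K1 s ξ| ≤ C * (1 + ξ ^ 2) ∧ |K2 s ξ| ≤ C * (1 + ξ ^ 2)) (ξ : ℝ) :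
    ∫ τ in (0 : ℝ)..t, heat τ (fun y => 4 * K2 (t - τ) y - Kt (t - τ) y) ξ
      = heat t (K 0) ξ - K t ξ := by
  have hct := h.cont_t
  have hc2 := h.cont_2
  have hC0 : 0 ≤ C := by simpa using (abs_nonneg _).trans (hC 0 ⟨le_rfl, ht⟩ 0).1
  rw [intervalIntegral.integral_eq_sub_of_hasDerivAt_of_le ht
    (continuousOn_heat h.cont (fun s hs y => (hC s hs y).1) ξ)
    (fun τ hτ => h.hasDerivAt_heat hC hτ ξ)]
  · simp [heat_zero]
  · refine ContinuousOn.intervalIntegrable ?_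
    rw [uIcc_of_le ht]
    refine continuousOn_heat (F := fun s y => 4 * K2 s y - Kt s y) (C := 5 * C) (by fun_prop) ?_ ξ
    intro s hs y
    obtain ⟨-, b1, -, b2⟩ := hC s hs y
    rw [abs_le] at *
    constructor <;> nlinarith

/-- A source dominated by `w_t - 4 w''` has Duhamel integral dominated by `w`. -/
lemma IsRegular.abs_duhamel_le {w wt w1 w2 : ℝ → ℝ → ℝ} (h : IsRegular w wt w1 w2)
    {t C : ℝ} (ht : 0 ≤ t) (hw : ∀ ξ, 0 ≤ w 0 ξ)
    (hC : ∀ s ∈ Icc 0 t, ∀ ξ, |w s ξ| ≤ C * (1 + ξ ^ 2) ∧ |wt s ξ| ≤ C * (1 + ξ ^ 2) ∧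
      |w1 s ξ| ≤ C * (1 + ξ ^ 2) ∧ |w2 s ξ| ≤ C * (1 + ξ ^ 2))
    {F : ℝ → ℝ → ℝ} (hF : IsSource F) {M : ℝ} (hM : 0 ≤ M)
    (hFw : ∀ s ∈ Icc 0 t, ∀ ξ, |F s ξ| ≤ M * (wt s ξ - 4 * w2 s ξ)) (ξ : ℝ) :
    |duhamel F t ξ| ≤ M * w t ξ := by
  have hct := h.cont_t
  have hc2 := h.cont_2
  have hcF := hF.cont
  have hC0 : 0 ≤ C := by simpa using (abs_nonneg _).trans (hC 0 ⟨le_rfl, ht⟩ 0).1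
  have hG : ∀ s ∈ Icc 0 t, ∀ y, |M * (wt s y - 4 * w2 s y)| ≤ (M * (5 * C)) * (1 + y ^ 2) := by
    intro s hs y
    obtain ⟨-, b1, -, b2⟩ := hC s hs y
    rw [abs_mul, abs_of_nonneg hM, mul_assoc]
    gcongr
    rw [abs_le] at *
    constructor <;> nlinarith
  have hFG : ∀ s ∈ Icc 0 t, ∀ y, |F s y| ≤ (M * (5 * C)) * (1 + y ^ 2) := fun s hs y =>
    (hFw s hs y).trans ((le_abs_self _).trans (hG s hs y))
  have hs : ∀ {τ}, τ ∈ Icc 0 t → t - τ ∈ Icc 0 t := fun hr =>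
    ⟨by linarith [hr.2], by linarith [hr.1]⟩
  rw [duhamel_eq_intervalIntegral hF ht]
  have hcont : ContinuousOn (fun τ => heat τ (fun y => M * (wt (t - τ) y - 4 * w2 (t - τ) y)) ξ)
      (uIcc 0 t) := by
    rw [uIcc_of_le ht]
    exact continuousOn_heat (F := fun s y => M * (wt s y - 4 * w2 s y)) (by fun_prop) hG ξ
  have hle : |∫ τ in (0 : ℝ)..t, heat τ (F (t - τ)) ξ|
      ≤ ∫ τ in (0 : ℝ)..t, heat τ (fun y => M * (wt (t - τ) y - 4 * w2 (t - τ) y)) ξ := by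
    rw [← Real.norm_eq_abs]
    refine intervalIntegral.norm_integral_le_of_norm_le ht
      (Eventually.of_forall fun τ hτ => ?_) hcont.intervalIntegrable
    have hτ' : τ ∈ Icc 0 t := ⟨hτ.1.le, hτ.2⟩
    unfold heat
    refine norm_integral_le_of_norm_le
      (integrable_heat (f := fun y => M * (wt (t - τ) y - 4 * w2 (t - τ) y)) (by fun_prop)
        (hG _ (hs hτ')) τ ξ) (Eventually.of_forall fun z => hFw _ (hs hτ') _)
  refine hle.trans ?_
  -- By Duhamel's formula the majorant equals `M` times the difference of `w t` and `heat t (w 0)`;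
  -- the second term is non-negative and can be dropped.
  have e : ∫ τ in (0 : ℝ)..t, heat τ (fun y => M * (wt (t - τ) y - 4 * w2 (t - τ) y)) ξ
      = (-M) * ∫ τ in (0 : ℝ)..t, heat τ (fun y => 4 * w2 (t - τ) y - wt (t - τ) y) ξ := by
    rw [← intervalIntegral.integral_const_mul]
    congr 1; ext τ
    unfold heat
    rw [← integral_const_mul]
    congr 1; ext z; ring
  rw [e, h.intervalIntegral_heat ht hC]
  have : 0 ≤ heat t (w 0) ξ := integral_nonneg fun z => hw _
  nlinarith [mul_nonneg hM this]

/-! ### Space primitives and regularity of Duhamel integrals -/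

/-- The primitive in the space variable. -/
noncomputable def prim (F : ℝ → ℝ → ℝ) (s ξ : ℝ) : ℝ := ∫ η in (0 : ℝ)..ξ, F s η

lemma continuous_prim {F : ℝ → ℝ → ℝ} (hF : Continuous fun z : ℝ × ℝ => F z.1 z.2) :
    Continuous fun z : ℝ × ℝ => prim F z.1 z.2 := by
  unfold prim
  exact intervalIntegral.continuous_parametric_intervalIntegral_of_continuous
    (f := fun (z : ℝ × ℝ) η => F z.1 η) (by unfold Function.uncurry; fun_prop) continuous_snd

lemma hasDerivAt_prim {F : ℝ → ℝ → ℝ} {s : ℝ} (hF : Continuous (F s)) (ξ : ℝ) :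
    HasDerivAt (prim F s) (F s ξ) ξ :=
  intervalIntegral.integral_hasDerivAt_right (hF.intervalIntegrable _ _)
    (hF.stronglyMeasurableAtFilter _ _) hF.continuousAt

/-- Differentiation of a space primitive with respect to time. -/
lemma hasDerivAt_prim_time {F Ft : ℝ → ℝ → ℝ} {S : Set ℝ} (hS : IsOpen S)
    (hF : ContinuousOn (fun z : ℝ × ℝ => F z.1 z.2) (S ×ˢ univ))
    (hFt : ContinuousOn (fun z : ℝ × ℝ => Ft z.1 z.2) (S ×ˢ univ))
    (hd : ∀ s ∈ S, ∀ ξ, HasDerivAt (fun r => F r ξ) (Ft s ξ) s) {s : ℝ} (hs : s ∈ S) (ξ : ℝ) :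
    HasDerivAt (fun r => prim F r ξ) (prim Ft s ξ) s := by
  obtain ⟨δ, hδ, hball⟩ := Metric.isOpen_iff.1 hS s hs
  have hsub : Metric.closedBall s (δ / 2) ⊆ S :=
    (Metric.closedBall_subset_ball (by linarith)).trans hball
  obtain ⟨C, hC⟩ := ((isCompact_closedBall s (δ / 2)).prod (isCompact_uIcc (a := 0) (b := ξ))
    ).exists_bound_of_continuousOn (hFt.mono (prod_mono hsub (subset_univ _)))
  have slice : ∀ {G : ℝ → ℝ → ℝ}, ContinuousOn (fun z : ℝ × ℝ => G z.1 z.2) (S ×ˢ univ) →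
      ∀ {r}, r ∈ S → Continuous (G r) := fun hG r hr => by
    rw [← continuousOn_univ]
    exact hG.comp (f := fun y => (r, y)) (by fun_prop) fun y _ => ⟨hr, mem_univ _⟩
  unfold prim
  refine (intervalIntegral.hasDerivAt_integral_of_dominated_loc_of_deriv_le
    (s := Metric.closedBall s (δ / 2)) (bound := fun _ => C)
    (Metric.closedBall_mem_nhds s (by linarith)) ?_
    ((slice hF hs).intervalIntegrable _ _) (slice hFt hs).aestronglyMeasurable ?_
    (by simp) ?_).2
  · filter_upwards [hS.mem_nhds hs] with r hr using (slice hF hr).aestronglyMeasurable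
  · exact Eventually.of_forall fun y hy r hr => hC (r, y) ⟨hr, uIoc_subset_uIcc hy⟩
  · exact Eventually.of_forall fun y _ r hr => hd r (hsub hr) y

lemma abs_prim_le {F : ℝ → ℝ → ℝ} {s C : ℝ} (hC : ∀ ξ, |F s ξ| ≤ C) (ξ : ℝ) :
    |prim F s ξ| ≤ C * |ξ| := by
  have := intervalIntegral.norm_integral_le_of_norm_le_const (a := (0 : ℝ)) (b := ξ) (f := F s)
    (C := C) (fun x _ => hC x)
  simpa [prim] using this

lemma abs_prim_prim_le {F : ℝ → ℝ → ℝ} {s C : ℝ} (hC : ∀ ξ, |F s ξ| ≤ C) (ξ : ℝ) :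
    |prim (prim F) s ξ| ≤ C * ξ ^ 2 := by
  have hC0 : 0 ≤ C := (abs_nonneg _).trans (hC 0)
  have := intervalIntegral.norm_integral_le_of_norm_le_const (a := (0 : ℝ)) (b := ξ)
    (f := prim F s) (C := C * |ξ|) (fun x hx => (abs_prim_le hC x).trans (by
      refine mul_le_mul_of_nonneg_left ?_ hC0
      have := uIoc_subset_uIcc hx
      rcases le_total 0 ξ with h | h
      · rw [uIcc_of_le h] at this
        rw [abs_of_nonneg this.1, abs_of_nonneg h]; exact this.2
      · rw [uIcc_of_ge h] at this
        rw [abs_of_nonpos this.2, abs_of_nonpos h]; linarith [this.1]))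
  rw [← sq_abs]
  simpa [prim, mul_assoc, sq] using this

/-- Bounded sources that are `C¹` in time. -/
structure IsSmoothSource (F Ft : ℝ → ℝ → ℝ) : Prop where
  cont : Continuous fun z : ℝ × ℝ => F z.1 z.2
  cont_t : Continuous fun z : ℝ × ℝ => Ft z.1 z.2
  zero : ∀ s ≤ 0, ∀ ξ, F s ξ = 0
  zero_t : ∀ s ≤ 0, ∀ ξ, Ft s ξ = 0
  bound : ∃ C, ∀ s ξ, |F s ξ| ≤ C
  bound_t : ∃ C, ∀ s ξ, |Ft s ξ| ≤ C
  deriv_t : ∀ s ξ, HasDerivAt (fun r => F r ξ) (Ft s ξ) s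

lemma isSource_of_bound {F : ℝ → ℝ → ℝ} (hF : Continuous fun z : ℝ × ℝ => F z.1 z.2)
    (h0 : ∀ s ≤ 0, ∀ ξ, F s ξ = 0) {C : ℝ} (hC : ∀ s ξ, |F s ξ| ≤ C) : IsSource F :=
  ⟨hF, h0, C, fun s ξ => (hC s ξ).trans (by nlinarith [(abs_nonneg _).trans (hC s ξ), sq_nonneg ξ])⟩

lemma isSource_prim {F : ℝ → ℝ → ℝ} (hF : Continuous fun z : ℝ × ℝ => F z.1 z.2)
    (h0 : ∀ s ≤ 0, ∀ ξ, F s ξ = 0) {C : ℝ} (hC : ∀ s ξ, |F s ξ| ≤ C) : IsSource (prim F) :=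
  ⟨continuous_prim hF, fun s hs ξ => by simp [prim, h0 s hs], C, fun s ξ =>
    (abs_prim_le (hC s) ξ).trans (by
      gcongr
      · exact (abs_nonneg _).trans (hC s ξ)
      · rw [← sq_abs]; nlinarith [sq_nonneg (|ξ| - 1)])⟩

lemma isSource_prim_prim {F : ℝ → ℝ → ℝ} (hF : Continuous fun z : ℝ × ℝ => F z.1 z.2)
    (h0 : ∀ s ≤ 0, ∀ ξ, F s ξ = 0) {C : ℝ} (hC : ∀ s ξ, |F s ξ| ≤ C) :
    IsSource (prim (prim F)) :=
  ⟨continuous_prim (continuous_prim hF), fun s hs ξ => by simp [prim, h0 s hs], C, fun s ξ =>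
    (abs_prim_prim_le (hC s) ξ).trans (by
      gcongr
      · exact (abs_nonneg _).trans (hC s ξ)
      · linarith)⟩

namespace IsSmoothSource

variable {F Ft : ℝ → ℝ → ℝ}

lemma isSource (h : IsSmoothSource F Ft) : IsSource F :=
  let ⟨_, hC⟩ := h.bound
  isSource_of_bound h.cont h.zero hC

lemma isSource_t (h : IsSmoothSource F Ft) : IsSource Ft :=
  let ⟨_, hC⟩ := h.bound_t
  isSource_of_bound h.cont_t h.zero_t hC

/-- Integrating twice in space creates the two space derivatives that `F` itself lacks, so Duhamel's
formula becomes available. -/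
lemma isRegular_prim_prim (h : IsSmoothSource F Ft) :
    IsRegular (prim (prim F)) (prim (prim Ft)) (prim F) F where
  cont := continuous_prim (continuous_prim h.cont)
  cont_t := continuous_prim (continuous_prim h.cont_t)
  cont_1 := continuous_prim h.cont
  cont_2 := h.cont
  deriv_t s ξ := hasDerivAt_prim_time isOpen_univ (continuous_prim h.cont).continuousOn
    (continuous_prim h.cont_t).continuousOn
    (fun s hs ξ => hasDerivAt_prim_time isOpen_univ h.cont.continuousOn h.cont_t.continuousOn
      (fun s _ ξ => h.deriv_t s ξ) hs ξ) (mem_univ s) ξ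
  deriv_1 s ξ := hasDerivAt_prim (by have := continuous_prim h.cont; fun_prop) ξ
  deriv_2 s ξ := hasDerivAt_prim (by have := h.cont; fun_prop) ξ

/-- The Duhamel integral in terms of space primitives of the source. -/
lemma duhamel_eq (h : IsSmoothSource F Ft) {t : ℝ} (ht : 0 ≤ t) (ξ : ℝ) :
    duhamel F t ξ = (duhamel (prim (prim Ft)) t ξ - prim (prim F) t ξ) / 4 := by
  obtain ⟨C, hC⟩ := h.bound
  obtain ⟨Ct, hCt⟩ := h.bound_t
  have sK := isSource_prim_prim h.cont h.zero hC
  have sKt := isSource_prim_prim h.cont_t h.zero_t hCt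
  have hcF := h.cont
  have hcK := sKt.cont
  have hM0 : 0 ≤ max C Ct := ((abs_nonneg _).trans (hC 0 0)).trans (le_max_left _ _)
  -- Duhamel's formula for the double primitive `K` of `F`, whose second space derivative is `F` and
  -- whose initial value is zero.
  have key := h.isRegular_prim_prim.intervalIntegral_heat (C := max C Ct) ht
    (fun s _ y => by
      have h1 : C ≤ max C Ct := le_max_left _ _
      have h2 : Ct ≤ max C Ct := le_max_right _ _
      have h3 : |y| ≤ 1 + y ^ 2 := by rw [← sq_abs]; nlinarith [sq_nonneg (|y| - 1)]
      refine ⟨(abs_prim_prim_le (hC s) y).trans ?_, (abs_prim_prim_le (hCt s) y).trans ?_,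
        (abs_prim_le (hC s) y).trans ?_, (hC s y).trans ?_⟩
      · gcongr; linarith
      · gcongr; linarith
      · gcongr
      · nlinarith [sq_nonneg y]) ξ
  have z0 : prim (prim F) 0 = fun _ => 0 := funext fun y => sK.zero 0 le_rfl y
  rw [z0, heat_zero_fun] at key
  have hs : ∀ {τ}, τ ∈ Icc 0 t → t - τ ∈ Icc 0 t := fun hr =>
    ⟨by linarith [hr.2], by linarith [hr.1]⟩
  obtain ⟨D, hD⟩ := h.isSource.growth
  obtain ⟨E, hE⟩ := sKt.growth
  have e : ∫ τ in (0 : ℝ)..t,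
      heat τ (fun y => 4 * F (t - τ) y - prim (prim Ft) (t - τ) y) ξ
      = 4 * duhamel F t ξ - duhamel (prim (prim Ft)) t ξ := by
    rw [duhamel_eq_intervalIntegral h.isSource ht, duhamel_eq_intervalIntegral sKt ht,
      ← intervalIntegral.integral_const_mul, ← intervalIntegral.integral_sub]
    · congr 1; ext τ
      unfold heat
      rw [integral_sub, integral_const_mul]
      · exact (integrable_heat (f := F (t - τ)) (by fun_prop) (hD _) _ _).const_mul 4
      · exact integrable_heat (f := prim (prim Ft) (t - τ)) (by fun_prop) (hE _) _ _
    · refine (ContinuousOn.intervalIntegrable ?_).const_mul 4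
      rw [uIcc_of_le ht]
      exact continuousOn_heat hcF (fun s _ => hD s) ξ
    · refine ContinuousOn.intervalIntegrable ?_
      rw [uIcc_of_le ht]
      exact continuousOn_heat hcK (fun s _ => hE s) ξ
  rw [e] at key
  linarith

/-- In `duhamel_eq` every space derivative lands on a primitive, so no derivative of the heat
kernel, with its time singularity, is needed. -/
lemma hasDerivAt_duhamel (h : IsSmoothSource F Ft) {t : ℝ} (ht : 0 ≤ t) (ξ : ℝ) :
    HasDerivAt (duhamel F t) ((duhamel (prim Ft) t ξ - prim F t ξ) / 4) ξ := by
  obtain ⟨Ct, hCt⟩ := h.bound_t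
  have sKt := isSource_prim_prim h.cont_t h.zero_t hCt
  have sKt1 := isSource_prim h.cont_t h.zero_t hCt
  rw [show duhamel F t = fun ξ => (duhamel (prim (prim Ft)) t ξ - prim (prim F) t ξ) / 4 from
    funext fun ξ => h.duhamel_eq ht ξ]
  exact ((sKt.hasDerivAt_duhamel_space sKt1 (fun s ξ => hasDerivAt_prim
    (by have := sKt1.cont; fun_prop) ξ) t ξ).sub (h.isRegular_prim_prim.deriv_1 t ξ)).div_const 4

/-- The resulting value, together with `hasDerivAt_duhamel_time`, is the heat equation with source
`F`. -/
lemma hasDerivAt_deriv_duhamel (h : IsSmoothSource F Ft) (t ξ : ℝ) :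
    HasDerivAt (fun ξ => (duhamel (prim Ft) t ξ - prim F t ξ) / 4)
      ((duhamel Ft t ξ - F t ξ) / 4) ξ := by
  obtain ⟨Ct, hCt⟩ := h.bound_t
  have sKt1 := isSource_prim h.cont_t h.zero_t hCt
  exact ((sKt1.hasDerivAt_duhamel_space h.isSource_t (fun s ξ => hasDerivAt_prim
    (by have := h.cont_t; fun_prop) ξ) t ξ).sub (h.isRegular_prim_prim.deriv_2 t ξ)).div_const 4

lemma continuous_deriv_duhamel (h : IsSmoothSource F Ft) :
    Continuous fun z : ℝ × ℝ => (duhamel (prim Ft) z.1 z.2 - prim F z.1 z.2) / 4 := by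
  obtain ⟨Ct, hCt⟩ := h.bound_t
  have h1 := (isSource_prim h.cont_t h.zero_t hCt).continuous_duhamel
  have h2 := continuous_prim h.cont
  fun_prop

end IsSmoothSource

/-! ### Gaussian weights -/

/-- Decay rate of the Gaussian weight. -/
noncomputable def decay (c s : ℝ) : ℝ := c * Real.exp (-(32 * c * s))

/-- A Gaussian weight which is a strict supersolution of the heat equation. -/
noncomputable def weight (c Λ s ξ : ℝ) : ℝ := Real.exp (Λ * s - decay c s * ξ ^ 2)

noncomputable def weightT (c Λ s ξ : ℝ) : ℝ :=
  (Λ + 32 * c * decay c s * ξ ^ 2) * weight c Λ s ξ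

noncomputable def weight1 (c Λ s ξ : ℝ) : ℝ := -(2 * decay c s * ξ) * weight c Λ s ξ

noncomputable def weight2 (c Λ s ξ : ℝ) : ℝ :=
  (4 * decay c s ^ 2 * ξ ^ 2 - 2 * decay c s) * weight c Λ s ξ

/-- The heat operator applied to the weight. -/
noncomputable def weightGap (c Λ s ξ : ℝ) : ℝ := weightT c Λ s ξ - 4 * weight2 c Λ s ξ

lemma weight_pos (c Λ s ξ : ℝ) : 0 < weight c Λ s ξ := Real.exp_pos _

lemma hasDerivAt_decay (c s : ℝ) : HasDerivAt (decay c) (-(32 * c * decay c s)) s := by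
  unfold decay
  exact ((((hasDerivAt_id s).const_mul (32 * c)).neg.exp).const_mul c).congr_deriv (by
    simp; ring)

lemma isRegular_weight (c Λ : ℝ) :
    IsRegular (weight c Λ) (weightT c Λ) (weight1 c Λ) (weight2 c Λ) where
  cont := by unfold weight decay; fun_prop
  cont_t := by unfold weightT weight decay; fun_prop
  cont_1 := by unfold weight1 weight decay; fun_prop
  cont_2 := by unfold weight2 weight decay; fun_prop
  deriv_t s ξ := by
    unfold weightT weight
    exact ((((hasDerivAt_id s).const_mul Λ).sub
      ((hasDerivAt_decay c s).mul_const (ξ ^ 2))).exp).congr_deriv (by simp; ring)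
  deriv_1 s ξ := by
    unfold weight1 weight
    exact (((((hasDerivAt_id ξ).pow 2).const_mul (decay c s)).const_sub (Λ * s)).exp).congr_deriv
      (by simp; ring)
  deriv_2 s ξ := by
    have h : HasDerivAt (weight c Λ s) (-(2 * decay c s * ξ) * weight c Λ s ξ) ξ := by
      unfold weight
      exact (((((hasDerivAt_id ξ).pow 2).const_mul (decay c s)).const_sub (Λ * s)).exp).congr_deriv
        (by simp; ring)
    unfold weight1 weight2
    exact ((((hasDerivAt_id ξ).const_mul (2 * decay c s)).neg).mul h).congr_deriv (by simp; ring)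

lemma decay_pos {c : ℝ} (hc : 0 < c) (s : ℝ) : 0 < decay c s := mul_pos hc (Real.exp_pos _)

lemma decay_anti {c s t : ℝ} (hc : 0 < c) (h : s ≤ t) : decay c t ≤ decay c s := by
  unfold decay; gcongr

lemma decay_le {c s : ℝ} (hc : 0 < c) (hs : 0 ≤ s) : decay c s ≤ c := by
  simpa [decay] using decay_anti hc hs

lemma weight_mono {c Λ s t : ℝ} (hc : 0 < c) (hΛ : 0 ≤ Λ) (h : s ≤ t) (ξ : ℝ) :
    weight c Λ s ξ ≤ weight c Λ t ξ := by
  have := decay_anti hc h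
  unfold weight; gcongr

lemma weight_le {c Λ s T : ℝ} (hc : 0 < c) (hΛ : 0 ≤ Λ) (h : s ≤ T) (ξ : ℝ) :
    weight c Λ s ξ ≤ Real.exp (Λ * T) * Real.exp (-decay c T * ξ ^ 2) := by
  rw [← Real.exp_add]
  have := weight_mono hc hΛ h ξ
  unfold weight at *
  rwa [neg_mul, ← sub_eq_add_neg]

lemma weight_le_exp {c Λ s T : ℝ} (hc : 0 < c) (hΛ : 0 ≤ Λ) (h : s ≤ T) (ξ : ℝ) :
    weight c Λ s ξ ≤ Real.exp (Λ * T) := by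
  refine (weight_le hc hΛ h ξ).trans (mul_le_of_le_one_right (Real.exp_pos _).le ?_)
  rw [Real.exp_le_one_iff]
  nlinarith [decay_pos hc T, sq_nonneg ξ, mul_nonneg (decay_pos hc T).le (sq_nonneg ξ)]

lemma exp_le_weight {c Λ s : ℝ} (hc : 0 < c) (hΛ : 0 ≤ Λ) (hs : 0 ≤ s) (ξ : ℝ) :
    Real.exp (-c * ξ ^ 2) ≤ weight c Λ s ξ := by
  simpa [weight, decay] using weight_mono hc hΛ hs ξ

lemma weight_growth {c Λ : ℝ} (hc : 0 < c) (hΛ : 0 ≤ Λ) (t : ℝ) :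
    ∃ C, ∀ s ∈ Icc 0 t, ∀ ξ, |weight c Λ s ξ| ≤ C * (1 + ξ ^ 2) ∧
      |weightT c Λ s ξ| ≤ C * (1 + ξ ^ 2) ∧ |weight1 c Λ s ξ| ≤ C * (1 + ξ ^ 2) ∧
      |weight2 c Λ s ξ| ≤ C * (1 + ξ ^ 2) := by
  refine ⟨(1 + Λ + 32 * c * c + 2 * c + 4 * c ^ 2) * Real.exp (Λ * t), fun s hs ξ => ?_⟩
  have hw := weight_le_exp hc hΛ hs.2 ξ
  have hw0 := weight_pos c Λ s ξ
  have hd := decay_le hc hs.1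
  have hd0 := decay_pos hc s
  have hξ := sq_nonneg ξ
  have key : ∀ a : ℝ, |a| ≤ (1 + Λ + 32 * c * c + 2 * c + 4 * c ^ 2) * (1 + ξ ^ 2) →
      |a * weight c Λ s ξ| ≤
        (1 + Λ + 32 * c * c + 2 * c + 4 * c ^ 2) * Real.exp (Λ * t) * (1 + ξ ^ 2) := by
    intro a ha
    rw [abs_mul, abs_of_pos hw0, mul_right_comm]
    gcongr
  have hd2 : decay c s * ξ ^ 2 ≤ c * ξ ^ 2 := by gcongr
  have hd3 : decay c s ^ 2 * ξ ^ 2 ≤ c ^ 2 * ξ ^ 2 := by gcongr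
  have p1 : 0 ≤ Λ * ξ ^ 2 := by positivity
  have p2 : 0 ≤ c * ξ ^ 2 := by positivity
  have p3 : 0 ≤ c ^ 2 * ξ ^ 2 := by positivity
  have p4 : 0 ≤ decay c s * ξ ^ 2 := by positivity
  have p5 : 0 ≤ decay c s ^ 2 * ξ ^ 2 := by positivity
  refine ⟨?_, key _ ?_, key _ ?_, key _ ?_⟩
  · have := key 1 (by rw [abs_one]; nlinarith)
    rwa [one_mul] at this
  · rw [abs_of_nonneg (by positivity)]
    nlinarith
  · rw [abs_neg, abs_mul, abs_of_nonneg (by positivity : 0 ≤ 2 * decay c s)]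
    have h3 : |ξ| ≤ 1 + ξ ^ 2 := by rw [← sq_abs]; nlinarith [sq_nonneg (|ξ| - 1)]
    calc 2 * decay c s * |ξ| ≤ 2 * c * (1 + ξ ^ 2) := by gcongr
      _ ≤ _ := by gcongr; nlinarith
  · rw [abs_le]
    constructor <;> nlinarith

/-- The shrinking rate contributes `32 c d ξ²` through `∂ₜ`, where `d` is the current rate, while
`4∂²` costs only `16 d² ξ²`. Since `d ≤ c`, at least half of the gain survives. -/
lemma le_weightGap {c Λ s : ℝ} (hc : 0 < c) (hs : 0 ≤ s) (ξ : ℝ) :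
    (Λ + 16 * c * decay c s * ξ ^ 2) * weight c Λ s ξ ≤ weightGap c Λ s ξ := by
  have hd := decay_le hc hs
  have hd0 := decay_pos hc s
  have : weightGap c Λ s ξ = (Λ + 8 * decay c s + 16 * (2 * c - decay c s) * decay c s * ξ ^ 2)
      * weight c Λ s ξ := by
    unfold weightGap weightT weight2; ring
  rw [this]
  have hw := (weight_pos c Λ s ξ).le
  refine mul_le_mul_of_nonneg_right ?_ hw
  have : 16 * c * decay c s * ξ ^ 2 ≤ 16 * (2 * c - decay c s) * decay c s * ξ ^ 2 := by
    gcongr; linarith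
  linarith

lemma weightGap_nonneg {c Λ s : ℝ} (hc : 0 < c) (hΛ : 0 ≤ Λ) (hs : 0 ≤ s) (ξ : ℝ) :
    0 ≤ weightGap c Λ s ξ := by
  refine le_trans ?_ (le_weightGap hc hs ξ)
  have := decay_pos hc s
  have := weight_pos c Λ s ξ
  positivity

/-- The factor `d ξ²` is absorbed by `exp (-d ξ²)` through `x ≤ exp x`. It turns weighted bounds on
sources into plain boundedness. -/
lemma exists_weightGap_le {c Λ : ℝ} (hc : 0 < c) (hΛ : 0 ≤ Λ) :
    ∃ B, ∀ s ∈ Icc (0 : ℝ) 1, ∀ ξ, weightGap c Λ s ξ ≤ B := by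
  refine ⟨(Λ + 40 * c) * Real.exp Λ, fun s hs ξ => ?_⟩
  have hd := decay_le hc hs.1
  have hd0 := decay_pos hc s
  have e1 : weightGap c Λ s ξ ≤ (Λ + 8 * decay c s) * weight c Λ s ξ
      + 32 * c * (decay c s * ξ ^ 2 * weight c Λ s ξ) := by
    have : 0 ≤ 16 * decay c s ^ 2 * ξ ^ 2 * weight c Λ s ξ := by
      have := weight_pos c Λ s ξ
      positivity
    unfold weightGap weightT weight2
    nlinarith
  have hw := weight_le_exp hc hΛ hs.2 ξ
  rw [mul_one] at hw
  have e2 : decay c s * ξ ^ 2 * weight c Λ s ξ ≤ Real.exp Λ := by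
    have h1 : decay c s * ξ ^ 2 ≤ Real.exp (decay c s * ξ ^ 2) := by
      linarith [Real.add_one_le_exp (decay c s * ξ ^ 2)]
    calc decay c s * ξ ^ 2 * weight c Λ s ξ
        ≤ Real.exp (decay c s * ξ ^ 2) * weight c Λ s ξ := by
          gcongr; exact (weight_pos _ _ _ _).le
      _ = Real.exp (Λ * s) := by unfold weight; rw [← Real.exp_add]; congr 1; ring
      _ ≤ Real.exp Λ := by
          rw [Real.exp_le_exp]; nlinarith [hs.2]
  have hw0 := weight_pos c Λ s ξ
  calc weightGap c Λ s ξ ≤ _ := e1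
    _ ≤ (Λ + 8 * c) * Real.exp Λ + 32 * c * Real.exp Λ := by gcongr
    _ = _ := by ring

lemma abs_duhamel_le_weight {c Λ : ℝ} (hc : 0 < c) (hΛ : 0 ≤ Λ) {F : ℝ → ℝ → ℝ}
    (hF : IsSource F) {M : ℝ} (hM : 0 ≤ M)
    (hFw : ∀ s ≥ 0, ∀ ξ, |F s ξ| ≤ M * weightGap c Λ s ξ) {t : ℝ} (ht : 0 ≤ t) (ξ : ℝ) :
    |duhamel F t ξ| ≤ M * weight c Λ t ξ := by
  obtain ⟨C, hC⟩ := weight_growth hc hΛ t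
  exact (isRegular_weight c Λ).abs_duhamel_le ht (fun ξ => (weight_pos _ _ _ _).le) hC hF hM
    (fun s hs ξ => hFw s hs.1 ξ) ξ

/-! ### Solvability of the heat equation with a subquadratic potential -/

/-- Potentials supported in the time interval `(0,1)`, `C¹` in time, of subquadratic growth. -/
structure IsPotential (Q Qt : ℝ → ℝ → ℝ) : Prop where
  cont : Continuous fun z : ℝ × ℝ => Q z.1 z.2
  cont_t : Continuous fun z : ℝ × ℝ => Qt z.1 z.2
  zero : ∀ s ∉ Ioo (0 : ℝ) 1, ∀ ξ, Q s ξ = 0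
  zero_t : ∀ s ∉ Ioo (0 : ℝ) 1, ∀ ξ, Qt s ξ = 0
  growth : ∀ δ > 0, ∃ C, ∀ s ξ, |Q s ξ| ≤ δ * ξ ^ 2 + C
  growth_t : ∀ δ > 0, ∃ C, ∀ s ξ, |Qt s ξ| ≤ δ * ξ ^ 2 + C
  deriv_t : ∀ s ξ, HasDerivAt (fun r => Q r ξ) (Qt s ξ) s

/-- Forcings supported in the time interval `(0,1)`, `C¹` in time, of Gaussian decay. -/
structure IsForcing (c : ℝ) (f ft : ℝ → ℝ → ℝ) : Prop where
  cont : Continuous fun z : ℝ × ℝ => f z.1 z.2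
  cont_t : Continuous fun z : ℝ × ℝ => ft z.1 z.2
  zero : ∀ s ∉ Ioo (0 : ℝ) 1, ∀ ξ, f s ξ = 0
  zero_t : ∀ s ∉ Ioo (0 : ℝ) 1, ∀ ξ, ft s ξ = 0
  bound : ∃ C, ∀ s ξ, |f s ξ| ≤ C * Real.exp (-c * ξ ^ 2)
  bound_t : ∃ C, ∀ s ξ, |ft s ξ| ≤ C * Real.exp (-c * ξ ^ 2)
  deriv_t : ∀ s ξ, HasDerivAt (fun r => f r ξ) (ft s ξ) s

open BoundedContinuousFunction in
/-- The primitive in time of `weight * u`. -/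
noncomputable def timePrim (c Λ : ℝ) (u : ℝ × ℝ →ᵇ ℝ) (s ξ : ℝ) : ℝ :=
  ∫ r in (0 : ℝ)..s, weight c Λ r ξ * u (r, ξ)

open BoundedContinuousFunction in
/-- Time derivative of the total source term. -/
noncomputable def totalSource (c Λ : ℝ) (Q Qt ft : ℝ → ℝ → ℝ) (u : ℝ × ℝ →ᵇ ℝ) (s ξ : ℝ) : ℝ :=
  ft s ξ + (Qt s ξ * timePrim c Λ u s ξ + Q s ξ * (weight c Λ s ξ * u (s, ξ)))

section

open BoundedContinuousFunction

variable {c Λ : ℝ} {Q Qt f ft : ℝ → ℝ → ℝ}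

lemma continuous_weight (c Λ : ℝ) : Continuous fun z : ℝ × ℝ => weight c Λ z.1 z.2 :=
  (isRegular_weight c Λ).cont

lemma continuous_timePrim (u : ℝ × ℝ →ᵇ ℝ) :
    Continuous fun z : ℝ × ℝ => timePrim c Λ u z.1 z.2 := by
  unfold timePrim
  have h1 := continuous_weight c Λ
  exact intervalIntegral.continuous_parametric_intervalIntegral_of_continuous
    (f := fun (z : ℝ × ℝ) r => weight c Λ r z.2 * u (r, z.2))
    (by unfold Function.uncurry; fun_prop) continuous_fst

lemma hasDerivAt_timePrim (u : ℝ × ℝ →ᵇ ℝ) (s ξ : ℝ) :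
    HasDerivAt (fun s => timePrim c Λ u s ξ) (weight c Λ s ξ * u (s, ξ)) s := by
  have h1 := continuous_weight c Λ
  have h2 : Continuous fun r => weight c Λ r ξ * u (r, ξ) := by fun_prop
  exact intervalIntegral.integral_hasDerivAt_right (h2.intervalIntegrable _ _)
    (h2.stronglyMeasurableAtFilter _ _) h2.continuousAt

lemma timePrim_sub (u v : ℝ × ℝ →ᵇ ℝ) (s ξ : ℝ) :
    timePrim c Λ u s ξ - timePrim c Λ v s ξ = timePrim c Λ (u - v) s ξ := by
  have h1 := continuous_weight c Λ
  unfold timePrim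
  rw [← intervalIntegral.integral_sub]
  · congr 1; ext r; simp; ring
  · exact Continuous.intervalIntegrable (by fun_prop) _ _
  · exact Continuous.intervalIntegrable (by fun_prop) _ _

lemma abs_weight_mul_le (u : ℝ × ℝ →ᵇ ℝ) (s ξ : ℝ) :
    |weight c Λ s ξ * u (s, ξ)| ≤ ‖u‖ * weight c Λ s ξ := by
  rw [abs_mul, abs_of_pos (weight_pos _ _ _ _), mul_comm]
  gcongr
  · exact (weight_pos _ _ _ _).le
  · exact u.norm_coe_le_norm _

lemma abs_timePrim_le (hc : 0 < c) (hΛ : 0 ≤ Λ) (u : ℝ × ℝ →ᵇ ℝ) {s : ℝ} (hs : s ∈ Icc (0 : ℝ) 1)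
    (ξ : ℝ) : |timePrim c Λ u s ξ| ≤ ‖u‖ * weight c Λ s ξ := by
  have := intervalIntegral.norm_integral_le_of_norm_le_const (a := (0 : ℝ)) (b := s)
    (f := fun r => weight c Λ r ξ * u (r, ξ)) (C := ‖u‖ * weight c Λ s ξ) (fun x hx => by
      rw [uIoc_of_le hs.1] at hx
      refine (abs_weight_mul_le u x ξ).trans ?_
      gcongr
      exact weight_mono hc hΛ hx.2 ξ)
  rw [Real.norm_eq_abs, sub_zero, abs_of_nonneg hs.1] at this
  refine this.trans (mul_le_of_le_one_right ?_ hs.2)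
  have := weight_pos c Λ s ξ
  positivity

/-- `Λ` is large enough for the potential to be absorbed by the weight. -/
def Absorbs (c Λ : ℝ) (Q Qt : ℝ → ℝ → ℝ) : Prop :=
  ∀ s ∈ Icc (0 : ℝ) 1, ∀ ξ, (|Q s ξ| + |Qt s ξ|) * weight c Λ s ξ ≤ weightGap c Λ s ξ / 2

lemma IsPotential.exists_absorbs (hQ : IsPotential Q Qt) (hc : 0 < c) :
    ∃ Λ, 1 ≤ Λ ∧ Absorbs c Λ Q Qt := by
  -- Twice `4 c * decay c 1` is half of the coefficient `16 c * decay c 1`, a lower bound for the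
  -- quadratic gain of the weight on `[0,1]`; the constants are left to `Λ`.
  have hd := decay_pos hc 1
  obtain ⟨C, hC⟩ := hQ.growth (4 * c * decay c 1) (by positivity)
  obtain ⟨Ct, hCt⟩ := hQ.growth_t (4 * c * decay c 1) (by positivity)
  refine ⟨max 1 (2 * C + 2 * Ct), le_max_left _ _, fun s hs ξ => ?_⟩
  have h1 := hC s ξ
  have h2 := hCt s ξ
  have h3 := le_weightGap (Λ := max 1 (2 * C + 2 * Ct)) hc hs.1 ξ
  have h4 : c * decay c 1 * ξ ^ 2 ≤ c * decay c s * ξ ^ 2 := by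
    have := decay_anti hc hs.2
    gcongr
  have h5 := le_max_right 1 (2 * C + 2 * Ct)
  have hw := (weight_pos c (max 1 (2 * C + 2 * Ct)) s ξ).le
  have h6 : (|Q s ξ| + |Qt s ξ|) ≤
      (max 1 (2 * C + 2 * Ct) + 16 * c * decay c s * ξ ^ 2) / 2 := by linarith
  calc _ ≤ (max 1 (2 * C + 2 * Ct) + 16 * c * decay c s * ξ ^ 2) / 2 * weight c _ s ξ := by
        gcongr
    _ ≤ _ := by linarith

/-- The factor `1/2` gained here becomes the contraction constant of the fixed point map. -/
lemma Absorbs.abs_le (hA : Absorbs c Λ Q Qt) (hQ : IsPotential Q Qt) (hc : 0 < c) (hΛ : 1 ≤ Λ)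
    {M a b s : ℝ} (ξ : ℝ) (hs : 0 ≤ s) (hM : 0 ≤ M)
    (ha : s ∈ Icc (0 : ℝ) 1 → |a| ≤ M * weight c Λ s ξ)
    (hb : s ∈ Icc (0 : ℝ) 1 → |b| ≤ M * weight c Λ s ξ) :
    |Qt s ξ * a + Q s ξ * b| ≤ M / 2 * weightGap c Λ s ξ := by
  by_cases h : s ∈ Ioo (0 : ℝ) 1
  · have h' := Ioo_subset_Icc_self h
    have h1 := hA s h' ξ
    have h2 := ha h'
    have h3 := hb h'
    calc |Qt s ξ * a + Q s ξ * b| ≤ |Qt s ξ| * |a| + |Q s ξ| * |b| := by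
          rw [← abs_mul, ← abs_mul]; exact abs_add_le _ _
      _ ≤ |Qt s ξ| * (M * weight c Λ s ξ) + |Q s ξ| * (M * weight c Λ s ξ) := by gcongr
      _ = M * ((|Q s ξ| + |Qt s ξ|) * weight c Λ s ξ) := by ring
      _ ≤ M * (weightGap c Λ s ξ / 2) := by gcongr
      _ = _ := by ring
  · rw [hQ.zero s h, hQ.zero_t s h]
    simp only [zero_mul, add_zero, abs_zero]
    have := weightGap_nonneg hc (by linarith : 0 ≤ Λ) hs ξ
    positivity

lemma abs_le_weightGap (hc : 0 < c) (hΛ : 1 ≤ Λ) {a C s : ℝ} (ξ : ℝ) (hs : 0 ≤ s)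
    (ha : |a| ≤ C * Real.exp (-c * ξ ^ 2)) : |a| ≤ C * weightGap c Λ s ξ := by
  have hC : 0 ≤ C := by
    by_contra h
    have := Real.exp_pos (-c * ξ ^ 2)
    nlinarith [abs_nonneg a]
  refine ha.trans (mul_le_mul_of_nonneg_left ?_ hC)
  have h1 := exp_le_weight (c := c) (Λ := Λ) hc (by linarith) hs ξ
  have h2 := le_weightGap (Λ := Λ) hc hs ξ
  have h3 := weight_pos c Λ s ξ
  have h4 : 0 ≤ 16 * c * decay c s * ξ ^ 2 := by have := decay_pos hc s; positivity
  nlinarith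

lemma continuous_totalSource (hQ : IsPotential Q Qt) (hf : IsForcing c f ft) (u : ℝ × ℝ →ᵇ ℝ) :
    Continuous fun z : ℝ × ℝ => totalSource c Λ Q Qt ft u z.1 z.2 := by
  have h1 := hQ.cont
  have h2 := hQ.cont_t
  have h3 := hf.cont_t
  have h4 := continuous_weight c Λ
  have h5 := continuous_timePrim (c := c) (Λ := Λ) u
  unfold totalSource
  fun_prop

lemma totalSource_eq_zero (hQ : IsPotential Q Qt) (hf : IsForcing c f ft) (u : ℝ × ℝ →ᵇ ℝ) {s : ℝ}
    (hs : s ∉ Ioo (0 : ℝ) 1) (ξ : ℝ) : totalSource c Λ Q Qt ft u s ξ = 0 := by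
  simp [totalSource, hQ.zero s hs, hQ.zero_t s hs, hf.zero_t s hs]

lemma exists_bound_of_le_weightGap (hc : 0 < c) (hΛ : 1 ≤ Λ) {F : ℝ → ℝ → ℝ} {M : ℝ} (hM : 0 ≤ M)
    (h0 : ∀ s ∉ Ioo (0 : ℝ) 1, ∀ ξ, F s ξ = 0)
    (hF : ∀ s ≥ 0, ∀ ξ, |F s ξ| ≤ M * weightGap c Λ s ξ) : ∃ C, ∀ s ξ, |F s ξ| ≤ C := by
  obtain ⟨B, hB⟩ := exists_weightGap_le hc (by linarith : 0 ≤ Λ)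
  refine ⟨M * B, fun s ξ => ?_⟩
  by_cases h : s ∈ Ioo (0 : ℝ) 1
  · exact (hF s h.1.le ξ).trans (by gcongr; exact hB s (Ioo_subset_Icc_self h) ξ)
  · rw [h0 s h, abs_zero]
    have h1 := hB 0 (by simp) 0
    have h2 := weightGap_nonneg hc (by linarith : 0 ≤ Λ) le_rfl 0
    exact mul_nonneg hM (h2.trans h1)

lemma exists_totalSource_le (hA : Absorbs c Λ Q Qt) (hQ : IsPotential Q Qt)
    (hf : IsForcing c f ft) (hc : 0 < c) (hΛ : 1 ≤ Λ) (u : ℝ × ℝ →ᵇ ℝ) :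
    ∃ M, 0 ≤ M ∧ ∀ s ≥ 0, ∀ ξ, |totalSource c Λ Q Qt ft u s ξ| ≤ M * weightGap c Λ s ξ := by
  obtain ⟨C, hC⟩ := hf.bound_t
  have hC0 : 0 ≤ C := by simpa using (abs_nonneg _).trans (hC 0 0)
  refine ⟨C + ‖u‖ / 2, by positivity, fun s hs ξ => ?_⟩
  rw [add_mul]
  exact (abs_add_le _ _).trans (add_le_add (abs_le_weightGap hc hΛ ξ hs (hC s ξ))
    (hA.abs_le hQ hc hΛ ξ hs (norm_nonneg u)
      (fun h => abs_timePrim_le hc (by linarith) u h ξ) (fun _ => abs_weight_mul_le u s ξ)))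

lemma isSource_totalSource (hA : Absorbs c Λ Q Qt) (hQ : IsPotential Q Qt)
    (hf : IsForcing c f ft) (hc : 0 < c) (hΛ : 1 ≤ Λ) (u : ℝ × ℝ →ᵇ ℝ) :
    IsSource (totalSource c Λ Q Qt ft u) := by
  obtain ⟨M, hM, hMw⟩ := exists_totalSource_le hA hQ hf hc hΛ u
  obtain ⟨C, hC⟩ := exists_bound_of_le_weightGap hc hΛ hM
    (fun s hs ξ => totalSource_eq_zero hQ hf u hs ξ) hMw
  exact isSource_of_bound (continuous_totalSource hQ hf u)
    (fun s hs ξ => totalSource_eq_zero hQ hf u (fun h => absurd h.1 (not_lt.2 hs)) ξ) hC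

/-- Projection to the unit interval. -/
noncomputable def clamp (t : ℝ) : ℝ := max 0 (min t 1)

lemma clamp_mem (t : ℝ) : clamp t ∈ Icc (0 : ℝ) 1 := by
  unfold clamp; exact ⟨le_max_left _ _, max_le zero_le_one (min_le_right _ _)⟩

lemma clamp_of_mem {t : ℝ} (ht : t ∈ Icc (0 : ℝ) 1) : clamp t = t := by
  unfold clamp; rw [min_eq_left ht.2, max_eq_right ht.1]

/-- The Duhamel fixed point equation, divided by the weight, has a solution. -/
lemma exists_fixedPoint (hA : Absorbs c Λ Q Qt) (hQ : IsPotential Q Qt)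
    (hf : IsForcing c f ft) (hc : 0 < c) (hΛ : 1 ≤ Λ) :
    ∃ u : ℝ × ℝ →ᵇ ℝ, ∀ s ∈ Icc (0 : ℝ) 1, ∀ ξ,
      weight c Λ s ξ * u (s, ξ) = duhamel (totalSource c Λ Q Qt ft u) s ξ := by
  have hΛ0 : 0 ≤ Λ := by linarith
  have hw := continuous_weight c Λ
  have hcl : Continuous clamp := by unfold clamp; fun_prop
  have hb : ∀ u : ℝ × ℝ →ᵇ ℝ, ∃ M, ∀ z : ℝ × ℝ,
      ‖duhamel (totalSource c Λ Q Qt ft u) (clamp z.1) z.2 / weight c Λ (clamp z.1) z.2‖ ≤ M := by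
    intro u
    obtain ⟨M, hM, hMw⟩ := exists_totalSource_le hA hQ hf hc hΛ u
    refine ⟨M, fun z => ?_⟩
    rw [norm_div, Real.norm_eq_abs, Real.norm_eq_abs, abs_of_pos (weight_pos _ _ _ _),
      div_le_iff₀ (weight_pos _ _ _ _)]
    exact abs_duhamel_le_weight hc hΛ0 (isSource_totalSource hA hQ hf hc hΛ u) hM hMw
      (clamp_mem _).1 _
  choose M hM using hb
  -- Clamping time to `[0,1]`, where potential and forcing live, makes the weighted Duhamel integral
  -- bounded on the whole plane.
  let Φ : (ℝ × ℝ →ᵇ ℝ) → (ℝ × ℝ →ᵇ ℝ) := fun u =>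
    BoundedContinuousFunction.ofNormedAddCommGroup _
      (by
        have h := (isSource_totalSource hA hQ hf hc hΛ u).continuous_duhamel
        exact Continuous.div (f := fun z : ℝ × ℝ =>
          duhamel (totalSource c Λ Q Qt ft u) (clamp z.1) z.2)
          (g := fun z : ℝ × ℝ => weight c Λ (clamp z.1) z.2) (by fun_prop) (by fun_prop)
          (fun z => (weight_pos _ _ _ _).ne')) (M u) (hM u)
  have hΦ : ContractingWith (1 / 2) Φ := by
    refine ⟨by norm_num [← NNReal.coe_lt_coe], LipschitzWith.of_dist_le_mul fun u v => ?_⟩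
    rw [BoundedContinuousFunction.dist_le (by positivity)]
    intro z
    have su := isSource_totalSource hA hQ hf hc hΛ u
    have sv := isSource_totalSource hA hQ hf hc hΛ v
    -- The forcing cancels in the difference, leaving only the linear part controlled by `Absorbs`.
    have hdiff : ∀ s ξ, totalSource c Λ Q Qt ft u s ξ - totalSource c Λ Q Qt ft v s ξ
        = Qt s ξ * timePrim c Λ (u - v) s ξ + Q s ξ * (weight c Λ s ξ * (u - v) (s, ξ)) := by
      intro s ξ
      rw [← timePrim_sub]
      simp [totalSource]
      ring
    have hle : ∀ s ≥ 0, ∀ ξ,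
        |totalSource c Λ Q Qt ft u s ξ - totalSource c Λ Q Qt ft v s ξ|
          ≤ ‖u - v‖ / 2 * weightGap c Λ s ξ := by
      intro s hs ξ
      rw [hdiff]
      exact hA.abs_le hQ hc hΛ ξ hs (norm_nonneg _)
        (fun h => abs_timePrim_le hc hΛ0 _ h ξ) (fun _ => abs_weight_mul_le _ s ξ)
    have sd : IsSource fun s ξ =>
        totalSource c Λ Q Qt ft u s ξ - totalSource c Λ Q Qt ft v s ξ := by
      obtain ⟨C, hC⟩ := su.growth
      obtain ⟨D, hD⟩ := sv.growth
      exact ⟨su.cont.sub sv.cont, fun s hs ξ => by rw [su.zero s hs, sv.zero s hs, sub_zero],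
        C + D, fun s ξ => (abs_sub _ _).trans (by linarith [hC s ξ, hD s ξ])⟩
    have hsub : duhamel (totalSource c Λ Q Qt ft u) (clamp z.1) z.2
        - duhamel (totalSource c Λ Q Qt ft v) (clamp z.1) z.2
        = duhamel (fun s ξ => totalSource c Λ Q Qt ft u s ξ - totalSource c Λ Q Qt ft v s ξ)
          (clamp z.1) z.2 := by
      unfold duhamel
      exact (integral_sub (su.integrable _ _) (sv.integrable _ _)).symm
    have hpos := weight_pos c Λ (clamp z.1) z.2
    change dist (duhamel (totalSource c Λ Q Qt ft u) (clamp z.1) z.2 / weight c Λ (clamp z.1) z.2)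
      (duhamel (totalSource c Λ Q Qt ft v) (clamp z.1) z.2 / weight c Λ (clamp z.1) z.2) ≤ _
    rw [Real.dist_eq, ← sub_div, abs_div, abs_of_pos hpos, div_le_iff₀ hpos, hsub, dist_eq_norm]
    refine (abs_duhamel_le_weight hc hΛ0 sd (by positivity) hle (clamp_mem _).1 _).trans_eq ?_
    simp only [NNReal.coe_div, NNReal.coe_one, NNReal.coe_ofNat]
    ring
  refine ⟨hΦ.fixedPoint Φ, fun s hs ξ => ?_⟩
  have h : Φ (hΦ.fixedPoint Φ) = hΦ.fixedPoint Φ := hΦ.fixedPoint_isFixedPt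
  have h' : duhamel (totalSource c Λ Q Qt ft (hΦ.fixedPoint Φ)) (clamp s) ξ
      / weight c Λ (clamp s) ξ = hΦ.fixedPoint Φ (s, ξ) := congrArg (fun v => v (s, ξ)) h
  rw [clamp_of_mem hs] at h'
  rw [← h', mul_div_cancel₀ _ (weight_pos _ _ _ _).ne']

/-- Classical solution of the heat equation with a subquadratic potential and zero initial value. -/
theorem IsPotential.exists_solution (hQ : IsPotential Q Qt) (hf : IsForcing c f ft) (hc : 0 < c) :
    ∃ R Rt R1 R2 : ℝ → ℝ → ℝ,
      (Continuous fun z : ℝ × ℝ => R z.1 z.2) ∧ (Continuous fun z : ℝ × ℝ => Rt z.1 z.2) ∧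
      (Continuous fun z : ℝ × ℝ => R1 z.1 z.2) ∧ (Continuous fun z : ℝ × ℝ => R2 z.1 z.2) ∧
      (∀ t ξ, HasDerivAt (fun s => R s ξ) (Rt t ξ) t) ∧
      (∀ t ≥ 0, ∀ ξ, HasDerivAt (R t) (R1 t ξ) ξ) ∧ (∀ t ξ, HasDerivAt (R1 t) (R2 t ξ) ξ) ∧
      (∀ t ≥ 0, ∀ ξ, Rt t ξ - 4 * R2 t ξ = Q t ξ * R t ξ + f t ξ) ∧ (∀ ξ, R 0 ξ = 0) ∧
      ∀ T, ∃ C, ∃ d > 0, ∀ t ∈ Icc 0 T, ∀ ξ, |R t ξ| ≤ C * Real.exp (-d * ξ ^ 2) := by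
  obtain ⟨Λ, hΛ, hA⟩ := hQ.exists_absorbs hc
  have hΛ0 : 0 ≤ Λ := by linarith
  obtain ⟨u, hu⟩ := exists_fixedPoint hA hQ hf hc hΛ
  -- `weight * u` plays the role of the time derivative of the solution and `timePrim` that of the
  -- solution. `Ft` is then the time derivative of `F` by the product rule.
  let F : ℝ → ℝ → ℝ := fun s ξ => f s ξ + Q s ξ * timePrim c Λ u s ξ
  let Ft : ℝ → ℝ → ℝ := totalSource c Λ Q Qt ft u
  have hF0 : ∀ s ∉ Ioo (0 : ℝ) 1, ∀ ξ, F s ξ = 0 := fun s hs ξ => by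
    simp [F, hf.zero s hs, hQ.zero s hs]
  have hnot : ∀ s ≤ (0 : ℝ), s ∉ Ioo (0 : ℝ) 1 := fun s hs h => absurd h.1 (not_lt.2 hs)
  have hFw : ∃ M, 0 ≤ M ∧ ∀ s ≥ 0, ∀ ξ, |F s ξ| ≤ M * weightGap c Λ s ξ := by
    obtain ⟨C, hC⟩ := hf.bound
    have hC0 : 0 ≤ C := by simpa using (abs_nonneg _).trans (hC 0 0)
    refine ⟨C + ‖u‖ / 2, by positivity, fun s hs ξ => ?_⟩
    rw [add_mul]
    refine (abs_add_le _ _).trans (add_le_add (abs_le_weightGap hc hΛ ξ hs (hC s ξ)) ?_)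
    have := hA.abs_le hQ hc hΛ (a := 0) (b := timePrim c Λ u s ξ) ξ hs (norm_nonneg u)
      (fun _ => by rw [abs_zero]; have := weight_pos c Λ s ξ; positivity)
      (fun h => abs_timePrim_le hc hΛ0 u h ξ)
    simpa using this
  obtain ⟨M, hM, hMw⟩ := hFw
  obtain ⟨Mt, hMt, hMtw⟩ := exists_totalSource_le hA hQ hf hc hΛ u
  have hS : IsSmoothSource F Ft :=
    { cont := by
        have h1 := hQ.cont
        have h2 := hf.cont
        have h3 := continuous_timePrim (c := c) (Λ := Λ) u
        simp only [F]
        fun_prop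
      cont_t := continuous_totalSource hQ hf u
      zero := fun s hs ξ => hF0 s (hnot s hs) ξ
      zero_t := fun s hs ξ => totalSource_eq_zero hQ hf u (hnot s hs) ξ
      bound := exists_bound_of_le_weightGap hc hΛ hM hF0 hMw
      bound_t := exists_bound_of_le_weightGap hc hΛ hMt
        (fun s hs ξ => totalSource_eq_zero hQ hf u hs ξ) hMtw
      deriv_t := fun s ξ => (hf.deriv_t s ξ).add
        ((hQ.deriv_t s ξ).mul (hasDerivAt_timePrim u s ξ)) }
  have hct := hS.isSource_t.continuous_duhamel
  have hcF := hS.cont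
  have hdt : ∀ t ξ, HasDerivAt (fun s => duhamel F s ξ) (duhamel Ft t ξ) t := fun t ξ =>
    hS.isSource.hasDerivAt_duhamel_time hS.isSource_t hS.deriv_t t ξ
  have hzero : ∀ ξ, duhamel F 0 ξ = 0 := fun ξ => duhamel_of_nonpos hS.isSource le_rfl ξ
  -- Both sides vanish at time zero and have equal time derivatives, by the fixed point equation.
  -- Only `[0,1]` matters, since the potential is zero at other times.
  have heq : ∀ t ∈ Icc (0 : ℝ) 1, ∀ ξ, duhamel F t ξ = timePrim c Λ u t ξ := by
    intro t ht ξ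
    have h1 := intervalIntegral.integral_eq_sub_of_hasDerivAt (a := 0) (b := t)
      (fun s _ => hdt s ξ) (Continuous.intervalIntegrable (by fun_prop) _ _)
    rw [hzero, sub_zero] at h1
    rw [← h1]
    unfold timePrim
    refine intervalIntegral.integral_congr fun s hs => ?_
    rw [uIcc_of_le ht.1] at hs
    exact (hu s ⟨hs.1, hs.2.trans ht.2⟩ ξ).symm
  refine ⟨duhamel F, duhamel Ft, fun t ξ => (duhamel (prim Ft) t ξ - prim F t ξ) / 4,
    fun t ξ => (duhamel Ft t ξ - F t ξ) / 4, hS.isSource.continuous_duhamel, hct,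
    hS.continuous_deriv_duhamel, by fun_prop, hdt, fun t ht ξ => hS.hasDerivAt_duhamel ht ξ,
    fun t ξ => hS.hasDerivAt_deriv_duhamel t ξ, fun t ht ξ => ?_, hzero, fun T => ?_⟩
  · have : F t ξ = Q t ξ * duhamel F t ξ + f t ξ := by
      by_cases h : t ∈ Ioo (0 : ℝ) 1
      · rw [heq t (Ioo_subset_Icc_self h)]; simp only [F]; ring
      · rw [hF0 t h, hQ.zero t h, hf.zero t h]; simp
    rw [← this]; ring
  · refine ⟨M * Real.exp (Λ * T), decay c T, decay_pos hc T, fun t ht ξ => ?_⟩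
    refine (abs_duhamel_le_weight hc hΛ0 hS.isSource hM hMw ht.1 ξ).trans ?_
    rw [mul_assoc]
    gcongr
    exact weight_le hc hΛ0 ht.2 ξ

end

/-! ### The regularised power -/

/-- The derivative of `hBar`. -/
noncomputable def hDer (β ε ξ : ℝ) : ℝ := β / (ε ^ ((1 - β) / 2) + |ξ| ^ (1 - β))

/-- The primitive of `hBar`. -/
noncomputable def hPrim (β ε ξ : ℝ) : ℝ := ∫ η in (0 : ℝ)..ξ, hBar β ε η

section

variable {β ε : ℝ}

lemma hDer_denom_pos (hε : 0 < ε) (ξ : ℝ) : 0 < ε ^ ((1 - β) / 2) + |ξ| ^ (1 - β) :=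
  add_pos_of_pos_of_nonneg (Real.rpow_pos_of_pos hε _) (by positivity)

lemma continuous_hDer (hβ : β ∈ Ioo (0 : ℝ) 1) (hε : 0 < ε) : Continuous (hDer β ε) := by
  unfold hDer
  refine Continuous.div (by fun_prop) (continuous_const.add ?_)
    fun ξ => (hDer_denom_pos hε ξ).ne'
  exact continuous_abs.rpow_const fun x => Or.inr (by linarith [hβ.2])

lemma hasDerivAt_hBar (hβ : β ∈ Ioo (0 : ℝ) 1) (hε : 0 < ε) (ξ : ℝ) :
    HasDerivAt (hBar β ε) (hDer β ε ξ) ξ := by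
  have h := continuous_hDer hβ hε
  exact intervalIntegral.integral_hasDerivAt_right (h.intervalIntegrable _ _)
    (h.stronglyMeasurableAtFilter _ _) h.continuousAt

lemma deriv_hBar (hβ : β ∈ Ioo (0 : ℝ) 1) (hε : 0 < ε) : deriv (hBar β ε) = hDer β ε :=
  funext fun ξ => (hasDerivAt_hBar hβ hε ξ).deriv

lemma continuous_hBar (hβ : β ∈ Ioo (0 : ℝ) 1) (hε : 0 < ε) : Continuous (hBar β ε) :=
  continuous_iff_continuousAt.2 fun ξ => (hasDerivAt_hBar hβ hε ξ).continuousAt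

lemma hasDerivAt_hPrim (hβ : β ∈ Ioo (0 : ℝ) 1) (hε : 0 < ε) (ξ : ℝ) :
    HasDerivAt (hPrim β ε) (hBar β ε ξ) ξ := by
  have h := continuous_hBar hβ hε
  exact intervalIntegral.integral_hasDerivAt_right (h.intervalIntegrable _ _)
    (h.stronglyMeasurableAtFilter _ _) h.continuousAt

lemma continuous_hPrim (hβ : β ∈ Ioo (0 : ℝ) 1) (hε : 0 < ε) : Continuous (hPrim β ε) :=
  continuous_iff_continuousAt.2 fun ξ => (hasDerivAt_hPrim hβ hε ξ).continuousAt

lemma hDer_nonneg (hβ : β ∈ Ioo (0 : ℝ) 1) (hε : 0 < ε) (ξ : ℝ) : 0 ≤ hDer β ε ξ :=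
  div_nonneg hβ.1.le (hDer_denom_pos hε ξ).le

lemma hDer_le (hβ : β ∈ Ioo (0 : ℝ) 1) (hε : 0 < ε) (ξ : ℝ) :
    hDer β ε ξ ≤ β / ε ^ ((1 - β) / 2) := by
  unfold hDer
  have := Real.rpow_pos_of_pos hε ((1 - β) / 2)
  have := hβ.1
  gcongr
  have : 0 ≤ |ξ| ^ (1 - β) := by positivity
  linarith

lemma hDer_neg (ξ : ℝ) : hDer β ε (-ξ) = hDer β ε ξ := by simp [hDer]

lemma hBar_neg (ξ : ℝ) : hBar β ε (-ξ) = -hBar β ε ξ := by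
  unfold hBar
  have := intervalIntegral.integral_comp_neg (a := 0) (b := ξ)
    (fun η => β / (ε ^ ((1 - β) / 2) + |η| ^ (1 - β)))
  simp only [abs_neg, neg_zero] at this
  rw [this, intervalIntegral.integral_symm]

lemma hBar_nonneg (hβ : β ∈ Ioo (0 : ℝ) 1) (hε : 0 < ε) {ξ : ℝ} (hξ : 0 ≤ ξ) : 0 ≤ hBar β ε ξ :=
  intervalIntegral.integral_nonneg hξ fun η _ => hDer_nonneg hβ hε η

/-- The drift points outward; the minimum principle and the subsolution both rest on this sign. -/
lemma hBar_mul_self_nonneg (hβ : β ∈ Ioo (0 : ℝ) 1) (hε : 0 < ε) (ξ : ℝ) :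
    0 ≤ hBar β ε ξ * ξ := by
  rcases le_total 0 ξ with h | h
  · exact mul_nonneg (hBar_nonneg hβ hε h) h
  · have := mul_nonneg (hBar_nonneg hβ hε (neg_nonneg.2 h)) (neg_nonneg.2 h)
    rwa [hBar_neg, neg_mul_neg] at this

/-- `hBar` grows sublinearly. -/
lemma abs_hBar_le (hβ : β ∈ Ioo (0 : ℝ) 1) (hε : 0 < ε) {δ : ℝ} (hδ : 0 < δ) :
    ∃ C, 0 ≤ C ∧ ∀ ξ, |hBar β ε ξ| ≤ δ * |ξ| + C := by
  have hb0 : 0 < β / ε ^ ((1 - β) / 2) := div_pos hβ.1 (Real.rpow_pos_of_pos hε _)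
  have hlim : Tendsto (fun x : ℝ => x ^ (1 - β)) atTop atTop :=
    tendsto_rpow_atTop (by linarith [hβ.2])
  -- The derivative of `hBar` tends to zero at infinity; beyond `R` the slope is at most `δ`.
  obtain ⟨R, hR0, hR⟩ : ∃ R, 0 ≤ R ∧ ∀ x ≥ R, hDer β ε x ≤ δ := by
    obtain ⟨R, hR⟩ := (hlim.eventually_ge_atTop (β / δ)).exists_forall_of_atTop
    refine ⟨max R 0, le_max_right _ _, fun x hx => ?_⟩
    have h1 := hR x ((le_max_left _ _).trans hx)
    have h2 : 0 ≤ x := (le_max_right _ _).trans hx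
    unfold hDer
    rw [div_le_iff₀ (hDer_denom_pos hε x), abs_of_nonneg h2]
    rw [div_le_iff₀ hδ] at h1
    have := Real.rpow_pos_of_pos hε ((1 - β) / 2)
    nlinarith
  have hpos : ∀ ξ, 0 ≤ ξ → |hBar β ε ξ| ≤ δ * ξ + β / ε ^ ((1 - β) / 2) * R := by
    intro ξ hξ
    have hbd : ∀ y, 0 ≤ y → |hBar β ε y| ≤ β / ε ^ ((1 - β) / 2) * y := by
      intro y hy
      have := intervalIntegral.norm_integral_le_of_norm_le_const (a := (0 : ℝ)) (b := y)
        (f := hDer β ε) (C := β / ε ^ ((1 - β) / 2)) (fun x _ => by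
          rw [Real.norm_eq_abs, abs_of_nonneg (hDer_nonneg hβ hε x)]; exact hDer_le hβ hε x)
      rwa [sub_zero, abs_of_nonneg hy] at this
    rcases le_total ξ R with h | h
    · refine (hbd ξ hξ).trans ?_
      have : β / ε ^ ((1 - β) / 2) * ξ ≤ β / ε ^ ((1 - β) / 2) * R := by gcongr
      have : 0 ≤ δ * ξ := by positivity
      linarith
    · have h1 := hbd R hR0
      have hcd := continuous_hDer hβ hε
      have h2 := intervalIntegral.norm_integral_le_of_norm_le_const (a := R) (b := ξ)
        (f := hDer β ε) (C := δ) (fun x hx => by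
          rw [uIoc_of_le h] at hx
          rw [Real.norm_eq_abs, abs_of_nonneg (hDer_nonneg hβ hε x)]; exact hR x hx.1.le)
      rw [abs_of_nonneg (sub_nonneg.2 h)] at h2
      have h3 : hBar β ε ξ = hBar β ε R + ∫ x in R..ξ, hDer β ε x :=
        (intervalIntegral.integral_add_adjacent_intervals (hcd.intervalIntegrable _ _)
          (hcd.intervalIntegrable _ _)).symm
      rw [h3]
      refine (abs_add_le _ _).trans ?_
      rw [Real.norm_eq_abs] at h2
      nlinarith
  refine ⟨β / ε ^ ((1 - β) / 2) * R, by positivity, fun ξ => ?_⟩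
  rcases le_total 0 ξ with h | h
  · rw [abs_of_nonneg h]; exact hpos ξ h
  · have := hpos (-ξ) (neg_nonneg.2 h)
    rwa [hBar_neg, abs_neg, ← abs_of_nonpos h] at this

lemma hBar_sq_le (hβ : β ∈ Ioo (0 : ℝ) 1) (hε : 0 < ε) {δ : ℝ} (hδ : 0 < δ) :
    ∃ C, 0 ≤ C ∧ ∀ ξ, hBar β ε ξ ^ 2 ≤ δ * ξ ^ 2 + C := by
  obtain ⟨C, hC0, hC⟩ := abs_hBar_le hβ hε (δ := √(δ / 2)) (by positivity)
  refine ⟨2 * C ^ 2, by positivity, fun ξ => ?_⟩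
  have h1 : |hBar β ε ξ| ^ 2 ≤ (√(δ / 2) * |ξ| + C) ^ 2 := by gcongr; exact hC ξ
  have h2 : (√(δ / 2) * |ξ|) ^ 2 = δ / 2 * ξ ^ 2 := by
    rw [mul_pow, Real.sq_sqrt (by positivity), sq_abs]
  rw [sq_abs] at h1
  nlinarith [sq_nonneg (√(δ / 2) * |ξ| - C)]

lemma abs_hPrim_le (hβ : β ∈ Ioo (0 : ℝ) 1) (hε : 0 < ε) {δ : ℝ} (hδ : 0 < δ) :
    ∃ C, 0 ≤ C ∧ ∀ ξ, |hPrim β ε ξ| ≤ δ * ξ ^ 2 + C := by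
  obtain ⟨C, hC0, hC⟩ := abs_hBar_le hβ hε (δ := δ / 2) (by positivity)
  refine ⟨C ^ 2 / (2 * δ), by positivity, fun ξ => ?_⟩
  have h1 := intervalIntegral.norm_integral_le_of_norm_le_const (a := (0 : ℝ)) (b := ξ)
    (f := hBar β ε) (C := δ / 2 * |ξ| + C) (fun x hx => (hC x).trans (by
      have := uIoc_subset_uIcc hx
      have : |x| ≤ |ξ| := by
        rcases le_total 0 ξ with h | h
        · rw [uIcc_of_le h] at this
          rw [abs_of_nonneg this.1, abs_of_nonneg h]; exact this.2
        · rw [uIcc_of_ge h] at this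
          rw [abs_of_nonpos this.2, abs_of_nonpos h]; linarith [this.1]
      gcongr))
  rw [sub_zero] at h1
  refine h1.trans ?_
  -- Young's inequality, by completing the square.
  have h2 : C * |ξ| ≤ δ / 2 * ξ ^ 2 + C ^ 2 / (2 * δ) := by
    rw [← sq_abs ξ, ← sub_nonneg]
    have : δ / 2 * |ξ| ^ 2 + C ^ 2 / (2 * δ) - C * |ξ| = (δ * |ξ| - C) ^ 2 / (2 * δ) := by
      field_simp; ring
    rw [this]; positivity
  have h3 : |ξ| * |ξ| = ξ ^ 2 := by rw [← sq, sq_abs]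
  nlinarith

end

/-! ### The time coefficient and the transformed potential -/

/-- Non-negative `C²` functions supported in `(0,1)`, with their derivatives. -/
structure IsPulse (g g1 g2 : ℝ → ℝ) : Prop where
  nonneg : ∀ t, 0 ≤ g t
  cont : Continuous g
  cont_1 : Continuous g1
  cont_2 : Continuous g2
  zero : ∀ t ∉ Ioo (0 : ℝ) 1, g t = 0
  zero_1 : ∀ t ∉ Ioo (0 : ℝ) 1, g1 t = 0
  zero_2 : ∀ t ∉ Ioo (0 : ℝ) 1, g2 t = 0
  deriv_1 : ∀ t, HasDerivAt g (g1 t) t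
  deriv_2 : ∀ t, HasDerivAt g1 (g2 t) t

lemma exists_bound_of_zero {g : ℝ → ℝ} (hg : Continuous g) (h0 : ∀ t ∉ Ioo (0 : ℝ) 1, g t = 0) :
    ∃ B, 0 ≤ B ∧ ∀ t, |g t| ≤ B := by
  obtain ⟨B, hB⟩ := (isCompact_Icc (a := (0 : ℝ)) (b := 1)).exists_bound_of_continuousOn
    hg.continuousOn
  have hB0 : 0 ≤ B := (norm_nonneg _).trans (hB 0 (by simp))
  refine ⟨B, hB0, fun t => ?_⟩
  by_cases h : t ∈ Ioo (0 : ℝ) 1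
  · exact hB t (Ioo_subset_Icc_self h)
  · rwa [h0 t h, abs_zero]

/-- The potential obtained after removing the drift. -/
noncomputable def pot (β ε μ : ℝ) (g g1 : ℝ → ℝ) (t ξ : ℝ) : ℝ :=
  (1 + μ / 2) * g t * hDer β ε ξ - μ / 8 * g1 t * hPrim β ε ξ
    - μ ^ 2 / 16 * g t ^ 2 * hBar β ε ξ ^ 2

noncomputable def potT (β ε μ : ℝ) (g g1 g2 : ℝ → ℝ) (t ξ : ℝ) : ℝ :=
  (1 + μ / 2) * g1 t * hDer β ε ξ - μ / 8 * g2 t * hPrim β ε ξ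
    - μ ^ 2 / 8 * (g t * g1 t) * hBar β ε ξ ^ 2

section

variable {β ε μ : ℝ} {g g1 g2 : ℝ → ℝ}

lemma exists_growth_of_bounded (hβ : β ∈ Ioo (0 : ℝ) 1) (hε : 0 < ε) {a b c : ℝ → ℝ}
    (ha : ∃ B, 0 ≤ B ∧ ∀ t, |a t| ≤ B) (hb : ∃ B, 0 ≤ B ∧ ∀ t, |b t| ≤ B)
    (hc : ∃ B, 0 ≤ B ∧ ∀ t, |c t| ≤ B) {δ : ℝ} (hδ : 0 < δ) :
    ∃ C, ∀ t ξ, |a t * hDer β ε ξ - b t * hPrim β ε ξ - c t * hBar β ε ξ ^ 2|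
      ≤ δ * ξ ^ 2 + C := by
  obtain ⟨A, hA0, hA⟩ := ha
  obtain ⟨B, hB0, hB⟩ := hb
  obtain ⟨D, hD0, hD⟩ := hc
  -- The budget `δ` is split evenly between `hPrim` and `hBar ^ 2`; the shift by one avoids dividing
  -- by zero.
  obtain ⟨C1, hC10, hC1⟩ := abs_hPrim_le hβ hε (δ := δ / (2 * (B + 1))) (by positivity)
  obtain ⟨C2, hC20, hC2⟩ := hBar_sq_le hβ hε (δ := δ / (2 * (D + 1))) (by positivity)
  refine ⟨A * (β / ε ^ ((1 - β) / 2)) + (B + 1) * C1 + (D + 1) * C2, fun t ξ => ?_⟩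
  have e1 : |a t * hDer β ε ξ| ≤ A * (β / ε ^ ((1 - β) / 2)) := by
    rw [abs_mul, abs_of_nonneg (hDer_nonneg hβ hε ξ)]
    gcongr
    · exact hDer_nonneg hβ hε ξ
    · exact hA t
    · exact hDer_le hβ hε ξ
  have e2 : |b t * hPrim β ε ξ| ≤ (B + 1) * (δ / (2 * (B + 1)) * ξ ^ 2 + C1) := by
    rw [abs_mul]
    gcongr
    · linarith [hB t]
    · exact hC1 ξ
  have e3 : |c t * hBar β ε ξ ^ 2| ≤ (D + 1) * (δ / (2 * (D + 1)) * ξ ^ 2 + C2) := by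
    rw [abs_mul, abs_of_nonneg (sq_nonneg (hBar β ε ξ))]
    gcongr
    · linarith [hD t]
    · exact hC2 ξ
  have e4 : (B + 1) * (δ / (2 * (B + 1)) * ξ ^ 2 + C1) = δ / 2 * ξ ^ 2 + (B + 1) * C1 := by
    field_simp
  have e5 : (D + 1) * (δ / (2 * (D + 1)) * ξ ^ 2 + C2) = δ / 2 * ξ ^ 2 + (D + 1) * C2 := by
    field_simp
  have h1 := abs_sub (a t * hDer β ε ξ - b t * hPrim β ε ξ) (c t * hBar β ε ξ ^ 2)
  have h2 := abs_sub (a t * hDer β ε ξ) (b t * hPrim β ε ξ)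
  linarith

lemma IsPulse.isPotential (hg : IsPulse g g1 g2) (hβ : β ∈ Ioo (0 : ℝ) 1) (hε : 0 < ε) :
    IsPotential (pot β ε μ g g1) (potT β ε μ g g1 g2) := by
  have c1 := hg.cont
  have c2 := hg.cont_1
  have c3 := hg.cont_2
  have d1 := continuous_hDer hβ hε
  have d2 := continuous_hBar hβ hε
  have d3 := continuous_hPrim hβ hε
  have bd : ∀ {a : ℝ → ℝ}, Continuous a → (∀ t ∉ Ioo (0 : ℝ) 1, a t = 0) →
      ∃ B, 0 ≤ B ∧ ∀ t, |a t| ≤ B := fun h h' => exists_bound_of_zero h h'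
  exact {
    cont := by unfold pot; fun_prop
    cont_t := by unfold potT; fun_prop
    zero := fun s hs ξ => by simp [pot, hg.zero s hs, hg.zero_1 s hs]
    zero_t := fun s hs ξ => by simp [potT, hg.zero s hs, hg.zero_1 s hs, hg.zero_2 s hs]
    growth := fun δ hδ => exists_growth_of_bounded hβ hε
      (a := fun t => (1 + μ / 2) * g t) (b := fun t => μ / 8 * g1 t)
      (c := fun t => μ ^ 2 / 16 * g t ^ 2)
      (bd (by fun_prop) fun t ht => by simp [hg.zero t ht])
      (bd (by fun_prop) fun t ht => by simp [hg.zero_1 t ht])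
      (bd (by fun_prop) fun t ht => by simp [hg.zero t ht]) hδ
    growth_t := fun δ hδ => exists_growth_of_bounded hβ hε
      (a := fun t => (1 + μ / 2) * g1 t) (b := fun t => μ / 8 * g2 t)
      (c := fun t => μ ^ 2 / 8 * (g t * g1 t))
      (bd (by fun_prop) fun t ht => by simp [hg.zero_1 t ht])
      (bd (by fun_prop) fun t ht => by simp [hg.zero_2 t ht])
      (bd (by fun_prop) fun t ht => by simp [hg.zero t ht]) hδ
    deriv_t := fun s ξ => by
      unfold pot potT
      exact (((((hg.deriv_1 s).const_mul (1 + μ / 2)).mul_const (hDer β ε ξ)).sub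
        (((hg.deriv_2 s).const_mul (μ / 8)).mul_const (hPrim β ε ξ))).sub
        ((((hg.deriv_1 s).pow 2).const_mul (μ ^ 2 / 16)).mul_const
          (hBar β ε ξ ^ 2))).congr_deriv (by
            simp only [Nat.cast_ofNat, Nat.reduceSub, pow_one]; ring) }

end

/-! ### The heat flow of the initial Gaussian -/

/-- Solution of the heat equation with initial value `exp(-ξ²/ε)`. -/
noncomputable def gauss (ε t ξ : ℝ) : ℝ :=
  Real.exp (-ξ ^ 2 / (ε + 16 * t) - Real.log ((ε + 16 * t) / ε) / 2)

noncomputable def gaussT (ε t ξ : ℝ) : ℝ :=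
  (16 * ξ ^ 2 / (ε + 16 * t) ^ 2 - 8 / (ε + 16 * t)) * gauss ε t ξ

noncomputable def gauss1 (ε t ξ : ℝ) : ℝ := -2 * ξ / (ε + 16 * t) * gauss ε t ξ

noncomputable def gauss2 (ε t ξ : ℝ) : ℝ :=
  (4 * ξ ^ 2 / (ε + 16 * t) ^ 2 - 2 / (ε + 16 * t)) * gauss ε t ξ

section

variable {ε : ℝ}

lemma gauss_zero (hε : 0 < ε) (ξ : ℝ) : gauss ε 0 ξ = Real.exp (-ξ ^ 2 / ε) := by
  simp [gauss, hε.ne']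

lemma gauss_heat (ε t ξ : ℝ) : gaussT ε t ξ = 4 * gauss2 ε t ξ := by
  unfold gaussT gauss2; ring

lemma hasDerivAt_gauss_time (hε : 0 < ε) {t : ℝ} (ht : 0 < ε + 16 * t) (ξ : ℝ) :
    HasDerivAt (fun s => gauss ε s ξ) (gaussT ε t ξ) t := by
  have ha : HasDerivAt (fun s => ε + 16 * s) 16 t := by
    simpa using ((hasDerivAt_id t).const_mul 16).const_add ε
  have h1 : HasDerivAt (fun s => -ξ ^ 2 / (ε + 16 * s)) (16 * ξ ^ 2 / (ε + 16 * t) ^ 2) t :=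
    ((hasDerivAt_const t (-ξ ^ 2)).div ha ht.ne').congr_deriv (by ring)
  have h2 : HasDerivAt (fun s => Real.log ((ε + 16 * s) / ε)) (16 / (ε + 16 * t)) t :=
    ((ha.div_const ε).log (div_pos ht hε).ne').congr_deriv (by field_simp)
  unfold gauss gaussT
  exact ((h1.sub (h2.div_const 2)).exp).congr_deriv (by
    unfold gauss; simp only [Pi.sub_apply]; ring)

lemma hasDerivAt_gauss (ε t ξ : ℝ) : HasDerivAt (gauss ε t) (gauss1 ε t ξ) ξ := by
  unfold gauss gauss1
  exact (((((hasDerivAt_id ξ).pow 2).neg.div_const (ε + 16 * t)).sub_const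
    (Real.log ((ε + 16 * t) / ε) / 2)).exp).congr_deriv (by unfold gauss; simp; ring)

lemma hasDerivAt_gauss1 (ε t ξ : ℝ) : HasDerivAt (gauss1 ε t) (gauss2 ε t ξ) ξ := by
  have := (((hasDerivAt_id ξ).const_mul (-2)).div_const (ε + 16 * t)).mul (hasDerivAt_gauss ε t ξ)
  exact this.congr_deriv (by
    unfold gauss2 gauss1; generalize ε + 16 * t = a; simp only [id]; ring)

lemma continuousAt_gauss (hε : 0 < ε) {z : ℝ × ℝ} (hz : 0 < ε + 16 * z.1) :
    ContinuousAt (fun z : ℝ × ℝ => gauss ε z.1 z.2) z := by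
  have h1 := hz.ne'
  have h2 := (div_pos hz hε).ne'
  unfold gauss
  fun_prop (disch := assumption)

lemma continuousAt_gaussT (hε : 0 < ε) {z : ℝ × ℝ} (hz : 0 < ε + 16 * z.1) :
    ContinuousAt (fun z : ℝ × ℝ => gaussT ε z.1 z.2) z := by
  have h1 := hz.ne'
  have h2 := (pow_pos hz 2).ne'
  have h3 := continuousAt_gauss hε hz
  unfold gaussT
  fun_prop (disch := assumption)

lemma continuousAt_gauss1 (hε : 0 < ε) {z : ℝ × ℝ} (hz : 0 < ε + 16 * z.1) :
    ContinuousAt (fun z : ℝ × ℝ => gauss1 ε z.1 z.2) z := by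
  have h1 := hz.ne'
  have h3 := continuousAt_gauss hε hz
  unfold gauss1
  fun_prop (disch := assumption)

lemma continuousAt_gauss2 (hε : 0 < ε) {z : ℝ × ℝ} (hz : 0 < ε + 16 * z.1) :
    ContinuousAt (fun z : ℝ × ℝ => gauss2 ε z.1 z.2) z := by
  have h1 := hz.ne'
  have h2 := (pow_pos hz 2).ne'
  have h3 := continuousAt_gauss hε hz
  unfold gauss2
  fun_prop (disch := assumption)

lemma gauss_nonneg (ε t ξ : ℝ) : 0 ≤ gauss ε t ξ := (Real.exp_pos _).le

lemma gauss_le (hε : 0 < ε) {t T : ℝ} (ht : 0 ≤ t) (hT : t ≤ T) (ξ : ℝ) :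
    gauss ε t ξ ≤ Real.exp (-(1 / (ε + 16 * T)) * ξ ^ 2) := by
  unfold gauss
  rw [Real.exp_le_exp]
  have h1 : 0 ≤ Real.log ((ε + 16 * t) / ε) :=
    Real.log_nonneg ((one_le_div hε).2 (by linarith))
  have h2 : ξ ^ 2 / (ε + 16 * T) ≤ ξ ^ 2 / (ε + 16 * t) := by gcongr
  have h3 : -ξ ^ 2 / (ε + 16 * t) = -(ξ ^ 2 / (ε + 16 * t)) := neg_div _ _
  have h4 : -(1 / (ε + 16 * T)) * ξ ^ 2 = -(ξ ^ 2 / (ε + 16 * T)) := by ring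
  linarith

/-- The forcing and its time derivative are the Gaussian times at most a quartic: a quadratic from
the potential and another from `gaussT`. Half of the decay rate pays for it. -/
lemma quartic_mul_exp_le {c : ℝ} (hc : 0 < c) (ξ : ℝ) :
    (1 + ξ ^ 2) ^ 2 * Real.exp (-(2 * c) * ξ ^ 2) ≤ (1 + 2 / c) ^ 2 * Real.exp (-c * ξ ^ 2) := by
  have h1 : 1 + ξ ^ 2 ≤ (1 + 2 / c) * Real.exp (c / 2 * ξ ^ 2) := by
    have h2 := Real.add_one_le_exp (c / 2 * ξ ^ 2)
    calc 1 + ξ ^ 2 ≤ (1 + 2 / c) * (c / 2 * ξ ^ 2 + 1) := by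
          have h3 : (1 + 2 / c) * (c / 2 * ξ ^ 2 + 1) = 1 + ξ ^ 2 + (c / 2 * ξ ^ 2 + 2 / c) := by
            field_simp; ring
          rw [h3]
          have : 0 ≤ c / 2 * ξ ^ 2 + 2 / c := by positivity
          linarith
      _ ≤ _ := by gcongr
  calc _ ≤ ((1 + 2 / c) * Real.exp (c / 2 * ξ ^ 2)) ^ 2 * Real.exp (-(2 * c) * ξ ^ 2) := by
        gcongr
    _ = (1 + 2 / c) ^ 2 * (Real.exp (c / 2 * ξ ^ 2) * Real.exp (c / 2 * ξ ^ 2)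
          * Real.exp (-(2 * c) * ξ ^ 2)) := by ring
    _ = _ := by
        rw [← Real.exp_add, ← Real.exp_add]; congr 2; ring

/-- The product of a potential with a function continuous near non-negative times. -/
lemma continuous_mul_of_zero {Q G : ℝ → ℝ → ℝ} (hε : 0 < ε)
    (hQ : Continuous fun z : ℝ × ℝ => Q z.1 z.2) (h0 : ∀ s ≤ 0, ∀ ξ, Q s ξ = 0)
    (hG : ∀ z : ℝ × ℝ, 0 < ε + 16 * z.1 → ContinuousAt (fun z : ℝ × ℝ => G z.1 z.2) z) :
    Continuous fun z : ℝ × ℝ => Q z.1 z.2 * G z.1 z.2 := by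
  rw [continuous_iff_continuousAt]
  intro z
  by_cases h : 0 < ε + 16 * z.1
  · exact hQ.continuousAt.mul (hG z h)
  · have hz : z.1 < 0 := by linarith
    have h1 : (fun _ => (0 : ℝ)) =ᶠ[𝓝 z] fun z : ℝ × ℝ => Q z.1 z.2 * G z.1 z.2 := by
      have : ∀ᶠ y : ℝ × ℝ in 𝓝 z, y.1 < 0 :=
        (continuous_fst.continuousAt).eventually_lt continuousAt_const hz
      filter_upwards [this] with y hy
      rw [h0 y.1 hy.le, zero_mul]
    exact continuousAt_const.congr h1

lemma IsPotential.isForcing_gauss {Q Qt : ℝ → ℝ → ℝ} (hQ : IsPotential Q Qt) (hε : 0 < ε) :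
    IsForcing (1 / (2 * (ε + 16))) (fun t ξ => Q t ξ * gauss ε t ξ)
      (fun t ξ => Qt t ξ * gauss ε t ξ + Q t ξ * gaussT ε t ξ) := by
  have hnot : ∀ s ≤ (0 : ℝ), s ∉ Ioo (0 : ℝ) 1 := fun s hs h => absurd h.1 (not_lt.2 hs)
  have cQ := continuous_mul_of_zero hε hQ.cont (fun s hs => hQ.zero s (hnot s hs))
    (G := gauss ε) fun z hz => continuousAt_gauss hε hz
  have cQt := continuous_mul_of_zero hε hQ.cont_t (fun s hs => hQ.zero_t s (hnot s hs))
    (G := gauss ε) fun z hz => continuousAt_gauss hε hz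
  have cQ' := continuous_mul_of_zero hε hQ.cont (fun s hs => hQ.zero s (hnot s hs))
    (G := gaussT ε) fun z hz => continuousAt_gaussT hε hz
  obtain ⟨C, hC⟩ := hQ.growth 1 one_pos
  obtain ⟨Ct, hCt⟩ := hQ.growth_t 1 one_pos
  -- Up to time one the heat flow decays at rate at least `1/(ε + 16)`; half of that is kept.
  set c := 1 / (2 * (ε + 16)) with hcdef
  have hc : 0 < c := by positivity
  have hC0 : 0 ≤ C := by simpa using (abs_nonneg _).trans (hC 0 0)
  have hCt0 : 0 ≤ Ct := by simpa using (abs_nonneg _).trans (hCt 0 0)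
  have bound : ∀ (A : ℝ) (F P : ℝ → ℝ → ℝ), 0 ≤ A → (∀ s ∉ Ioo (0 : ℝ) 1, ∀ ξ, F s ξ = 0) →
      (∀ s ∈ Ioo (0 : ℝ) 1, ∀ ξ, F s ξ = P s ξ * gauss ε s ξ ∧ |P s ξ| ≤ A * (1 + ξ ^ 2) ^ 2) →
      ∃ C, ∀ s ξ, |F s ξ| ≤ C * Real.exp (-c * ξ ^ 2) := by
    intro A F P hA h0 hF
    refine ⟨A * (1 + 2 / c) ^ 2, fun s ξ => ?_⟩
    by_cases h : s ∈ Ioo (0 : ℝ) 1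
    · obtain ⟨e, hP⟩ := hF s h ξ
      have h1 := gauss_le hε h.1.le h.2.le ξ
      have h2 : -(1 / (ε + 16 * 1)) * ξ ^ 2 = -(2 * c) * ξ ^ 2 := by
        rw [hcdef]; field_simp
      rw [h2] at h1
      rw [e, abs_mul, abs_of_nonneg (gauss_nonneg _ _ _)]
      calc _ ≤ A * (1 + ξ ^ 2) ^ 2 * Real.exp (-(2 * c) * ξ ^ 2) := by
            gcongr; exact gauss_nonneg _ _ _
        _ = A * ((1 + ξ ^ 2) ^ 2 * Real.exp (-(2 * c) * ξ ^ 2)) := by ring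
        _ ≤ A * ((1 + 2 / c) ^ 2 * Real.exp (-c * ξ ^ 2)) :=
            mul_le_mul_of_nonneg_left (quartic_mul_exp_le hc ξ) hA
        _ = _ := by ring
    · rw [h0 s h, abs_zero]; positivity
  have q1 : ∀ s ξ, |Q s ξ| ≤ (1 + C) * (1 + ξ ^ 2) := fun s ξ => (hC s ξ).trans (by
    nlinarith [sq_nonneg ξ, mul_nonneg hC0 (sq_nonneg ξ)])
  have q2 : ∀ s ξ, |Qt s ξ| ≤ (1 + Ct) * (1 + ξ ^ 2) := fun s ξ => (hCt s ξ).trans (by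
    nlinarith [sq_nonneg ξ, mul_nonneg hCt0 (sq_nonneg ξ)])
  refine
    { cont := cQ
      cont_t := cQt.add cQ'
      zero := fun s hs ξ => by rw [hQ.zero s hs, zero_mul]
      zero_t := fun s hs ξ => by rw [hQ.zero s hs, hQ.zero_t s hs]; simp
      bound := bound (1 + C) _ Q (by positivity)
        (fun s hs ξ => by rw [hQ.zero s hs, zero_mul]) (fun s _ ξ => ⟨rfl, (q1 s ξ).trans ?_⟩)
      bound_t := bound ((1 + Ct) + (1 + C) * (16 / ε ^ 2 + 8 / ε)) _
        (fun s ξ => Qt s ξ + Q s ξ * (16 * ξ ^ 2 / (ε + 16 * s) ^ 2 - 8 / (ε + 16 * s)))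
        (by positivity) (fun s hs ξ => by rw [hQ.zero s hs, hQ.zero_t s hs]; simp)
        (fun s hs ξ => ⟨by unfold gaussT; ring, ?_⟩)
      deriv_t := fun s ξ => ?_ }
  · gcongr; nlinarith [sq_nonneg ξ]
  · have hs0 := hs.1
    have e1 : |16 * ξ ^ 2 / (ε + 16 * s) ^ 2 - 8 / (ε + 16 * s)|
        ≤ (16 / ε ^ 2 + 8 / ε) * (1 + ξ ^ 2) := by
      have p1 : 16 * ξ ^ 2 / (ε + 16 * s) ^ 2 ≤ 16 * ξ ^ 2 / ε ^ 2 := by gcongr; linarith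
      have p2 : 8 / (ε + 16 * s) ≤ 8 / ε := by gcongr; linarith
      have p3 : 0 ≤ 16 * ξ ^ 2 / (ε + 16 * s) ^ 2 := by positivity
      have p4 : 0 ≤ 8 / (ε + 16 * s) := by positivity
      have p5 : (16 / ε ^ 2 + 8 / ε) * (1 + ξ ^ 2)
          = 16 / ε ^ 2 + 16 * ξ ^ 2 / ε ^ 2 + 8 / ε + 8 / ε * ξ ^ 2 := by ring
      have p6 : 0 ≤ 16 / ε ^ 2 := by positivity
      have p7 : 0 ≤ 8 / ε * ξ ^ 2 := by positivity
      rw [p5, abs_le]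
      constructor <;> linarith
    refine (abs_add_le _ _).trans ?_
    rw [abs_mul]
    calc _ ≤ (1 + Ct) * (1 + ξ ^ 2)
          + (1 + C) * (1 + ξ ^ 2) * ((16 / ε ^ 2 + 8 / ε) * (1 + ξ ^ 2)) := by
          gcongr
          · exact q2 s ξ
          · exact q1 s ξ
      _ ≤ (1 + Ct) * (1 + ξ ^ 2) ^ 2
          + (1 + C) * (1 + ξ ^ 2) * ((16 / ε ^ 2 + 8 / ε) * (1 + ξ ^ 2)) := by
          gcongr; nlinarith [sq_nonneg ξ]
      _ = _ := by ring
  -- Where `ε + 16 * s ≤ 0` the formula for `gauss` has no meaning as a heat flow, but then `s < 0`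
  -- and the potential vanishes near `s`.
  · by_cases h : 0 < ε + 16 * s
    · exact (hQ.deriv_t s ξ).mul (hasDerivAt_gauss_time hε h ξ)
    · have hs : s < 0 := by linarith
      have h1 : (fun r => Q r ξ * gauss ε r ξ) =ᶠ[𝓝 s] fun _ => 0 := by
        filter_upwards [Iio_mem_nhds hs] with r hr
        rw [hQ.zero r (hnot r (le_of_lt hr)), zero_mul]
      rw [hQ.zero s (hnot s hs.le), hQ.zero_t s (hnot s hs.le), zero_mul, zero_mul, add_zero]
      exact (hasDerivAt_const s 0).congr_of_eventuallyEq h1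

end

/-! ### Solutions of the drift equation -/

/-- `u` has the continuous derivatives `ut`, `u1`, `u2` on `(0,∞) × I`. -/
structure IsClassical (I : Set ℝ) (u ut u1 u2 : ℝ → ℝ → ℝ) : Prop where
  deriv_t : ∀ t > 0, ∀ ξ ∈ I, HasDerivAt (fun s => u s ξ) (ut t ξ) t
  deriv_1 : ∀ t > 0, ∀ ξ ∈ I, HasDerivAt (u t) (u1 t ξ) ξ
  deriv_2 : ∀ t > 0, ∀ ξ ∈ I, HasDerivAt (u1 t) (u2 t ξ) ξ
  cont_t : ContinuousOn (fun z : ℝ × ℝ => ut z.1 z.2) (Ioi 0 ×ˢ I)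
  cont_1 : ContinuousOn (fun z : ℝ × ℝ => u1 z.1 z.2) (Ioi 0 ×ˢ I)
  cont_2 : ContinuousOn (fun z : ℝ × ℝ => u2 z.1 z.2) (Ioi 0 ×ˢ I)

section

variable {I : Set ℝ} {u ut u1 u2 : ℝ → ℝ → ℝ}

lemma IsClassical.deriv_two (h : IsClassical I u ut u1 u2) (hI : IsOpen I) {t : ℝ} (ht : 0 < t)
    {ξ : ℝ} (hξ : ξ ∈ I) : HasDerivAt (deriv (u t)) (u2 t ξ) ξ := by
  refine (h.deriv_2 t ht ξ hξ).congr_of_eventuallyEq ?_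
  filter_upwards [hI.mem_nhds hξ] with y hy using (h.deriv_1 t ht y hy).deriv

lemma IsClassical.isC12 (h : IsClassical I u ut u1 u2) (hI : IsOpen I) : IsC12 I u where
  diff_time _ ht _ hξ := (h.deriv_t _ ht _ hξ).differentiableAt
  diff_space _ ht _ hξ := (h.deriv_1 _ ht _ hξ).differentiableAt
  diff_space_two _ ht _ hξ := (h.deriv_two hI ht hξ).differentiableAt
  cont_time := h.cont_t.congr fun z hz => (h.deriv_t z.1 hz.1 z.2 hz.2).deriv
  cont_space := h.cont_1.congr fun z hz => (h.deriv_1 z.1 hz.1 z.2 hz.2).deriv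
  cont_space_two := h.cont_2.congr fun _ hz => (h.deriv_two hI hz.1 hz.2).deriv

end

section

variable {β ε : ℝ} {g g1 g2 : ℝ → ℝ}

/-- Solvability of the Cauchy problem for the drift equation, with Gaussian decay. -/
theorem IsPulse.exists_solution (hg : IsPulse g g1 g2) (hβ : β ∈ Ioo (0 : ℝ) 1) (hε : 0 < ε)
    (μ : ℝ) :
    ∃ V Vt V1 V2 : ℝ → ℝ → ℝ,
      ContinuousOn (fun z : ℝ × ℝ => V z.1 z.2) (Ici 0 ×ˢ univ) ∧
      IsClassical univ V Vt V1 V2 ∧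
      (∀ t > 0, ∀ ξ, Vt t ξ - 4 * V2 t ξ + μ * g t * hBar β ε ξ * V1 t ξ
        = g t * hDer β ε ξ * V t ξ) ∧
      (∀ ξ, V 0 ξ = Real.exp (-ξ ^ 2 / ε)) ∧
      ∀ T, ∃ C, ∃ d > 0, ∀ t ∈ Icc 0 T, ∀ ξ, |V t ξ| ≤ C * Real.exp (-d * ξ ^ 2) := by
  have hQ := hg.isPotential (μ := μ) hβ hε
  obtain ⟨R, Rt, R1, R2, cR, cRt, cR1, cR2, dRt, dR1, dR2, hR, hR0, hRb⟩ :=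
    hQ.exists_solution (hQ.isForcing_gauss hε) (by positivity)
  have ch := continuous_hBar hβ hε
  have chd := continuous_hDer hβ hε
  have cH := continuous_hPrim hβ hε
  have cg := hg.cont
  have cg1 := hg.cont_1
  -- In `4∂²(E U)` the cross term is `8 E' U'`. The exponent `μ g hPrim / 8` makes it cancel the
  -- drift; what remains multiplies `U` and is collected in `pot`.
  let E : ℝ → ℝ → ℝ := fun t ξ => Real.exp (μ / 8 * g t * hPrim β ε ξ)
  let U : ℝ → ℝ → ℝ := fun t ξ => gauss ε t ξ + R t ξ
  let U1 : ℝ → ℝ → ℝ := fun t ξ => gauss1 ε t ξ + R1 t ξ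
  let U2 : ℝ → ℝ → ℝ := fun t ξ => gauss2 ε t ξ + R2 t ξ
  let Ut : ℝ → ℝ → ℝ := fun t ξ => gaussT ε t ξ + Rt t ξ
  let V1 : ℝ → ℝ → ℝ := fun t ξ => E t ξ * (μ / 8 * g t * hBar β ε ξ * U t ξ + U1 t ξ)
  let V2 : ℝ → ℝ → ℝ := fun t ξ => E t ξ * (μ / 8 * g t * hBar β ε ξ *
      (μ / 8 * g t * hBar β ε ξ * U t ξ + U1 t ξ) + (μ / 8 * g t * hDer β ε ξ * U t ξ
      + μ / 8 * g t * hBar β ε ξ * U1 t ξ + U2 t ξ))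
  let Vt : ℝ → ℝ → ℝ := fun t ξ => E t ξ * (μ / 8 * g1 t * hPrim β ε ξ * U t ξ + Ut t ξ)
  have cE : Continuous fun z : ℝ × ℝ => E z.1 z.2 := by simp only [E]; fun_prop
  have hpos : ∀ {t : ℝ}, 0 ≤ t → 0 < ε + 16 * t := fun ht => by linarith
  have cU : ContinuousOn (fun z : ℝ × ℝ => U z.1 z.2) (Ici 0 ×ˢ univ) := fun z hz =>
    ((continuousAt_gauss hε (hpos hz.1)).add cR.continuousAt).continuousWithinAt
  have cU' : ContinuousOn (fun z : ℝ × ℝ => U z.1 z.2) (Ioi 0 ×ˢ univ) :=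
    cU.mono (prod_mono Ioi_subset_Ici_self le_rfl)
  have cU1 : ContinuousOn (fun z : ℝ × ℝ => U1 z.1 z.2) (Ioi 0 ×ˢ univ) := fun z hz =>
    ((continuousAt_gauss1 hε (hpos (le_of_lt hz.1))).add cR1.continuousAt).continuousWithinAt
  have cU2 : ContinuousOn (fun z : ℝ × ℝ => U2 z.1 z.2) (Ioi 0 ×ˢ univ) := fun z hz =>
    ((continuousAt_gauss2 hε (hpos (le_of_lt hz.1))).add cR2.continuousAt).continuousWithinAt
  have cUt : ContinuousOn (fun z : ℝ × ℝ => Ut z.1 z.2) (Ioi 0 ×ˢ univ) := fun z hz =>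
    ((continuousAt_gaussT hε (hpos (le_of_lt hz.1))).add cRt.continuousAt).continuousWithinAt
  have dU : ∀ t > 0, ∀ ξ, HasDerivAt (U t) (U1 t ξ) ξ := fun t ht ξ =>
    (hasDerivAt_gauss ε t ξ).add (dR1 t ht.le ξ)
  have dU1 : ∀ t ξ, HasDerivAt (U1 t) (U2 t ξ) ξ := fun t ξ =>
    (hasDerivAt_gauss1 ε t ξ).add (dR2 t ξ)
  have dUt : ∀ t > 0, ∀ ξ, HasDerivAt (fun s => U s ξ) (Ut t ξ) t := fun t ht ξ =>
    (hasDerivAt_gauss_time hε (hpos ht.le) ξ).add (dRt t ξ)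
  have dE : ∀ t ξ, HasDerivAt (E t) (E t ξ * (μ / 8 * g t * hBar β ε ξ)) ξ := fun t ξ =>
    ((hasDerivAt_hPrim hβ hε ξ).const_mul (μ / 8 * g t)).exp
  have dEt : ∀ t ξ, HasDerivAt (fun s => E s ξ) (E t ξ * (μ / 8 * g1 t * hPrim β ε ξ)) t :=
    fun t ξ => (((hg.deriv_1 t).const_mul (μ / 8)).mul_const (hPrim β ε ξ)).exp
  refine ⟨fun t ξ => E t ξ * U t ξ, Vt, V1, V2, cE.continuousOn.mul cU, ?_, ?_, ?_, ?_⟩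
  · exact {
      deriv_t := fun t ht ξ _ => ((dEt t ξ).mul (dUt t ht ξ)).congr_deriv (by simp only [Vt]; ring)
      deriv_1 := fun t ht ξ _ => ((dE t ξ).mul (dU t ht ξ)).congr_deriv (by simp only [V1]; ring)
      deriv_2 := fun t ht ξ _ => by
        have h1 := ((((hasDerivAt_hBar hβ hε ξ).const_mul (μ / 8 * g t)).mul (dU t ht ξ)).add
          (dU1 t ξ))
        exact ((dE t ξ).mul h1).congr_deriv (by
          simp only [V2, Pi.add_apply, Pi.mul_apply]; ring)
      cont_t := by simp only [Vt]; fun_prop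
      cont_1 := by simp only [V1]; fun_prop
      cont_2 := by simp only [V2]; fun_prop }
  · intro t ht ξ
    have h1 := hR t ht.le ξ
    have h2 := gauss_heat ε t ξ
    have h3 : Ut t ξ - 4 * U2 t ξ = pot β ε μ g g1 t ξ * U t ξ := by
      simp only [Ut, U2, U]; linarith
    simp only [Vt, V1, V2]
    unfold pot at h3
    linear_combination E t ξ * h3
  · intro ξ
    have : g 0 = 0 := hg.zero 0 (by simp)
    simp [E, U, this, hR0, gauss_zero hε]
  · intro T
    obtain ⟨C, d, hd, hb⟩ := hRb T
    obtain ⟨B, hB0, hB⟩ := exists_bound_of_zero hg.cont hg.zero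
    -- A common decay rate for the heat flow and the correction on `[0,T]`. The growth of `E` is
    -- then limited to `exp (d' ξ²/2)`, so the product still decays.
    set d' := min d (1 / (ε + 16 * max T 0)) with hd'
    have hmax := le_max_right T 0
    have hd'0 : 0 < d' := lt_min hd (by positivity)
    have hA : 0 ≤ |μ| / 8 * B := by positivity
    obtain ⟨K, hK0, hK⟩ := abs_hPrim_le hβ hε (δ := d' / (2 * (|μ| / 8 * B + 1))) (by positivity)
    refine ⟨Real.exp ((|μ| / 8 * B + 1) * K) * (1 + |C|), d' / 2, by positivity,
      fun t ht ξ => ?_⟩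
    have h1 : |U t ξ| ≤ (1 + |C|) * Real.exp (-d' * ξ ^ 2) := by
      have e1 : gauss ε t ξ ≤ Real.exp (-d' * ξ ^ 2) := by
        refine (gauss_le hε ht.1 (ht.2.trans (le_max_left T 0)) ξ).trans ?_
        rw [Real.exp_le_exp]
        have : d' ≤ 1 / (ε + 16 * max T 0) := min_le_right _ _
        nlinarith [sq_nonneg ξ]
      have e2 : |R t ξ| ≤ |C| * Real.exp (-d' * ξ ^ 2) := by
        refine (hb t ht ξ).trans ?_
        have : d' ≤ d := min_le_left _ _
        gcongr
        exact le_abs_self C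
      refine (abs_add_le _ _).trans ?_
      rw [abs_of_nonneg (gauss_nonneg _ _ _)]
      linarith
    have h2 : E t ξ ≤ Real.exp ((|μ| / 8 * B + 1) * K) * Real.exp (d' / 2 * ξ ^ 2) := by
      rw [← Real.exp_add, Real.exp_le_exp]
      calc μ / 8 * g t * hPrim β ε ξ ≤ |μ / 8 * g t * hPrim β ε ξ| := le_abs_self _
        _ = |μ| / 8 * |g t| * |hPrim β ε ξ| := by
            rw [abs_mul, abs_mul, abs_div, abs_of_pos (by norm_num : (0 : ℝ) < 8)]
        _ ≤ (|μ| / 8 * B + 1) * (d' / (2 * (|μ| / 8 * B + 1)) * ξ ^ 2 + K) := by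
            gcongr
            · have : |μ| / 8 * |g t| ≤ |μ| / 8 * B := by gcongr; exact hB t
              linarith
            · exact hK ξ
        _ = _ := by field_simp; ring
    calc |E t ξ * U t ξ| = E t ξ * |U t ξ| := by
          rw [abs_mul, abs_of_pos (Real.exp_pos _)]
      _ ≤ (Real.exp ((|μ| / 8 * B + 1) * K) * Real.exp (d' / 2 * ξ ^ 2))
          * ((1 + |C|) * Real.exp (-d' * ξ ^ 2)) := by gcongr
      _ = Real.exp ((|μ| / 8 * B + 1) * K) * (1 + |C|)
          * (Real.exp (d' / 2 * ξ ^ 2) * Real.exp (-d' * ξ ^ 2)) := by ring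
      _ = _ := by rw [← Real.exp_add]; congr 2; ring

end

/-! ### Maximum principle -/

/-- A function with a local minimum has non-negative second derivative there. -/
lemma second_deriv_nonneg_of_isLocalMin {f f' : ℝ → ℝ} {f'' a : ℝ} (h : IsLocalMin f a)
    (hf : ∀ x, HasDerivAt f (f' x) x) (hf' : HasDerivAt f' f'' a) : 0 ≤ f'' := by
  by_contra hneg
  push Not at hneg
  have hd : deriv f = f' := funext fun x => (hf x).deriv
  have h0 : f' a = 0 := by rw [← hd]; exact h.deriv_eq_zero
  have hmax : IsLocalMax f a := by
    refine isLocalMax_of_deriv_deriv_neg ?_ (by rw [hd, h0]) (hf a).continuousAt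
    rw [hd, hf'.deriv]; exact hneg
  -- A point that is both a local minimum and a local maximum: the function is locally constant,
  -- which contradicts a negative second derivative.
  have hconst : f =ᶠ[𝓝 a] fun _ => f a := by
    filter_upwards [h, hmax] with x h1 h2 using le_antisymm h2 h1
  have h1 : f' =ᶠ[𝓝 a] fun _ => 0 := by
    filter_upwards [hconst.eventuallyEq_nhds] with x hx
    rw [← hd, hx.deriv_eq, deriv_const]
  have h2 : deriv f' a = 0 := by rw [h1.deriv_eq, deriv_const]
  rw [hf'.deriv] at h2
  linarith

/-- Minimum principle for bounded supersolutions with an outward drift. -/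
lemma nonneg_of_supersolution {T B C₀ : ℝ} {E Et E1 E2 b c : ℝ → ℝ → ℝ}
    (hE : ContinuousOn (fun z : ℝ × ℝ => E z.1 z.2) (Icc 0 T ×ˢ univ))
    (hB : ∀ t ∈ Icc 0 T, ∀ ξ, |E t ξ| ≤ B)
    (ht : ∀ t ∈ Ioc 0 T, ∀ ξ, HasDerivAt (fun s => E s ξ) (Et t ξ) t)
    (h1 : ∀ t ∈ Ioc 0 T, ∀ ξ, HasDerivAt (E t) (E1 t ξ) ξ)
    (h2 : ∀ t ∈ Ioc 0 T, ∀ ξ, HasDerivAt (E1 t) (E2 t ξ) ξ)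
    (hb : ∀ t ∈ Ioc 0 T, ∀ ξ, 0 ≤ b t ξ * ξ) (hc : ∀ t ∈ Ioc 0 T, ∀ ξ, c t ξ ≤ C₀)
    (heq : ∀ t ∈ Ioc 0 T, ∀ ξ, 0 ≤ Et t ξ - 4 * E2 t ξ + b t ξ * E1 t ξ - c t ξ * E t ξ)
    (h0 : ∀ ξ, 0 ≤ E 0 ξ) {t ξ : ℝ} (htT : t ∈ Icc 0 T) : 0 ≤ E t ξ := by
  by_contra hneg
  push Not at hneg
  set Λ := |C₀| + 1 with hΛ
  have hΛ0 : 0 < Λ := by positivity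
  have hden : 0 < ξ ^ 2 + 8 * t + 1 := by have := htT.1; positivity
  -- Small enough that the penalty cannot cancel the negative value at `(t, ξ)`.
  set δ := -(Real.exp (-(Λ * t)) * E t ξ) / (2 * (ξ ^ 2 + 8 * t + 1)) with hδ
  have hδ0 : 0 < δ := by
    refine div_pos (neg_pos.2 (mul_neg_of_pos_of_neg (Real.exp_pos _) hneg)) (by positivity)
  -- The penalty `ξ² + 8t` solves the heat equation for `4∂²`, increases along the outward drift,
  -- and forces a minimum on a bounded set. The factor `exp (-Λ t)`, with `Λ > c`, makes the
  -- zeroth-order term strictly favourable.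
  let Y : ℝ × ℝ → ℝ := fun z => Real.exp (-(Λ * z.1)) * E z.1 z.2 + δ * (z.2 ^ 2 + 8 * z.1)
  have hYneg : Y (t, ξ) < 0 := by
    have h3 : δ * (2 * (ξ ^ 2 + 8 * t + 1)) = -(Real.exp (-(Λ * t)) * E t ξ) := by
      rw [hδ, div_mul_cancel₀ _ (by positivity)]
    have h4 : 0 ≤ ξ ^ 2 + 8 * t := by have := htT.1; positivity
    have : Y (t, ξ) = Real.exp (-(Λ * t)) * E t ξ + δ * (ξ ^ 2 + 8 * t) := rfl
    rw [this]
    nlinarith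
  have hB0 : 0 ≤ B := (abs_nonneg _).trans (hB t htT ξ)
  set X := √(B / δ) + |ξ| + 1 with hX
  have hX0 : 0 < X := by positivity
  have hXB : B < δ * X ^ 2 := by
    have h5 : √(B / δ) ^ 2 = B / δ := Real.sq_sqrt (by positivity)
    have h6 : B = δ * √(B / δ) ^ 2 := by rw [h5]; field_simp
    rw [h6]
    have : √(B / δ) < X := by rw [hX]; linarith [abs_nonneg ξ]
    have := Real.sqrt_nonneg (B / δ)
    gcongr
  have hYbig : ∀ s ∈ Icc 0 T, ∀ y, X ≤ |y| → 0 < Y (s, y) := by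
    intro s hs y hy
    have h5 : -B ≤ Real.exp (-(Λ * s)) * E s y := by
      have h6 : |Real.exp (-(Λ * s)) * E s y| ≤ 1 * B := by
        rw [abs_mul, abs_of_pos (Real.exp_pos _)]
        have := hB s hs y
        gcongr
        rw [Real.exp_le_one_iff]
        have := hs.1
        simp only [Left.neg_nonpos_iff]; positivity
      rw [one_mul] at h6
      exact (abs_le.1 h6).1
    have h7 : X ^ 2 ≤ y ^ 2 := by rw [← sq_abs y]; gcongr
    have h8 : δ * X ^ 2 ≤ δ * (y ^ 2 + 8 * s) := by
      have := hs.1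
      gcongr; linarith
    have : Y (s, y) = Real.exp (-(Λ * s)) * E s y + δ * (y ^ 2 + 8 * s) := rfl
    linarith
  have hYc : ContinuousOn Y (Icc 0 T ×ˢ univ) := by
    simp only [Y]; fun_prop
  obtain ⟨⟨t₀, ξ₀⟩, hmem, hmin⟩ := (isCompact_Icc.prod (isCompact_Icc (a := -X) (b := X))
    ).exists_isMinOn ⟨(t, ξ), htT, by
      have : |ξ| ≤ X := by rw [hX]; linarith [Real.sqrt_nonneg (B / δ)]
      exact abs_le.1 this⟩ (hYc.mono (prod_mono le_rfl (subset_univ _)))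
  have hξX : ξ ∈ Icc (-X) X := by
    have : |ξ| ≤ X := by rw [hX]; linarith [Real.sqrt_nonneg (B / δ)]
    exact abs_le.1 this
  have hY0 : Y (t₀, ξ₀) < 0 := (hmin ⟨htT, hξX⟩ : Y (t₀, ξ₀) ≤ Y (t, ξ)).trans_lt hYneg
  have hglob : ∀ s ∈ Icc 0 T, ∀ y, Y (t₀, ξ₀) ≤ Y (s, y) := by
    intro s hs y
    by_cases hy : X ≤ |y|
    · exact hY0.le.trans (hYbig s hs y hy).le
    · exact hmin ⟨hs, abs_le.1 (not_le.1 hy).le⟩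
  have ht₀ : t₀ ∈ Ioc 0 T := by
    refine ⟨lt_of_le_of_ne hmem.1.1 fun h => ?_, hmem.1.2⟩
    have h5 : Y (t₀, ξ₀) = Real.exp (-(Λ * t₀)) * E t₀ ξ₀ + δ * (ξ₀ ^ 2 + 8 * t₀) := rfl
    rw [← h] at h5 hY0
    rw [h5] at hY0
    have := mul_nonneg (Real.exp_pos (-(Λ * 0))).le (h0 ξ₀)
    nlinarith [sq_nonneg ξ₀]
  set e := Real.exp (-(Λ * t₀)) with he
  have he0 : 0 < e := Real.exp_pos _
  have d1 : ∀ y, HasDerivAt (fun y => Y (t₀, y)) (e * E1 t₀ y + δ * (2 * y)) y := fun y =>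
    (((h1 t₀ ht₀ y).const_mul e).add
      ((((hasDerivAt_id y).pow 2).add_const (8 * t₀)).const_mul δ)).congr_deriv (by simp)
  have d2 : HasDerivAt (fun y => e * E1 t₀ y + δ * (2 * y)) (e * E2 t₀ ξ₀ + δ * 2) ξ₀ :=
    (((h2 t₀ ht₀ ξ₀).const_mul e).add (((hasDerivAt_id ξ₀).const_mul 2).const_mul δ)).congr_deriv
      (by simp)
  have dt : HasDerivAt (fun s => Y (s, ξ₀))
      (-(Λ * e) * E t₀ ξ₀ + e * Et t₀ ξ₀ + δ * 8) t₀ := by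
    have h5 : HasDerivAt (fun s => Real.exp (-(Λ * s))) (-(Λ * e)) t₀ :=
      (((hasDerivAt_id t₀).const_mul Λ).neg.exp).congr_deriv (by rw [he]; simp; ring)
    exact ((h5.mul (ht t₀ ht₀ ξ₀)).add
      ((((hasDerivAt_id t₀).const_mul 8).const_add (ξ₀ ^ 2)).const_mul δ)).congr_deriv (by
        simp [he])
  have hlm : IsLocalMin (fun y => Y (t₀, y)) ξ₀ :=
    Eventually.of_forall fun y => hglob t₀ hmem.1 y
  have r1 : e * E1 t₀ ξ₀ + δ * (2 * ξ₀) = 0 := by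
    rw [← (d1 ξ₀).deriv]; exact hlm.deriv_eq_zero
  have r2 := second_deriv_nonneg_of_isLocalMin hlm d1 d2
  -- The minimum may sit at the final time, so only slopes from the left are used.
  have r3 : -(Λ * e) * E t₀ ξ₀ + e * Et t₀ ξ₀ + δ * 8 ≤ 0 := by
    by_contra hpos
    push Not at hpos
    have hslope := (hasDerivAt_iff_tendsto_slope.1 dt).mono_left
      (nhdsWithin_mono t₀ (fun x (hx : x < t₀) => ne_of_lt hx) : 𝓝[<] t₀ ≤ 𝓝[≠] t₀)
    have h5 := hslope.eventually (lt_mem_nhds hpos)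
    have h6 : ∀ᶠ s in 𝓝[<] t₀, s ∈ Ioo 0 t₀ := Ioo_mem_nhdsLT ht₀.1
    obtain ⟨s, hs, hs'⟩ := (h5.and h6).exists
    have h7 := hglob s ⟨hs'.1.le, hs'.2.le.trans ht₀.2⟩ ξ₀
    rw [slope_def_field] at hs
    have h8 : s - t₀ < 0 := by linarith [hs'.2]
    have := (div_pos_iff.1 hs).resolve_left (fun h => by linarith [h.2])
    linarith [this.1]
  have hEneg : e * E t₀ ξ₀ < 0 := by
    have h5 : Y (t₀, ξ₀) = e * E t₀ ξ₀ + δ * (ξ₀ ^ 2 + 8 * t₀) := rfl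
    have h6 : 0 ≤ δ * (ξ₀ ^ 2 + 8 * t₀) := by have := ht₀.1; positivity
    linarith
  -- At the minimum the contributions `8δ` of `∂ₜ` and `4∂²` cancel and the drift term has a
  -- favourable sign, so `e` times the supersolution expression is at most `(Λ - c) e E < 0`.
  have r4 := mul_nonneg he0.le (heq t₀ ht₀ ξ₀)
  have r5 := mul_nonneg hδ0.le (hb t₀ ht₀ ξ₀)
  have r6 : 0 < (Λ - c t₀ ξ₀) * -(e * E t₀ ξ₀) := by
    refine mul_pos ?_ (by linarith)
    have := hc t₀ ht₀ ξ₀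
    have := le_abs_self C₀
    rw [hΛ]; linarith
  have r7 : b t₀ ξ₀ * (e * E1 t₀ ξ₀ + δ * (2 * ξ₀)) = 0 := by rw [r1, mul_zero]
  nlinarith

/-! ### The concentrating coefficient -/

/-- A bump function supported in `(0, 1/2)`. -/
noncomputable def bump : ContDiffBump (1 / 4 : ℝ) := ⟨1 / 8, 3 / 16, by norm_num, by norm_num⟩

/-- A time coefficient of unit `L^p` size concentrated in `(0, ε/2)`. -/
noncomputable def coeff (p ε t : ℝ) : ℝ := ε ^ (-(1 / p)) * bump (t / ε)

section

variable {p ε : ℝ}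

lemma contDiff_coeff : ContDiff ℝ ∞ (coeff p ε) := by
  unfold coeff
  exact contDiff_const.mul (bump.contDiff.comp (by fun_prop))

lemma coeff_nonneg (hε : 0 < ε) (t : ℝ) : 0 ≤ coeff p ε t :=
  mul_nonneg (Real.rpow_nonneg hε.le _) bump.nonneg

lemma coeff_le (hε : 0 < ε) (t : ℝ) : coeff p ε t ≤ ε ^ (-(1 / p)) :=
  mul_le_of_le_one_right (Real.rpow_nonneg hε.le _) bump.le_one

lemma coeff_eq_zero (hε : 0 < ε) {t : ℝ} (ht : t ∉ Ioo (ε / 16) (ε / 2)) : coeff p ε t = 0 := by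
  unfold coeff
  rw [bump.zero_of_le_dist, mul_zero]
  change 3 / 16 ≤ dist (t / ε) (1 / 4)
  rw [Real.dist_eq, le_abs]
  by_cases h : t ≤ ε / 16
  · right
    have : t / ε ≤ 1 / 16 := by rw [div_le_iff₀ hε]; linarith
    linarith
  · left
    have h1 : ε / 2 ≤ t := by
      by_contra h2
      exact ht ⟨not_le.1 h, not_le.1 h2⟩
    have : 1 / 2 ≤ t / ε := by rw [le_div_iff₀ hε]; linarith
    linarith

lemma coeff_eq_of_mem (hε : 0 < ε) {t : ℝ} (ht : t ∈ Icc (ε / 8) (3 * ε / 8)) :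
    coeff p ε t = ε ^ (-(1 / p)) := by
  unfold coeff
  rw [bump.one_of_mem_closedBall, mul_one]
  change dist (t / ε) (1 / 4) ≤ 1 / 8
  have h1 : 1 / 8 ≤ t / ε := by rw [le_div_iff₀ hε]; linarith [ht.1]
  have h2 : t / ε ≤ 3 / 8 := by rw [div_le_iff₀ hε]; linarith [ht.2]
  rw [Real.dist_eq, abs_le]
  constructor <;> linarith

/-- Each time outside `(0,1)` is at positive distance from `(ε/16, ε/2)`, so the derivatives vanish
there as well. -/
lemma isPulse_coeff (hε : ε ∈ Ioo (0 : ℝ) 1) :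
    IsPulse (coeff p ε) (deriv (coeff p ε)) (deriv (deriv (coeff p ε))) := by
  have h0 : ∀ t ∉ Ioo (0 : ℝ) 1, coeff p ε =ᶠ[𝓝 t] fun _ => 0 := by
    intro t ht
    by_cases h : t ≤ 0
    · have h1 : t < ε / 16 := by linarith [hε.1]
      filter_upwards [Iio_mem_nhds h1] with s hs
      exact coeff_eq_zero hε.1 fun hs' => lt_asymm hs hs'.1
    · have h1 : ε / 2 < t := by
        have : 1 ≤ t := by
          by_contra h2
          exact ht ⟨not_le.1 h, not_le.1 h2⟩
        linarith [hε.1, hε.2]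
      filter_upwards [Ioi_mem_nhds h1] with s hs
      exact coeff_eq_zero hε.1 fun hs' => lt_asymm hs hs'.2
  have h1 : ∀ t ∉ Ioo (0 : ℝ) 1, deriv (coeff p ε) =ᶠ[𝓝 t] fun _ => 0 := by
    intro t ht
    filter_upwards [(h0 t ht).eventuallyEq_nhds] with s hs
    rw [hs.deriv_eq, deriv_const]
  have s0 : ContDiff ℝ ∞ (coeff p ε) := contDiff_coeff
  have s1 : ContDiff ℝ ∞ (deriv (coeff p ε)) := (contDiff_infty_iff_deriv.1 s0).2
  have s2 : ContDiff ℝ ∞ (deriv (deriv (coeff p ε))) := (contDiff_infty_iff_deriv.1 s1).2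
  exact {
    nonneg := coeff_nonneg hε.1
    cont := s0.continuous
    cont_1 := s1.continuous
    cont_2 := s2.continuous
    zero := fun t ht => (h0 t ht).self_of_nhds
    zero_1 := fun t ht => (h1 t ht).self_of_nhds
    zero_2 := fun t ht => by rw [(h1 t ht).deriv_eq, deriv_const]
    deriv_1 := fun t => ((contDiff_infty_iff_deriv.1 s0).1 t).hasDerivAt
    deriv_2 := fun t => ((contDiff_infty_iff_deriv.1 s1).1 t).hasDerivAt }

/-- The bump lies below the indicator of `(0, ε)` times `ε ^ (-1/p)`, whose `L^p` norm is exactly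
one. -/
lemma isAdmissibleCoeff_coeff (hp : 0 < p) (hε : 0 < ε) : IsAdmissibleCoeff p (coeff p ε) where
  smooth := contDiff_coeff
  nonneg := coeff_nonneg hε
  norm_le T _ := by
    have hp' : ENNReal.ofReal p ≠ 0 := by simpa using hp
    have hpos : 0 < ε ^ (-(1 / p)) := Real.rpow_pos_of_pos hε _
    calc eLpNorm (coeff p ε) (ENNReal.ofReal p) (volume.restrict (Ioo 0 T))
        ≤ eLpNorm (coeff p ε) (ENNReal.ofReal p) volume :=
          eLpNorm_mono_measure _ Measure.restrict_le_self
      _ ≤ eLpNorm ((Ioo 0 ε).indicator fun _ => ε ^ (-(1 / p))) (ENNReal.ofReal p) volume := by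
          refine eLpNorm_mono_real fun t => ?_
          rw [Real.norm_eq_abs, abs_of_nonneg (coeff_nonneg hε t)]
          by_cases h : t ∈ Ioo 0 ε
          · rw [indicator_of_mem h]; exact coeff_le hε t
          · rw [indicator_of_notMem h, coeff_eq_zero hε]
            exact fun h' => h ⟨by linarith [h'.1], by linarith [h'.2]⟩
      _ = 1 := by
          rw [eLpNorm_indicator_const measurableSet_Ioo hp' ENNReal.ofReal_ne_top,
            Real.volume_Ioo, sub_zero, ENNReal.toReal_ofReal hp.le,
            ENNReal.ofReal_rpow_of_pos hε, Real.enorm_eq_ofReal hpos.le,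
            ← ENNReal.ofReal_mul hpos.le, ← Real.rpow_add hε]
          simp

end

/-! ### Lower bounds for solutions -/

/-- Rescaled size of the reaction coefficient. -/
noncomputable def strength (β ε : ℝ) (g : ℝ → ℝ) (t : ℝ) : ℝ := β * ε ^ ((1 + β) / 2) * g t

/-- The growth exponent of the Gaussian subsolution. -/
noncomputable def growthExp (β ε : ℝ) (g : ℝ → ℝ) (t : ℝ) : ℝ :=
  ∫ s in (0 : ℝ)..t, (√(1 + strength β ε g s) - 9) / ε

section

variable {β ε μ : ℝ} {g g1 g2 : ℝ → ℝ}

lemma hasDerivAt_growthExp (hg : Continuous g) (t : ℝ) :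
    HasDerivAt (growthExp β ε g) ((√(1 + strength β ε g t) - 9) / ε) t := by
  have h : Continuous fun s => (√(1 + strength β ε g s) - 9) / ε := by
    unfold strength; fun_prop
  exact intervalIntegral.integral_hasDerivAt_right (h.intervalIntegrable _ _)
    (h.stronglyMeasurableAtFilter _ _) h.continuousAt

/-- The algebraic inequality behind the Gaussian subsolution. -/
lemma subsolution_ineq (hβ : β ∈ Ioo (0 : ℝ) 1) (hε : 0 < ε) {a ξ N : ℝ} (ha : 0 ≤ a)
    (hN : N = β * ε ^ ((1 + β) / 2) * a) :
    (√(1 + N) - 1) / ε - 16 * ξ ^ 2 / ε ^ 2 ≤ a * hDer β ε ξ := by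
  have hb := hβ.1
  have hN0 : 0 ≤ N := by rw [hN]; have := Real.rpow_pos_of_pos hε ((1 + β) / 2); positivity
  have hs1 : 1 ≤ √(1 + N) := Real.one_le_sqrt.2 (by linarith)
  have hsq : √(1 + N) ^ 2 = 1 + N := Real.sq_sqrt (by linarith)
  -- The positive root of `y (y + 2) = N`.
  set y := √(1 + N) - 1 with hy
  have hy0 : 0 ≤ y := by linarith
  have hyN : y * (y + 2) = N := by rw [hy]; nlinarith
  set x := ξ ^ 2 / ε with hx
  have hx0 : 0 ≤ x := by positivity
  have hlhs : y / ε - 16 * ξ ^ 2 / ε ^ 2 = (y - 16 * x) / ε := by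
    rw [hx]; field_simp
  rw [hlhs]
  -- Far out the left side is already non-positive. Otherwise `x < y`, the denominator of `hDer` is
  -- at most `ε ^ ((1-β)/2) * (2 + y)`, and the equation for `y` closes the estimate.
  by_cases hcase : y ≤ 16 * x
  · refine le_trans ?_ (mul_nonneg ha (hDer_nonneg hβ hε ξ))
    exact div_nonpos_of_nonpos_of_nonneg (by linarith) hε.le
  · push Not at hcase
    have hρ : 0 < ε ^ ((1 - β) / 2) := Real.rpow_pos_of_pos hε _
    have hpow : |ξ| ^ (1 - β) ≤ ε ^ ((1 - β) / 2) * (1 + x) := by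
      have h1 : |ξ| ^ (1 - β) = ε ^ ((1 - β) / 2) * x ^ ((1 - β) / 2) := by
        rw [← Real.mul_rpow hε.le hx0, hx, mul_div_cancel₀ _ hε.ne', ← sq_abs, ← Real.rpow_natCast,
          ← Real.rpow_mul (abs_nonneg ξ)]
        congr 1; push_cast; ring
      rw [h1]
      gcongr
      calc x ^ ((1 - β) / 2) ≤ (1 + x) ^ ((1 - β) / 2) := by
            gcongr
            · linarith [hβ.2]
            · linarith
        _ ≤ (1 + x) ^ (1 : ℝ) := Real.rpow_le_rpow_of_exponent_le (by linarith)
            (by linarith [hβ.1])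
        _ = 1 + x := Real.rpow_one _
    have hden : ε ^ ((1 - β) / 2) + |ξ| ^ (1 - β) ≤ ε ^ ((1 - β) / 2) * (2 + y) := by
      nlinarith
    have hprod : ε ^ ((1 + β) / 2) * ε ^ ((1 - β) / 2) = ε := by
      rw [← Real.rpow_add hε, show (1 + β) / 2 + (1 - β) / 2 = 1 by ring, Real.rpow_one]
    have h2 : y / ε = a * (β / (ε ^ ((1 - β) / 2) * (2 + y))) := by
      have hA : 0 < ε ^ ((1 + β) / 2) := Real.rpow_pos_of_pos hε _
      rw [← mul_div_assoc, div_eq_div_iff hε.ne' (by positivity)]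
      have : y * (ε ^ ((1 - β) / 2) * (2 + y)) = ε ^ ((1 - β) / 2) * (y * (y + 2)) := by ring
      rw [this, hyN, hN]
      linear_combination a * β * hprod
    calc (y - 16 * x) / ε ≤ y / ε := by gcongr; linarith
      _ = a * (β / (ε ^ ((1 - β) / 2) * (2 + y))) := h2
      _ ≤ a * hDer β ε ξ := by
          unfold hDer
          have := hDer_denom_pos (β := β) hε ξ
          gcongr

/-- Comparison with a growing Gaussian. -/
lemma exp_growthExp_le {V Vt V1 V2 : ℝ → ℝ → ℝ} (hg : IsPulse g g1 g2)
    (hβ : β ∈ Ioo (0 : ℝ) 1) (hε : 0 < ε) (hμ : 0 ≤ μ)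
    (hc : ContinuousOn (fun z : ℝ × ℝ => V z.1 z.2) (Ici 0 ×ˢ univ))
    (hV : IsClassical univ V Vt V1 V2)
    (heq : ∀ t > 0, ∀ ξ, Vt t ξ - 4 * V2 t ξ + μ * g t * hBar β ε ξ * V1 t ξ
        = g t * hDer β ε ξ * V t ξ)
    (h0 : ∀ ξ, V 0 ξ = Real.exp (-ξ ^ 2 / ε)) (hb : IsLocBounded univ V)
    {t : ℝ} (ht : 0 ≤ t) (ξ : ℝ) :
    Real.exp (growthExp β ε g t - ξ ^ 2 / ε) ≤ V t ξ := by
  have cg := hg.cont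
  have cm : Continuous (growthExp β ε g) :=
    continuous_iff_continuousAt.2 fun s => (hasDerivAt_growthExp hg.cont s).continuousAt
  obtain ⟨B, hB⟩ := hb t
  obtain ⟨K, hK⟩ := (isCompact_Icc (a := 0) (b := t)).exists_bound_of_continuousOn cm.continuousOn
  obtain ⟨G, hG0, hG⟩ := exists_bound_of_zero hg.cont hg.zero
  -- `-4∂²` of this Gaussian contributes `8/ε`, which is why `growthExp` subtracts 9: the sum of the
  -- 8 and the 1 of `√(1 + N) - 1`.
  let z : ℝ → ℝ → ℝ := fun s y => Real.exp (growthExp β ε g s - y ^ 2 / ε)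
  have dz : ∀ s y, HasDerivAt (z s) (-(2 * y / ε) * z s y) y := fun s y =>
    ((((hasDerivAt_id y).pow 2).div_const ε).const_sub (growthExp β ε g s)).exp.congr_deriv (by
      simp [z]; ring)
  have dz2 : ∀ s y, HasDerivAt (fun y => -(2 * y / ε) * z s y)
      (-(2 / ε) * z s y + -(2 * y / ε) * (-(2 * y / ε) * z s y)) y := fun s y =>
    ((((hasDerivAt_id y).const_mul 2).div_const ε).neg.mul (dz s y)).congr_deriv (by simp)
  have dzt : ∀ s y, HasDerivAt (fun r => z r y)
      ((√(1 + strength β ε g s) - 9) / ε * z s y) s := fun s y =>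
    (((hasDerivAt_growthExp hg.cont s).sub_const (y ^ 2 / ε)).exp).congr_deriv (by
      simp only [z]; ring)
  have hmain := nonneg_of_supersolution (T := t) (B := B + Real.exp K)
    (C₀ := G * (β / ε ^ ((1 - β) / 2)))
    (E := fun s y => V s y - z s y)
    (Et := fun s y => Vt s y - (√(1 + strength β ε g s) - 9) / ε * z s y)
    (E1 := fun s y => V1 s y - -(2 * y / ε) * z s y)
    (E2 := fun s y => V2 s y - (-(2 / ε) * z s y + -(2 * y / ε) * (-(2 * y / ε) * z s y)))
    (b := fun s y => μ * g s * hBar β ε y) (c := fun s y => g s * hDer β ε y)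
    ?_ ?_ ?_ ?_ ?_ ?_ ?_ ?_ ?_ (t := t) (ξ := ξ) ⟨ht, le_rfl⟩
  · exact sub_nonneg.1 hmain
  · refine (hc.mono (prod_mono Icc_subset_Ici_self le_rfl)).sub ?_
    simp only [z]; fun_prop
  · intro s hs y
    refine (abs_sub _ _).trans (add_le_add (hB s hs y (mem_univ _)) ?_)
    rw [abs_of_pos (Real.exp_pos _), Real.exp_le_exp]
    have h1 := (le_abs_self _).trans (hK s hs)
    have : 0 ≤ y ^ 2 / ε := by positivity
    linarith
  · exact fun s hs y => (hV.deriv_t s hs.1 y (mem_univ _)).sub (dzt s y)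
  · exact fun s hs y => (hV.deriv_1 s hs.1 y (mem_univ _)).sub (dz s y)
  · exact fun s hs y => (hV.deriv_2 s hs.1 y (mem_univ _)).sub (dz2 s y)
  · intro s _ y
    rw [mul_assoc]
    exact mul_nonneg (mul_nonneg hμ (hg.nonneg s)) (hBar_mul_self_nonneg hβ hε y)
  · intro s _ y
    have := hDer_nonneg hβ hε y
    gcongr
    · exact (le_abs_self _).trans (hG s)
    · exact hDer_le hβ hε y
  · intro s hs y
    have h1 := heq s hs.1 y
    have h2 := subsolution_ineq hβ hε (hg.nonneg s) (ξ := y) (N := strength β ε g s) rfl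
    have h3 : 0 ≤ μ * g s * (hBar β ε y * y) * (2 / ε) :=
      mul_nonneg (mul_nonneg (mul_nonneg hμ (hg.nonneg s)) (hBar_mul_self_nonneg hβ hε y))
        (by positivity)
    have hz : 0 < z s y := Real.exp_pos _
    -- The drift acting on the decreasing Gaussian gives a term of good sign, which adds to
    -- `subsolution_ineq`.
    have h4 : 0 ≤ z s y * (g s * hDer β ε y + μ * g s * (hBar β ε y * y) * (2 / ε)
        - ((√(1 + strength β ε g s) - 1) / ε - 16 * y ^ 2 / ε ^ 2)) :=
      mul_nonneg hz.le (by linarith)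
    refine h4.trans_eq ?_
    linear_combination -h1
  · intro y
    have : growthExp β ε g 0 = 0 := by simp [growthExp]
    simp only [z, h0, this]
    rw [zero_sub, neg_div, sub_self]

/-- Solutions of the Cauchy problem are even in space. -/
lemma even_of_isClassical {V Vt V1 V2 : ℝ → ℝ → ℝ} (hg : IsPulse g g1 g2)
    (hβ : β ∈ Ioo (0 : ℝ) 1) (hε : 0 < ε) (hμ : 0 ≤ μ)
    (hc : ContinuousOn (fun z : ℝ × ℝ => V z.1 z.2) (Ici 0 ×ˢ univ))
    (hV : IsClassical univ V Vt V1 V2)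
    (heq : ∀ t > 0, ∀ ξ, Vt t ξ - 4 * V2 t ξ + μ * g t * hBar β ε ξ * V1 t ξ
        = g t * hDer β ε ξ * V t ξ)
    (h0 : ∀ ξ, V 0 ξ = Real.exp (-ξ ^ 2 / ε)) (hb : IsLocBounded univ V)
    {t : ℝ} (ht : 0 ≤ t) (ξ : ℝ) : V t (-ξ) = V t ξ := by
  obtain ⟨B, hB⟩ := hb t
  obtain ⟨G, hG0, hG⟩ := exists_bound_of_zero hg.cont hg.zero
  -- The difference of `V` and its reflection solves the same linear equation with zero data;
  -- applying the minimum principle at `ξ` and `-ξ` gives equality.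
  have key : ∀ ξ, 0 ≤ V t ξ - V t (-ξ) := by
    intro ξ
    refine nonneg_of_supersolution (T := t) (B := B + B) (C₀ := G * (β / ε ^ ((1 - β) / 2)))
      (E := fun s y => V s y - V s (-y)) (Et := fun s y => Vt s y - Vt s (-y))
      (E1 := fun s y => V1 s y + V1 s (-y)) (E2 := fun s y => V2 s y - V2 s (-y))
      (b := fun s y => μ * g s * hBar β ε y) (c := fun s y => g s * hDer β ε y)
      ?_ ?_ ?_ ?_ ?_ ?_ ?_ ?_ ?_ ⟨ht, le_rfl⟩
    · refine (hc.mono (prod_mono Icc_subset_Ici_self le_rfl)).sub ?_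
      exact hc.comp (f := fun z : ℝ × ℝ => (z.1, -z.2)) (by fun_prop)
        fun z hz => ⟨hz.1.1, mem_univ _⟩
    · exact fun s hs y => (abs_sub _ _).trans
        (add_le_add (hB s hs y (mem_univ _)) (hB s hs (-y) (mem_univ _)))
    · exact fun s hs y => (hV.deriv_t s hs.1 y (mem_univ _)).sub
        (hV.deriv_t s hs.1 (-y) (mem_univ _))
    · exact fun s hs y => ((hV.deriv_1 s hs.1 y (mem_univ _)).sub
        ((hV.deriv_1 s hs.1 (-y) (mem_univ _)).comp y (hasDerivAt_neg y))).congr_deriv (by ring)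
    · exact fun s hs y => ((hV.deriv_2 s hs.1 y (mem_univ _)).add
        ((hV.deriv_2 s hs.1 (-y) (mem_univ _)).comp y (hasDerivAt_neg y))).congr_deriv (by ring)
    · intro s _ y
      rw [mul_assoc]
      exact mul_nonneg (mul_nonneg hμ (hg.nonneg s)) (hBar_mul_self_nonneg hβ hε y)
    · intro s _ y
      have := hDer_nonneg hβ hε y
      gcongr
      · exact (le_abs_self _).trans (hG s)
      · exact hDer_le hβ hε y
    · intro s hs y
      have h1 := heq s hs.1 y
      have h2 := heq s hs.1 (-y)
      rw [hBar_neg, hDer_neg] at h2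
      refine le_of_eq ?_
      linear_combination h2 - h1
    · intro y
      simp [h0]
  have h1 := key ξ
  have h2 := key (-ξ)
  rw [neg_neg] at h2
  linarith

end

/-- A lower bound for solutions with coefficient `coeff p ε` after time `ε/2`. -/
noncomputable def lowerBound (β p ε : ℝ) : ℝ :=
  Real.exp (√(β * ε ^ ((1 + β) / 2 - 1 / p)) / 4 - 10)

section

variable {β p ε : ℝ}

/-- On the plateau `[ε/8, 3ε/8]`, of length `ε/4`, the integrand gains at least `S/ε`, in total
`S/4`; the loss is at most `9t/ε ≤ 9`. -/
lemma le_growthExp_coeff (hε : 0 < ε) {t : ℝ}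
    (ht : t ∈ Icc (ε / 2) ε) :
    √(β * ε ^ ((1 + β) / 2 - 1 / p)) / 4 - 9 ≤ growthExp β ε (coeff p ε) t := by
  set S := √(β * ε ^ ((1 + β) / 2 - 1 / p)) with hS
  have hcs : Continuous fun s => √(1 + strength β ε (coeff p ε) s) := by
    have : Continuous (coeff p ε) := contDiff_coeff.continuous
    unfold strength; fun_prop
  have h1 : growthExp β ε (coeff p ε) t
      = ((∫ s in (0 : ℝ)..t, √(1 + strength β ε (coeff p ε) s)) - 9 * t) / ε := by
    unfold growthExp
    rw [intervalIntegral.integral_div, intervalIntegral.integral_sub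
      (hcs.intervalIntegrable _ _) (by simp)]
    simp [mul_comm]
  have h2 : ∫ s in (ε / 8)..(3 * ε / 8), S
      ≤ ∫ s in (0 : ℝ)..t, √(1 + strength β ε (coeff p ε) s) := by
    refine le_trans (intervalIntegral.integral_mono_on (by linarith) (by simp)
      (hcs.intervalIntegrable _ _) (fun s hs => ?_))
      (intervalIntegral.integral_mono_interval (c := 0) (d := t) (by linarith) (by linarith)
        (by linarith [ht.1]) (Eventually.of_forall fun s => Real.sqrt_nonneg _)
        (hcs.intervalIntegrable _ _))
    refine Real.sqrt_le_sqrt ?_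
    unfold strength
    rw [coeff_eq_of_mem hε hs, mul_assoc, ← Real.rpow_add hε, ← sub_eq_add_neg]
    linarith
  rw [intervalIntegral.integral_const, smul_eq_mul] at h2
  rw [h1, le_div_iff₀ hε]
  have h3 : (3 * ε / 8 - ε / 8) * S = S / 4 * ε := by ring
  rw [h3] at h2
  nlinarith [ht.2]

lemma exists_le_lowerBound (hβ : β ∈ Ioo (0 : ℝ) 1) (hp : p ∈ Ioo (0 : ℝ) (2 / (1 + β))) :
    ∃ C, 0 < C ∧ ∀ ε ∈ Ioo (0 : ℝ) 1, C / ε ^ 2 ≤ lowerBound β p ε := by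
  have hβ0 := hβ.1
  set δ := 1 / p - (1 + β) / 2 with hδ
  have hδ0 : 0 < δ := by
    have h1 := hp.2
    rw [lt_div_iff₀ (by linarith)] at h1
    rw [hδ, sub_pos, div_lt_div_iff₀ (by norm_num) hp.1]
    linarith
  -- From `exp x ≥ x ^ n / n!` with `x` of order `ε ^ (-δ/2)`, this `n` yields at least `ε ^ (-2)`.
  obtain ⟨n, hn⟩ := exists_nat_ge (4 / δ)
  rw [div_le_iff₀ hδ0] at hn
  refine ⟨Real.exp (-10) * ((√β / 4) ^ n / n.factorial), by positivity, fun ε hε => ?_⟩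
  have hε0 := hε.1
  have h1 : √(β * ε ^ ((1 + β) / 2 - 1 / p)) = √β * ε ^ (-(δ / 2)) := by
    rw [Real.sqrt_mul hβ.1.le, Real.sqrt_eq_rpow (ε ^ _), ← Real.rpow_mul hε0.le]
    congr 2; rw [hδ]; ring
  have h2 : (ε ^ 2)⁻¹ ≤ (ε ^ (-(δ / 2))) ^ n := by
    rw [← Real.rpow_natCast, ← Real.rpow_natCast, ← Real.rpow_mul hε0.le, ← Real.rpow_neg hε0.le]
    refine Real.rpow_le_rpow_of_exponent_ge hε0 hε.2.le ?_
    push_cast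
    nlinarith
  unfold lowerBound
  rw [h1, sub_eq_add_neg, Real.exp_add, mul_div_assoc, mul_comm (Real.exp (-10))]
  refine mul_le_mul_of_nonneg_right ?_ (Real.exp_pos _).le
  calc (√β / 4) ^ n / n.factorial / ε ^ 2
      = (√β / 4) ^ n / n.factorial * (ε ^ 2)⁻¹ := by rw [div_eq_mul_inv]
    _ ≤ (√β / 4) ^ n / n.factorial * (ε ^ (-(δ / 2))) ^ n := by gcongr
    _ = (√β * ε ^ (-(δ / 2)) / 4) ^ n / n.factorial := by rw [div_mul_eq_mul_div, ← mul_pow]; ring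
    _ ≤ Real.exp (√β * ε ^ (-(δ / 2)) / 4) :=
        Real.pow_div_factorial_le_exp _ (by have := Real.rpow_pos_of_pos hε0 (-(δ / 2)); positivity) _

/-- Solvability of the Cauchy problem with the concentrating coefficient. -/
theorem exists_solution_coeff (hβ : β ∈ Ioo (0 : ℝ) 1) (hε : ε ∈ Ioo (0 : ℝ) 1) {μ : ℝ}
    (hμ : 0 ≤ μ) :
    ∃ V Vt V1 V2 : ℝ → ℝ → ℝ,
      ContinuousOn (fun z : ℝ × ℝ => V z.1 z.2) (Ici 0 ×ˢ univ) ∧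
      IsClassical univ V Vt V1 V2 ∧
      (∀ t > 0, ∀ ξ, Vt t ξ - 4 * V2 t ξ + μ * coeff p ε t * hBar β ε ξ * V1 t ξ
        = coeff p ε t * hDer β ε ξ * V t ξ) ∧
      (∀ ξ, V 0 ξ = Real.exp (-ξ ^ 2 / ε)) ∧
      (∀ T, ∃ C, ∃ d > 0, ∀ t ∈ Icc 0 T, ∀ ξ, |V t ξ| ≤ C * Real.exp (-d * ξ ^ 2)) ∧
      IsLocBounded univ V ∧
      (∀ t ≥ 0, ∀ ξ, V t (-ξ) = V t ξ) ∧
      ∀ t ∈ Icc (ε / 2) ε, ∀ ξ, |ξ| ≤ √ε → lowerBound β p ε ≤ V t ξ := by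
  have hg := isPulse_coeff (p := p) hε
  obtain ⟨V, Vt, V1, V2, hc, hV, heq, h0, hdec⟩ := hg.exists_solution hβ hε.1 μ
  have hb : IsLocBounded univ V := by
    intro T
    obtain ⟨C, d, hd, h⟩ := hdec T
    refine ⟨|C|, fun t ht ξ _ => (h t ht ξ).trans ?_⟩
    have h1 : Real.exp (-d * ξ ^ 2) ≤ 1 := by
      rw [Real.exp_le_one_iff]; nlinarith [mul_nonneg hd.le (sq_nonneg ξ)]
    calc C * Real.exp (-d * ξ ^ 2) ≤ |C| * 1 := by gcongr; exact le_abs_self C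
      _ = |C| := mul_one _
  refine ⟨V, Vt, V1, V2, hc, hV, heq, h0, hdec, hb,
    fun t ht ξ => even_of_isClassical hg hβ hε.1 hμ hc hV heq h0 hb ht ξ, fun t ht ξ hξ => ?_⟩
  refine le_trans ?_ (exp_growthExp_le hg hβ hε.1 hμ hc hV heq h0 hb
    (by linarith [ht.1, hε.1]) ξ)
  unfold lowerBound
  rw [Real.exp_le_exp]
  have h1 := le_growthExp_coeff (β := β) (p := p) hε.1 ht
  -- Within `√ε` of the origin the Gaussian costs at most one unit in the exponent, turning 9 into
  -- the 10 of `lowerBound`.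
  have h2 : ξ ^ 2 / ε ≤ 1 := by
    rw [div_le_one hε.1, ← sq_abs]
    calc |ξ| ^ 2 ≤ √ε ^ 2 := by gcongr
      _ = ε := Real.sq_sqrt hε.1.le
  linarith

end

/-! ### Norms and the non-local problem -/

/-- Lower bound of an `L^q` norm by the values on a short interval. -/
lemma mul_le_eLpNorm {ε : Type*} [TopologicalSpace ε] [ContinuousENorm ε] {f : ℝ → ε}
    {q c : ℝ≥0∞} (hq : 1 ≤ q) {μ : Measure ℝ} {a b : ℝ} (hab : a < b) (hb : b - a ≤ 1)
    (hμ : volume.restrict (Ioo a b) ≤ μ) (h : ∀ t ∈ Ioo a b, c ≤ ‖f t‖ₑ) :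
    c * ENNReal.ofReal (b - a) ≤ eLpNorm f q μ := by
  have hne : volume.restrict (Ioo a b) ≠ 0 := by
    rw [Ne, Measure.restrict_eq_zero, Real.volume_Ioo]
    simpa using hab
  calc c * ENNReal.ofReal (b - a)
      ≤ c * (volume.restrict (Ioo a b)) univ ^ (1 / q.toReal) := by
        gcongr
        rw [Measure.restrict_apply_univ, Real.volume_Ioo]
        conv_lhs => rw [← ENNReal.rpow_one (ENNReal.ofReal (b - a))]
        -- For a length at most one, its power `1/q` is at least the length itself; this handles all
        -- `q` at once.
        refine ENNReal.rpow_le_rpow_of_exponent_ge (ENNReal.ofReal_le_one.2 hb) ?_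
        by_cases hq' : q = ⊤
        · simp [hq']
        · have : 1 ≤ q.toReal := by
            simpa using ENNReal.toReal_mono hq' hq
          rw [div_le_one (by linarith)]
          exact this
    _ = eLpNorm (fun _ : ℝ => c) q (volume.restrict (Ioo a b)) := by
        rw [eLpNorm_const c (by positivity) hne, enorm_eq_self]
    _ ≤ eLpNorm f q (volume.restrict (Ioo a b)) := by
        refine eLpNorm_mono_enorm_ae ?_
        filter_upwards [ae_restrict_mem measurableSet_Ioo] with t ht
        simpa using h t ht
    _ ≤ eLpNorm f q μ := eLpNorm_mono_measure _ hμ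

/-- Lower bound of the essential supremum by the values on an interval. -/
lemma le_eLpNorm_top {f : ℝ → ℝ} {c : ℝ≥0∞} {a b : ℝ} (hab : a < b)
    (h : ∀ t ∈ Ioo a b, c ≤ ‖f t‖ₑ) : c ≤ eLpNorm f ∞ volume := by
  have hne : volume.restrict (Ioo a b) ≠ 0 := by
    rw [Ne, Measure.restrict_eq_zero, Real.volume_Ioo]
    simpa using hab
  calc c = eLpNorm (fun _ : ℝ => c) ∞ (volume.restrict (Ioo a b)) := by
        rw [eLpNorm_const c (by simp) hne]; simp
    _ ≤ eLpNorm f ∞ (volume.restrict (Ioo a b)) := by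
        refine eLpNorm_mono_enorm_ae ?_
        filter_upwards [ae_restrict_mem measurableSet_Ioo] with t ht
        simpa using h t ht
    _ ≤ eLpNorm f ∞ volume := eLpNorm_mono_measure _ Measure.restrict_le_self

/-- Freezing `F` at its value at time `a` for earlier times gives a jointly continuous function on
the plane. -/
lemma continuousOn_prim_Ici {F : ℝ → ℝ → ℝ} {a : ℝ}
    (hF : ContinuousOn (fun z : ℝ × ℝ => F z.1 z.2) (Ici a ×ˢ univ)) :
    ContinuousOn (fun z : ℝ × ℝ => prim F z.1 z.2) (Ici a ×ˢ univ) := by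
  have h : Continuous fun z : ℝ × ℝ => F (max z.1 a) z.2 := by
    rw [← continuousOn_univ]
    exact hF.comp (f := fun z : ℝ × ℝ => (max z.1 a, z.2)) (by fun_prop)
      fun z _ => ⟨le_max_right z.1 a, mem_univ _⟩
  refine (continuous_prim (F := fun s ξ => F (max s a) ξ) h).continuousOn.congr fun z hz => ?_
  have : a ≤ z.1 := hz.1
  simp [prim, max_eq_left this]

lemma continuousOn_prim_Ioi {F : ℝ → ℝ → ℝ}
    (hF : ContinuousOn (fun z : ℝ × ℝ => F z.1 z.2) (Ioi 0 ×ˢ univ)) :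
    ContinuousOn (fun z : ℝ × ℝ => prim F z.1 z.2) (Ioi 0 ×ˢ univ) := by
  intro z hz
  have hz0 : 0 < z.1 := hz.1
  have h := continuousOn_prim_Ici (F := F) (a := z.1 / 2)
    (hF.mono (prod_mono (fun x hx => lt_of_lt_of_le (half_pos hz0) hx) le_rfl))
  refine (h.continuousAt ?_).continuousWithinAt
  exact prod_mem_nhds (Ici_mem_nhds (by linarith)) univ_mem

lemma abs_integral_le_of_gauss {f : ℝ → ℝ} {C d : ℝ} (hd : 0 < d) (hf : Continuous f)
    (h : ∀ ξ, |f ξ| ≤ C * Real.exp (-d * ξ ^ 2)) (ξ : ℝ) :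
    |∫ η in (0 : ℝ)..ξ, f η| ≤ C * √(Real.pi / d) := by
  have hint : Integrable f := ((integrable_exp_neg_mul_sq hd).const_mul C).mono'
    hf.aestronglyMeasurable (Eventually.of_forall h)
  calc |∫ η in (0 : ℝ)..ξ, f η| ≤ ∫ η in uIoc 0 ξ, ‖f η‖ := by
        rw [← Real.norm_eq_abs]
        exact intervalIntegral.norm_integral_le_integral_norm_uIoc
    _ ≤ ∫ η, ‖f η‖ := setIntegral_le_integral hint.norm (Eventually.of_forall fun _ => norm_nonneg _)
    _ ≤ ∫ η, C * Real.exp (-d * η ^ 2) :=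
        integral_mono hint.norm ((integrable_exp_neg_mul_sq hd).const_mul C) h
    _ = _ := by rw [integral_const_mul, integral_gaussian]

lemma integral_gauss_le {ε ξ : ℝ} (hε : 0 < ε) (hξ : 0 ≤ ξ) :
    ∫ η in (0 : ℝ)..ξ, Real.exp (-η ^ 2 / ε) ≤ √ε := by
  have hd : 0 < 1 / ε := by positivity
  have e : ∀ η : ℝ, Real.exp (-η ^ 2 / ε) = Real.exp (-(1 / ε) * η ^ 2) := fun η => by
    congr 1; ring
  simp_rw [e]
  rw [intervalIntegral.integral_of_le hξ]
  calc ∫ η in Ioc 0 ξ, Real.exp (-(1 / ε) * η ^ 2)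
      ≤ ∫ η in Ioi 0, Real.exp (-(1 / ε) * η ^ 2) :=
        setIntegral_mono_set (integrable_exp_neg_mul_sq hd).integrableOn
          (Eventually.of_forall fun _ => (Real.exp_pos _).le)
          (Eventually.of_forall fun _ hx => hx.1)
    _ = √(Real.pi / (1 / ε)) / 2 := integral_gaussian_Ioi _
    _ ≤ √(4 * ε) / 2 := by
        gcongr
        rw [div_div_eq_mul_div, div_one]
        have := Real.pi_le_four
        gcongr
    _ = √ε := by
        rw [Real.sqrt_mul (by norm_num), show (4 : ℝ) = 2 ^ 2 by norm_num,
          Real.sqrt_sq (by norm_num)]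
        ring

section

variable {β p : ℝ}

lemma exists_isSolution (hβ : β ∈ Ioo (0 : ℝ) 1) {μ₁ : ℝ} (hμ : 0 ≤ μ₁) {ε : ℝ}
    (hε : ε ∈ Ioo (0 : ℝ) 1) :
    ∃ V : ℝ → ℝ → ℝ, IsSolution β ε μ₁ (coeff p ε) V ∧
      (∀ t ≥ 0, ∀ ξ, V t (-ξ) = V t ξ) ∧
      ∀ t ∈ Icc (ε / 2) ε, ∀ ξ, |ξ| ≤ √ε → lowerBound β p ε ≤ V t ξ := by
  obtain ⟨V, Vt, V1, V2, hc, hV, heq, h0, -, hb, heven, hlow⟩ :=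
    exists_solution_coeff (p := p) hβ hε hμ
  refine ⟨V, ⟨hc, hb, hV.isC12 isOpen_univ, fun t ht ξ => ?_, h0⟩, heven, hlow⟩
  rw [(hV.deriv_t t ht ξ (mem_univ _)).deriv, (hV.deriv_1 t ht ξ (mem_univ _)).deriv,
    (hV.deriv_two isOpen_univ ht (mem_univ ξ)).deriv, deriv_hBar hβ hε.1]
  exact heq t ht ξ

/-- Norm inflation for the drift equation. -/
theorem exists_inflating_solutions (hβ : β ∈ Ioo (0 : ℝ) 1) (hp : p ∈ Ioo (0 : ℝ) (2 / (1 + β)))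
    {μ₁ : ℝ} (hμ : 0 ≤ μ₁) :
    ∃ (g : ℝ → ℝ → ℝ) (V : ℝ → ℝ → ℝ → ℝ),
      (∀ ε ∈ Ioo (0 : ℝ) 1, IsAdmissibleCoeff p (g ε) ∧ IsSolution β ε μ₁ (g ε) (V ε) ∧
        ∀ t ≥ 0, ∀ ξ : ℝ, V ε t (-ξ) = V ε t ξ) ∧
      (∃ C : ℝ, 0 < C ∧ ∀ ε ∈ Ioo (0 : ℝ) 1, ∀ T : ℝ, ε ≤ T →
        ENNReal.ofReal (C * ε⁻¹) ≤ ∫⁻ t in Ioo 0 T, eLpNorm (V ε t) ∞ volume) ∧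
      (∀ q : ℝ≥0∞, 1 ≤ q → ∀ T : ℝ, 0 < T → ∀ M : ℝ, ∃ ε ∈ Ioo (0 : ℝ) 1,
        ENNReal.ofReal M <
          eLpNorm (fun t => eLpNorm (V ε t) ∞ volume) q (volume.restrict (Ioo 0 T))) := by
  have hex : ∀ ε : ℝ, ∃ V : ℝ → ℝ → ℝ, ε ∈ Ioo (0 : ℝ) 1 → IsSolution β ε μ₁ (coeff p ε) V ∧
      (∀ t ≥ 0, ∀ ξ, V t (-ξ) = V t ξ) ∧
      ∀ t ∈ Icc (ε / 2) ε, ∀ ξ, |ξ| ≤ √ε → lowerBound β p ε ≤ V t ξ := by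
    intro ε
    by_cases h : ε ∈ Ioo (0 : ℝ) 1
    · obtain ⟨V, hV⟩ := exists_isSolution (p := p) hβ hμ h
      exact ⟨V, fun _ => hV⟩
    -- Arbitrary value, never used outside `(0,1)`.
    · exact ⟨0, fun h' => absurd h' h⟩
  choose V hV using hex
  obtain ⟨C, hC0, hC⟩ := exists_le_lowerBound hβ hp
  have hsup : ∀ ε ∈ Ioo (0 : ℝ) 1, ∀ t ∈ Ioo (ε / 2) ε,
      ENNReal.ofReal (lowerBound β p ε) ≤ eLpNorm (V ε t) ∞ volume := by
    intro ε hε t ht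
    have hs : 0 < √ε := Real.sqrt_pos.2 hε.1
    refine le_eLpNorm_top (a := -√ε) (b := √ε) (by linarith) fun ξ hξ => ?_
    have h1 := (hV ε hε).2.2 t (Ioo_subset_Icc_self ht) ξ (abs_le.2 ⟨hξ.1.le, hξ.2.le⟩)
    rw [Real.enorm_eq_ofReal_abs]
    exact ENNReal.ofReal_le_ofReal (h1.trans (le_abs_self _))
  have hmass : ∀ ε ∈ Ioo (0 : ℝ) 1, ∀ q : ℝ≥0∞, 1 ≤ q → ∀ T, ε ≤ T →
      ENNReal.ofReal (C / 2 * ε⁻¹) ≤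
        eLpNorm (fun t => eLpNorm (V ε t) ∞ volume) q (volume.restrict (Ioo 0 T)) := by
    intro ε hε q hq T hT
    have hε0 := hε.1
    refine le_trans ?_ (mul_le_eLpNorm (c := ENNReal.ofReal (lowerBound β p ε)) (a := ε / 2)
      (b := ε) hq (by linarith) (by linarith [hε.2])
      (Measure.restrict_mono (Ioo_subset_Ioo (by linarith) hT) le_rfl)
      fun t ht => by simpa using hsup ε hε t ht)
    rw [← ENNReal.ofReal_mul (p := lowerBound β p ε) (Real.exp_pos _).le]
    refine ENNReal.ofReal_le_ofReal ?_
    have h1 := hC ε hε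
    -- Size `C/ε²` on a time interval of length `ε/2`.
    calc C / 2 * ε⁻¹ = C / ε ^ 2 * (ε - ε / 2) := by field_simp; ring
      _ ≤ lowerBound β p ε * (ε - ε / 2) := by
          gcongr; linarith
  refine ⟨fun ε => coeff p ε, V, fun ε hε => ⟨isAdmissibleCoeff_coeff hp.1 hε.1, (hV ε hε).1,
    (hV ε hε).2.1⟩, ⟨C / 2, by positivity, fun ε hε T hT => ?_⟩, fun q hq T hT M => ?_⟩
  · have := hmass ε hε 1 le_rfl T hT
    rw [eLpNorm_one_eq_lintegral_enorm] at this
    simpa using this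
  · have hM : 0 < |M| + 1 := by positivity
    obtain ⟨ε, hε0, hε⟩ : ∃ ε > 0, ε < min (min T 1) (C / 2 / (|M| + 1)) :=
      exists_between (lt_min (lt_min hT one_pos) (by positivity))
    have h1 : ε < T := hε.trans_le ((min_le_left _ _).trans (min_le_left _ _))
    have h2 : ε < 1 := hε.trans_le ((min_le_left _ _).trans (min_le_right _ _))
    have h3 : ε < C / 2 / (|M| + 1) := hε.trans_le (min_le_right _ _)
    refine ⟨ε, ⟨hε0, h2⟩, lt_of_lt_of_le ?_ (hmass ε ⟨hε0, h2⟩ q hq T h1.le)⟩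
    rw [ENNReal.ofReal_lt_ofReal_iff (by positivity), ← div_eq_mul_inv, lt_div_iff₀ hε0]
    rw [lt_div_iff₀ hM] at h3
    nlinarith [le_abs_self M]

/-- Failure of the minimum principle for the non-local problem. -/
theorem exists_negative_nonlocal_solution (hβ : β ∈ Ioo (0 : ℝ) 1)
    (hp : p ∈ Ioo (0 : ℝ) (2 / (1 + β))) {k₁ k₂ : ℝ} (hk₁ : 0 ≤ k₁) (hk₂ : 0 < k₂) :
    ∃ ε ∈ Ioo (0 : ℝ) 1, ∃ (g : ℝ → ℝ) (Ω : ℝ → ℝ → ℝ),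
      IsAdmissibleCoeff p g ∧ IsNonlocalSolution β ε k₁ g Ω ∧ (∀ ξ ≥ 0, 0 ≤ Ω 0 ξ) ∧
      (∀ t ≥ 0, Ω t 0 = t * k₁ + k₂) ∧ ∃ t > 0, ∃ ξ > 0, Ω t ξ < 0 := by
  obtain ⟨C, hC0, hC⟩ := exists_le_lowerBound hβ hp
  -- This threshold makes `k₂ * (C/ε)` exceed `k₂ + k₁`, the bound for the boundary value at time
  -- `ε`.
  obtain ⟨ε, hε0, hε⟩ : ∃ ε > 0, ε < min 1 (C * k₂ / (k₂ + k₁)) :=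
    exists_between (lt_min one_pos (by positivity))
  have hε1 : ε < 1 := hε.trans_le (min_le_left _ _)
  have hεk : ε < C * k₂ / (k₂ + k₁) := hε.trans_le (min_le_right _ _)
  have hεI : ε ∈ Ioo (0 : ℝ) 1 := ⟨hε0, hε1⟩
  obtain ⟨V, Vt, V1, V2, hc, hV, heq, h0, hdec, hb, heven, hlow⟩ :=
    exists_solution_coeff (p := p) hβ hεI le_rfl
  have hs : 0 < √ε := Real.sqrt_pos.2 hε0
  -- The largest multiple for which the mass bound `√ε` keeps the initial value non-negative.
  set κ := k₂ / √ε with hκ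
  have hκ0 : 0 < κ := by positivity
  have hκs : κ * √ε = k₂ := by rw [hκ]; field_simp
  have slice : ∀ t ≥ 0, Continuous (V t) := fun t ht => by
    rw [← continuousOn_univ]
    exact hc.comp (f := fun y => (t, y)) (by fun_prop) fun y _ => ⟨ht, mem_univ _⟩
  have slice' : ∀ {W : ℝ → ℝ → ℝ}, ContinuousOn (fun z : ℝ × ℝ => W z.1 z.2) (Ioi 0 ×ˢ univ) →
      ∀ t > 0, Continuous (W t) := fun hW t ht => by
    rw [← continuousOn_univ]
    exact hW.comp (f := fun y => (t, y)) (by fun_prop) fun y _ => ⟨ht, mem_univ _⟩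
  let Ω : ℝ → ℝ → ℝ := fun t ξ => k₂ + t * k₁ - κ * prim V t ξ
  have dΩ : ∀ t ≥ 0, ∀ ξ, HasDerivAt (Ω t) (-(κ * V t ξ)) ξ := fun t ht ξ =>
    ((hasDerivAt_prim (slice t ht) ξ).const_mul κ).const_sub (k₂ + t * k₁)
  have hΩ : IsClassical (Ioi 0) Ω (fun t ξ => k₁ - κ * prim Vt t ξ) (fun t ξ => -(κ * V t ξ))
      (fun t ξ => -(κ * V1 t ξ)) := by
    have sub : Ioi (0 : ℝ) ×ˢ Ioi (0 : ℝ) ⊆ Ioi 0 ×ˢ univ := prod_mono le_rfl (subset_univ _)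
    have sub' : Ioi (0 : ℝ) ×ˢ (univ : Set ℝ) ⊆ Ici 0 ×ˢ univ := prod_mono Ioi_subset_Ici_self le_rfl
    exact {
      deriv_t := fun t ht ξ _ => by
        have h1 := hasDerivAt_prim_time isOpen_Ioi (hc.mono sub') hV.cont_t
          (fun s hs ξ => hV.deriv_t s hs ξ (mem_univ _)) ht ξ
        exact ((((hasDerivAt_id t).mul_const k₁).const_add k₂).sub
          (h1.const_mul κ)).congr_deriv (by simp)
      deriv_1 := fun t ht ξ _ => dΩ t (le_of_lt ht) ξ
      deriv_2 := fun t ht ξ _ => ((hV.deriv_1 t ht ξ (mem_univ _)).const_mul κ).neg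
      cont_t := continuousOn_const.sub
        (continuousOn_const.mul ((continuousOn_prim_Ioi hV.cont_t).mono sub))
      cont_1 := (continuousOn_const.mul (hc.mono (sub.trans sub'))).neg
      cont_2 := (continuousOn_const.mul (hV.cont_1.mono sub)).neg }
  refine ⟨ε, hεI, coeff p ε, Ω, isAdmissibleCoeff_coeff hp.1 hε0, ⟨?_, ?_, hΩ.isC12 isOpen_Ioi,
    ?_, ?_⟩, ?_, ?_, ε, hε0, √ε, hs, ?_⟩
  · have h1 : ContinuousOn (fun z : ℝ × ℝ => prim V z.1 z.2) (Ici 0 ×ˢ Ici 0) :=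
      (continuousOn_prim_Ici hc).mono (prod_mono le_rfl (subset_univ _))
    simp only [Ω]
    fun_prop
  · intro T
    obtain ⟨D, d, hd, h⟩ := hdec T
    refine ⟨k₂ + |T| * k₁ + κ * (D * √(Real.pi / d)), fun t ht ξ _ => ?_⟩
    have h1 := abs_integral_le_of_gauss hd (slice t ht.1) (h t ht) ξ
    have ht' : t * k₁ ≤ |T| * k₁ := by gcongr; exact ht.2.trans (le_abs_self T)
    have ht0 : 0 ≤ t * k₁ := mul_nonneg ht.1 hk₁
    refine (abs_sub _ _).trans (add_le_add ?_ ?_)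
    · rw [abs_of_nonneg (by linarith)]; linarith
    · rw [abs_mul, abs_of_pos hκ0]; gcongr; exact h1
  · intro t ht ξ _
    rw [show deriv (Ω t) = fun ξ => -(κ * V t ξ) from funext fun ξ => (dΩ t ht.le ξ).deriv,
      deriv_hBar hβ hε0]
    have h1 := slice t ht.le
    have h2 := continuous_hDer hβ hε0
    exact Continuous.intervalIntegrable (by fun_prop) _ _
  · intro t ht ξ hξ
    have hcV := slice t ht.le
    have hcV2 := slice' hV.cont_2 t ht
    have hch := continuous_hDer hβ hε0
    rw [(hΩ.deriv_t t ht ξ hξ).deriv, (hΩ.deriv_two isOpen_Ioi ht hξ).deriv,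
      show deriv (Ω t) = fun ξ => -(κ * V t ξ) from funext fun ξ => (dΩ t ht.le ξ).deriv,
      deriv_hBar hβ hε0]
    -- Evenness kills the boundary term at the origin when the equation for `V` is integrated from
    -- `0` to `ξ`.
    have hV10 : V1 t 0 = 0 := by
      have h1 := hV.deriv_1 t ht 0 (mem_univ _)
      have h2 : HasDerivAt (fun x => V t (-x)) (-V1 t 0) 0 :=
        ((hV.deriv_1 t ht (-0) (mem_univ _)).comp 0 (hasDerivAt_neg 0)).congr_deriv (by
          rw [neg_zero]; ring)
      rw [show (fun x => V t (-x)) = V t from funext fun x => heven t ht.le x] at h2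
      linarith [h1.unique h2]
    have hV2 : ∫ η in (0 : ℝ)..ξ, V2 t η = V1 t ξ := by
      rw [intervalIntegral.integral_eq_sub_of_hasDerivAt
        (fun x _ => hV.deriv_2 t ht x (mem_univ _)) (hcV2.intervalIntegrable _ _), hV10, sub_zero]
    have hVt : prim Vt t ξ
        = 4 * V1 t ξ + coeff p ε t * ∫ η in (0 : ℝ)..ξ, hDer β ε η * V t η := by
      unfold prim
      rw [← hV2, ← intervalIntegral.integral_const_mul, ← intervalIntegral.integral_const_mul,
        ← intervalIntegral.integral_add (Continuous.intervalIntegrable (by fun_prop) _ _)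
          (Continuous.intervalIntegrable (by fun_prop) _ _)]
      congr 1; ext η
      linear_combination heq t ht η
    have hI : ∫ η in (0 : ℝ)..ξ, hDer β ε η * -(κ * V t η)
        = -κ * ∫ η in (0 : ℝ)..ξ, hDer β ε η * V t η := by
      rw [← intervalIntegral.integral_const_mul]
      congr 1; ext η; ring
    rw [hI, hVt]
    ring
  · intro ξ hξ
    have h1 : prim V 0 ξ ≤ √ε := by
      unfold prim
      simp_rw [h0]
      exact integral_gauss_le hε0 hξ
    have h2 : κ * prim V 0 ξ ≤ κ * √ε := by gcongr
    simp only [Ω]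
    linarith
  · intro t _
    simp [Ω, prim]
    ring
  · have hmem : ε ∈ Icc (ε / 2) ε := ⟨by linarith, le_rfl⟩
    have h1 : √ε * lowerBound β p ε ≤ prim V ε √ε := by
      have := intervalIntegral.integral_mono_on (a := 0) (b := √ε) (f := fun _ => lowerBound β p ε)
        (g := V ε) (μ := volume) hs.le (continuous_const.intervalIntegrable _ _) ((slice ε hε0.le).intervalIntegrable _ _)
        (fun x hx => hlow ε hmem x (by rw [abs_of_nonneg hx.1]; exact hx.2))
      simpa [prim] using this
    have h2 : k₂ * lowerBound β p ε ≤ κ * prim V ε √ε := by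
      rw [← hκs, mul_assoc]; gcongr
    have h3 := hC ε hεI
    have h4 : k₂ + k₁ < k₂ * lowerBound β p ε := by
      rw [lt_div_iff₀ (by positivity)] at hεk
      calc k₂ + k₁ < C * k₂ / ε := by rw [lt_div_iff₀ hε0]; linarith
        _ = k₂ * (C / ε) := by ring
        _ ≤ k₂ * (C / ε ^ 2) := by
            gcongr
            nlinarith
        _ ≤ _ := by gcongr
    simp only [Ω]
    nlinarith

end

end DriftExample

theorem propositionB (β : ℝ) (hβ : β ∈ Ioo (0 : ℝ) 1)
    (p : ℝ) (hp : p ∈ Ioo (0 : ℝ) (2 / (1 + β))) :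
    (∀ μ₁ : ℝ, 0 ≤ μ₁ →
      ∃ (g : ℝ → ℝ → ℝ) (V : ℝ → ℝ → ℝ → ℝ),
        (∀ ε ∈ Ioo (0 : ℝ) 1,
          DriftExample.IsAdmissibleCoeff p (g ε) ∧
          DriftExample.IsSolution β ε μ₁ (g ε) (V ε) ∧
          ∀ t ≥ 0, ∀ ξ : ℝ, V ε t (-ξ) = V ε t ξ) ∧
        (∃ C : ℝ, 0 < C ∧ ∀ ε ∈ Ioo (0 : ℝ) 1, ∀ T : ℝ, ε ≤ T →
          ENNReal.ofReal (C * ε⁻¹) ≤ ∫⁻ t in Ioo 0 T, eLpNorm (V ε t) ∞ volume) ∧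
        (∀ q : ℝ≥0∞, 1 ≤ q → ∀ T : ℝ, 0 < T → ∀ M : ℝ, ∃ ε ∈ Ioo (0 : ℝ) 1,
          ENNReal.ofReal M <
            eLpNorm (fun t => eLpNorm (V ε t) ∞ volume) q (volume.restrict (Ioo 0 T)))) ∧
    (∀ k₁ k₂ : ℝ, 0 ≤ k₁ → 0 < k₂ →
      ∃ ε ∈ Ioo (0 : ℝ) 1, ∃ (g : ℝ → ℝ) (Ω : ℝ → ℝ → ℝ),
        DriftExample.IsAdmissibleCoeff p g ∧
        DriftExample.IsNonlocalSolution β ε k₁ g Ω ∧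
        (∀ ξ ≥ 0, 0 ≤ Ω 0 ξ) ∧
        (∀ t ≥ 0, Ω t 0 = t * k₁ + k₂) ∧
        ∃ t > 0, ∃ ξ > 0, Ω t ξ < 0) := by
  refine ⟨fun μ₁ hμ => DriftExample.exists_inflating_solutions hβ hp hμ, fun k₁ k₂ hk₁ hk₂ =>
    DriftExample.exists_negative_nonlocal_solution hβ hp hk₁ hk₂⟩
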